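/- Let $n\ge 2$, let $G=\mathbb Z_n$, and let $\rho:G\to\mathbb C^\times$ be a faithful one-dimensional representation. Setting. For $N\ge 1$ let $B_N=[-N,N]^4\cap\mathbb Z^4$. Let $C_1(B_N)$ be the set of oriented nearest-neighbour edges (of both orientations) with end points in $B_N$, and $C_2(B_N)$ the set of oriented unit lattice squares (plaquettes, of both orientations) whose corners lie in $B_N$. Let $\Omega^1(B_N,G)$ be the set of functions $\sigma:C_1(B_N)\to G$ with $\sigma(-e)=-\sigma(e)$, and for $p\in C_2(B_N)$ let $d\sigma(p)$ be the sum of $\sigma$ over the four boundary edges of $p$, directed according to the orientation of $p$. For $\beta\ge 0$ let $\mu_{N,\beta}$ be the probability measure on $\Omega^1(B_N,G)$ with $\mu_{N,\beta}(\sigma)\propto\exp\bigl(\beta\sum_{p\in C_2(B_N)}\Re\rho(d\sigma(p))\bigr)$, and $\mathbb E_{N,\beta}$ its expectation. A generalized loop in $\mathbb Z^4$ is a finite formal sum $\gamma=\sum_e\gamma[e]\,e$ of positively oriented edges of $\mathbb Z^4$ with $\gamma[e]\in\{-1,0,1\}$ and $\partial\gamma=0$, where $\partial e$ is the end point minus the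 starting point of $e$. Its length $\ell$ is the number of edges $e$ with $\gamma[e]\ne0$. Such an edge $e$ is a corner edge if there is another edge $e'\neq e$ with $\gamma[e']\neq 0$ such that $e$ and $e'$ both lie, up to orientation, in the boundary of a common plaquette; $\ell_c$ is the number of corner edges. For $N$ so large that $B_N$ contains $\gamma$, put $W_\gamma(\sigma)=\rho\bigl(\sum_e\gamma[e]\sigma(e)\bigr)$. Finally let $$\theta(\beta)=\frac{\sum_{g\in G}\rho(g)e^{12\beta\Re\rho(g)}}{\sum_{g\in G}e^{12\beta\Re\rho(g)}},\qquad \lambda(\beta)=\max_{g\in G\setminus\{0\}}\frac{e^{\beta\Re\rho(g)}}{e^{\beta\Re\rho(0)}}=e^{-\beta(1-\cos(2\pi/n))}.$$ Theorem. For all sufficiently large $\beta_0>0$ there are constants $K'>0$ and $K''>0$, depending only on $\beta_0$, $n$ and $\rho$, such that for every $\beta\ge\beta_0$ and every generalized loop $\gamma$ in $\mathbb Z^4$, with $\ell$ and $\ell_c$ as above, the limit $\langle W_\gamma\rangle_\beta=\lim_{N\to\infty}\mathbb E_{N,\beta}[W_\gamma]$ exists and $$\Bigl|\langle W_\gamma\rangle_\beta-e^{-\ell(1-\theta(\beta))}\Bigr|\le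 K'\Bigl[\sqrt{\tfrac{\ell_c}{\ell}}+\lambda(\beta)^2\Bigr]^{K''}$$ (for the empty loop, $\ell_c/\ell$ is read as $0$). -/

import Mathlib

namespace LatticeGauge

/-! ### The cell complex of `ℤ⁴` in dimensions 0, 1, 2 -/

/-- Vertices of the lattice `ℤ⁴`. -/
abbrev Vertex := Fin 4 → ℤ

/-- The unit vector `e_i`. -/
def unitVec (i : Fin 4) : Vertex := Pi.single i 1

/-- Positively oriented edges: `(a, i)` is the edge from `a` to `a + e_i`. -/
abbrev Edge := Vertex × Fin 4

/-- Positively oriented plaquettes: `(a, (i, j))` with `i < j` is the lattice square spanned at `a`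
by the edges in directions `i` and `j`. -/
abbrev Plaquette := Vertex × {ij : Fin 4 × Fin 4 // ij.1 < ij.2}

/-- Oriented plaquettes: `(1, p)` is `p` and `(-1, p)` is `p` with the opposite orientation. -/
abbrev OrientedPlaquette := ℤˣ × Plaquette

/-- `0`-chains: finite formal sums of vertices with integer coefficients. -/
abbrev ZeroChain := Vertex →₀ ℤ

/-- `1`-chains: finite formal sums of positively oriented edges with integer coefficients. -/
abbrev OneChain := Edge →₀ ℤ

/-- Boundary of a positively oriented edge. -/
noncomputable def edgeBoundary (e : Edge) : ZeroChain :=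
  Finsupp.single (e.1 + unitVec e.2) 1 - Finsupp.single e.1 1

/-- Boundary of a `1`-chain, extended linearly from edges. -/
noncomputable def chainBoundary (γ : OneChain) : ZeroChain :=
  γ.sum fun e c => c • edgeBoundary e

/-- Boundary of a positively oriented plaquette: its four edges, with coefficient `1` or `-1`
according to the direction in which they are traversed. -/
noncomputable def plaquetteBoundary (p : Plaquette) : OneChain :=
  let a := p.1
  let i := p.2.1.1
  let j := p.2.1.2
  Finsupp.single (a, i) 1 + Finsupp.single (a + unitVec i, j) 1
    - Finsupp.single (a + unitVec j, i) 1 - Finsupp.single (a, j) 1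

/-- Boundary of an oriented plaquette. -/
noncomputable def orientedBoundary (p : OrientedPlaquette) : OneChain :=
  (p.1 : ℤ) • plaquetteBoundary p.2

/-! ### Generalized loops -/

/-- A generalized loop is a `1`-chain with coefficients in `{-1, 0, 1}` and empty boundary. -/
def IsGeneralizedLoop (γ : OneChain) : Prop :=
  (∀ e, γ e = -1 ∨ γ e = 0 ∨ γ e = 1) ∧ chainBoundary γ = 0

/-- The length `ℓ` of a chain: the number of edges in its support. -/
def loopLength (γ : OneChain) : ℕ := γ.support.card

/-- An edge of `γ` is a corner edge if some plaquette has both this edge and another edge of `γ`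
in its boundary (irrespective of orientations). -/
def IsCornerEdge (γ : OneChain) (e : Edge) : Prop :=
  e ∈ γ.support ∧ ∃ e' ∈ γ.support, e' ≠ e ∧
    ∃ p : Plaquette, plaquetteBoundary p e ≠ 0 ∧ plaquetteBoundary p e' ≠ 0

open Classical in
/-- The number `ℓ_c` of corner edges. -/
noncomputable def cornerCount (γ : OneChain) : ℕ :=
  (γ.support.filter (IsCornerEdge γ)).card

/-! ### Finite boxes and spin configurations -/

/-- The box `B_N = [-N, N]⁴ ∩ ℤ⁴`. -/
noncomputable def box (N : ℕ) : Finset Vertex :=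
  Fintype.piFinset fun _ => Finset.Icc (-(N : ℤ)) (N : ℤ)

/-- Positively oriented edges with both end points in `B_N`. -/
noncomputable def boxEdges (N : ℕ) : Finset Edge :=
  (box N ×ˢ Finset.univ).filter fun e => e.1 + unitVec e.2 ∈ box N

/-- Positively oriented plaquettes with all four corners in `B_N`. -/
noncomputable def boxPlaquettes (N : ℕ) : Finset Plaquette :=
  (box N ×ˢ Finset.univ).filter fun p =>
    p.1 + unitVec p.2.1.1 ∈ box N ∧ p.1 + unitVec p.2.1.2 ∈ box N ∧
      p.1 + unitVec p.2.1.1 + unitVec p.2.1.2 ∈ box N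

/-- All (positively and negatively) oriented plaquettes of `B_N`. -/
noncomputable def orientedBoxPlaquettes (N : ℕ) : Finset OrientedPlaquette :=
  Finset.univ ×ˢ boxPlaquettes N

/-- `ℤ_n`-valued `1`-forms on `B_N`, given by their values on the positively oriented edges; the
value on a negatively oriented edge is determined by `σ(-e) = -σ(e)`. -/
abbrev OneForm (n N : ℕ) := {e : Edge // e ∈ boxEdges N} → ZMod n

/-- The value `σ(q) = ∑ₑ q[e] σ(e)` of a `1`-form on a `1`-chain. For a chain that is not contained
in `B_N` the edges outside `B_N` contribute `0`. -/
noncomputable def OneForm.eval {n N : ℕ} (σ : OneForm n N) (q : OneChain) : ZMod n :=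
  q.sum fun e c => c • (if h : e ∈ boxEdges N then σ ⟨e, h⟩ else 0)

/-- The plaquette spin `dσ(p)`: the sum of `σ` over the boundary edges of `p`, directed according
to the orientation of `p`. -/
noncomputable def OneForm.d {n N : ℕ} (σ : OneForm n N) (p : OrientedPlaquette) : ZMod n :=
  σ.eval (orientedBoundary p)

/-! ### The Gibbs measure. A one-dimensional representation of `ℤ_n` is a homomorphism from the
additive group `ℤ_n` to the multiplicative structure of `ℂ`. -/

/-- The Wilson action; the sum is over plaquettes of both orientations. -/
noncomputable def wilsonAction {n N : ℕ} (ρ : AddChar (ZMod n) ℂ) (σ : OneForm n N) : ℝ :=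
  -∑ p ∈ orientedBoxPlaquettes N, (ρ (σ.d p)).re

/-- The uniform probability measure on spin configurations. -/
noncomputable def uniformWeight (n N : ℕ) [NeZero n] (_σ : OneForm n N) : ℝ :=
  (Fintype.card (OneForm n N) : ℝ)⁻¹

/-- The normalizing constant `Z_{N,β}`. -/
noncomputable def partitionFunction {n : ℕ} [NeZero n] (ρ : AddChar (ZMod n) ℂ) (N : ℕ) (β : ℝ) :
    ℝ :=
  ∑ σ : OneForm n N, Real.exp (-β * wilsonAction ρ σ) * uniformWeight n N σ

/-- The probability `μ_{N,β}(σ)`. -/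
noncomputable def gibbsWeight {n : ℕ} [NeZero n] (ρ : AddChar (ZMod n) ℂ) (N : ℕ) (β : ℝ)
    (σ : OneForm n N) : ℝ :=
  (partitionFunction ρ N β)⁻¹ * Real.exp (-β * wilsonAction ρ σ) * uniformWeight n N σ

/-- The expectation `𝔼_{N,β}[f]`. -/
noncomputable def expectation {n : ℕ} [NeZero n] (ρ : AddChar (ZMod n) ℂ) (N : ℕ) (β : ℝ)
    (f : OneForm n N → ℂ) : ℂ :=
  ∑ σ : OneForm n N, f σ * (gibbsWeight ρ N β σ : ℂ)

/-- The Wilson loop observable `W_γ(σ) = ρ(σ(γ))`. -/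
noncomputable def wilsonLoop {n N : ℕ} (ρ : AddChar (ZMod n) ℂ) (γ : OneChain)
    (σ : OneForm n N) : ℂ :=
  ρ (σ.eval γ)

/-- `N ↦ 𝔼_{N,β}[W_γ]`. -/
noncomputable def finiteVolumeWilson {n : ℕ} [NeZero n] (ρ : AddChar (ZMod n) ℂ) (β : ℝ)
    (γ : OneChain) (N : ℕ) : ℂ :=
  expectation ρ N β (wilsonLoop ρ γ)

/-- The infinite volume limit `⟨W_γ⟩_β = lim_N 𝔼_{N,β}[W_γ]` (meaningful if the limit exists). -/
noncomputable def infiniteVolumeWilson {n : ℕ} [NeZero n] (ρ : AddChar (ZMod n) ℂ) (β : ℝ)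
    (γ : OneChain) : ℂ :=
  Filter.limUnder Filter.atTop (finiteVolumeWilson ρ β γ)

/-! ### The functions `θ` and `λ` -/

/-- `θ(β)`. -/
noncomputable def theta {n : ℕ} [NeZero n] (ρ : AddChar (ZMod n) ℂ) (β : ℝ) : ℂ :=
  (∑ g : ZMod n, ρ g * (Real.exp (12 * β * (ρ g).re) : ℂ)) /
    ∑ g : ZMod n, (Real.exp (12 * β * (ρ g).re) : ℂ)

/-- `λ(β)`, a maximum over the finitely many `g ≠ 0`. -/
noncomputable def lam {n : ℕ} (ρ : AddChar (ZMod n) ℂ) (β : ℝ) : ℝ :=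
  ⨆ g : {g : ZMod n // g ≠ 0}, Real.exp (β * (ρ g).re) / Real.exp (β * (ρ 0).re)

/-- `λ(β) = exp(-β (1 - cos(2π/n)))`. -/
theorem lam_eq {n : ℕ} [NeZero n] (hn : 2 ≤ n) (ρ : AddChar (ZMod n) ℂ)
    (hρ : Function.Injective ρ) {β : ℝ} (hβ : 0 ≤ β) :
    lam ρ β = Real.exp (-β * (1 - Real.cos (2 * Real.pi / n))) := by
  have hn0 : n ≠ 0 := by omega
  have hnR : (0 : ℝ) < n := by positivity
  have key (g : ZMod n) : Real.exp (β * (ρ g).re) / Real.exp (β * (ρ 0).re)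
      = Real.exp (-β * (1 - (ρ g).re)) := by
    rw [← Real.exp_sub]; simp; ring
  have hpow (g : ZMod n) : ρ g ^ n = 1 := by
    rw [← AddChar.map_nsmul_eq_pow]; simp
  have hexp (k : ℕ) : (Complex.exp (2 * Real.pi * Complex.I * (k / n))).re
      = Real.cos (2 * Real.pi * k / n) := by
    rw [← Complex.exp_ofReal_mul_I_re]; congr 2; push_cast; ring
  have hub (g : ZMod n) (hg : g ≠ 0) : (ρ g).re ≤ Real.cos (2 * Real.pi / n) := by
    obtain ⟨k, hk, hk'⟩ := (Complex.isPrimitiveRoot_exp n hn0).eq_pow_of_pow_eq_one (hpow g)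
    have hval : ρ g = Complex.exp (2 * Real.pi * Complex.I * (k / n)) := by
      rw [← hk', ← Complex.exp_nat_mul]; congr 1; ring
    have hk0 : 1 ≤ k := by
      rcases Nat.eq_zero_or_pos k with rfl | h
      · exact absurd (hρ (by rw [← hk']; simp)) hg
      · exact h
    rw [hval, hexp]
    have hpi := Real.pi_pos
    have h1 : (1 : ℝ) ≤ k := by exact_mod_cast hk0
    have h2 : (k : ℝ) + 1 ≤ n := by exact_mod_cast hk
    have h2n : (2 : ℝ) ≤ n := by exact_mod_cast hn
    have hsmall : 2 * Real.pi / n ≤ Real.pi := by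
      rw [div_le_iff₀ hnR]; nlinarith
    rcases le_total (2 * Real.pi * k / n) Real.pi with h | h
    · apply Real.cos_le_cos_of_nonneg_of_le_pi (by positivity) h
      rw [div_le_div_iff_of_pos_right hnR]; nlinarith
    · rw [← Real.cos_two_pi_sub]
      apply Real.cos_le_cos_of_nonneg_of_le_pi (by positivity) (by linarith)
      rw [le_sub_iff_add_le, ← add_div, div_le_iff₀ hnR]; nlinarith
  have hsurj : ∃ g : ZMod n, ρ g = Complex.exp (2 * Real.pi * Complex.I / n) := by
    have hprim := Complex.isPrimitiveRoot_exp n hn0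
    have hcard : (Finset.univ.image ρ) = Polynomial.nthRootsFinset n (1 : ℂ) := by
      apply Finset.eq_of_subset_of_card_le
      · intro z hz
        obtain ⟨g, -, rfl⟩ := Finset.mem_image.1 hz
        exact (Polynomial.mem_nthRootsFinset (by omega) _).2 (hpow g)
      · rw [hprim.card_nthRootsFinset, Finset.card_image_of_injective _ hρ]; simp [ZMod.card]
    have hm : Complex.exp (2 * Real.pi * Complex.I / n) ∈ Finset.univ.image ρ := by
      rw [hcard]; exact (Polynomial.mem_nthRootsFinset (by omega) _).2 hprim.pow_eq_one
    obtain ⟨g, -, hg⟩ := Finset.mem_image.1 hm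
    exact ⟨g, hg⟩
  obtain ⟨g₁, hg₁⟩ := hsurj
  have hg₁0 : g₁ ≠ 0 := by
    rintro rfl
    have := (Complex.isPrimitiveRoot_exp n hn0).ne_one (by omega)
    exact this (by rw [← hg₁]; simp)
  have : Nonempty {g : ZMod n // g ≠ 0} := ⟨⟨g₁, hg₁0⟩⟩
  unfold lam
  simp only [key]
  apply le_antisymm
  · refine ciSup_le fun g => Real.exp_le_exp.2 ?_
    nlinarith [hub g g.2]
  · refine le_trans (le_of_eq ?_) (le_ciSup (Set.finite_range _).bddAbove ⟨g₁, hg₁0⟩)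
    have := hexp 1
    rw [show (2 * Real.pi * Complex.I * ((1 : ℕ) / n) : ℂ) = 2 * Real.pi * Complex.I / n by
      push_cast; ring, ← hg₁] at this
    simp only [this]; simp

end LatticeGauge

/-! At large `β` the form `dσ` vanishes on most plaquettes, and its support splits into rare
clusters, the vortices. A given set of `k` plaquettes is a vortex with probability at most `(n
λ²)^k`: the curl restricted to a vortex is closed, hence has a primitive, and subtracting this
primitive from `σ` removes the vortex (`prob_isVortex_le`). Since the number of possible clusters
grows only exponentially, large vortices are negligible.

The smallest vortices can be classified. A nonzero closed 2-form on at most six plaquettes is the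
curl of a form on one edge, and its support is the star of that edge
(`eq_curl_single_of_card_le_six`). A vortex far from `γ` compared to its size has a primitive that
vanishes on `γ`. Call an edge uniform if its six plaquettes, oriented along it, carry the same
value; the value `0` is allowed and typical. Unless there is a vortex of at least seven plaquettes
near `γ` or a minimal vortex at a corner edge, `σ(γ)` is the sum of the values at the uniform
non-corner edges (`pair_eq_sum_stapleValue`).

Non-corner edges of `γ` have disjoint stars, and whether `e` is uniform does not depend on `σ(e)`.
Given the other spins, the common value at a uniform edge has law proportional to `exp(12 β Re ρ)`,
under which `ρ` has mean `θ`. Integrating these edges out is exact (`expectation_wilsonLoop_eq`) and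
leaves `θ^k` times a phase, where `k` counts the uniform non-corner edges. Outside the bad events
the phase is `1`, and `ℓ - k` is at most `ℓ_c` plus a term of mean `O(ℓ λ²)`.

Here `1 - θ` is comparable to `λ^12`. With `A = ℓ λ^12` and `x = √(ℓ_c/ℓ) + λ²` the error is `O(A
x)`. When at least half of the edges are not corners, both quantities compared are also `O(1/A +
λ²)`. Switching between the bounds at `A √x = 1` gives `O(√x)`, so the exponent is `1/2`. The bounds
are uniform in `N`. The limit exists because the expectations are real, bounded by `1` and, by
Ginibre's inequality, nondecreasing in `N`. -/

namespace LatticeGauge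

/-! ### Discrete exterior calculus on `ℤ⁴`. -/

section Forms

variable {A : Type*} [AddCommGroup A]

/-! ### Signed sums over integer intervals -/

/-- The sum of `f` over `[c, t)`, with the opposite sign over `[t, c)` if `t < c`. -/
noncomputable def signedSum (c : ℤ) (f : ℤ → A) (t : ℤ) : A :=
  ∑ s ∈ Finset.Ico c t, f s - ∑ s ∈ Finset.Ico t c, f s

theorem signedSum_self (c : ℤ) (f : ℤ → A) : signedSum c f c = 0 := by simp [signedSum]

theorem signedSum_succ (c : ℤ) (f : ℤ → A) (t : ℤ) :
    signedSum c f (t + 1) = signedSum c f t + f t := by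
  unfold signedSum
  rcases le_or_gt c t with h | h
  · have h1 : Finset.Ico c (t + 1) = insert t (Finset.Ico c t) := by
      ext s; simp only [Finset.mem_Ico, Finset.mem_insert]; omega
    rw [h1, Finset.sum_insert (by simp), Finset.Ico_eq_empty (a := t + 1) (by omega),
      Finset.Ico_eq_empty (a := t) (b := c) (by omega)]
    simp [add_comm]
  · have h1 : Finset.Ico t c = insert t (Finset.Ico (t + 1) c) := by
      ext s; simp only [Finset.mem_Ico, Finset.mem_insert]; omega
    rw [h1, Finset.sum_insert (by simp), Finset.Ico_eq_empty (a := c) (b := t + 1) (by omega),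
      Finset.Ico_eq_empty (a := c) (b := t) (by omega)]
    simp

theorem signedSum_add (c : ℤ) (f g : ℤ → A) (t : ℤ) :
    signedSum c (fun s => f s + g s) t = signedSum c f t + signedSum c g t := by
  simp only [signedSum, Finset.sum_add_distrib]; abel

theorem signedSum_sub (c : ℤ) (f g : ℤ → A) (t : ℤ) :
    signedSum c (fun s => f s - g s) t = signedSum c f t - signedSum c g t := by
  simp only [signedSum, Finset.sum_sub_distrib]; abel

/-- The fundamental theorem of calculus for the discrete integral, valid on both sides of the base
point; this is what allows contraction onto any hyperplane. -/
theorem signedSum_telescope (c : ℤ) (g : ℤ → A) (t : ℤ) :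
    signedSum c (fun s => g (s + 1) - g s) t = g t - g c := by
  induction t using Int.inductionOn' (b := c) with
  | zero => simp [signedSum_self]
  | succ k _ ih => rw [signedSum_succ, ih]; abel
  | pred k _ ih =>
    have := signedSum_succ c (fun s => g (s + 1) - g s) (k - 1)
    simp only [sub_add_cancel] at this
    rw [ih] at this
    rw [← sub_eq_iff_eq_add] at this
    rw [← this]; abel

theorem signedSum_eq_zero {c : ℤ} {f : ℤ → A} {t : ℤ}
    (h : ∀ s, (c ≤ s ∧ s < t) ∨ (t ≤ s ∧ s < c) → f s = 0) : signedSum c f t = 0 := by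
  unfold signedSum
  rw [Finset.sum_eq_zero fun s hs => h s (Or.inl (Finset.mem_Ico.1 hs)),
    Finset.sum_eq_zero fun s hs => h s (Or.inr (Finset.mem_Ico.1 hs)), sub_zero]

/-! ### Forms on `ℤ⁴` and their differentials -/

/-- The differential of a `0`-form. -/
def grad (η : Vertex → A) (e : Edge) : A := η (e.1 + unitVec e.2) - η e.1

/-- The differential of a `1`-form, evaluated on the square at `x` in the directions `i, j`. -/
def curl (s : Edge → A) (x : Vertex) (i j : Fin 4) : A :=
  s (x, i) + s (x + unitVec i, j) - s (x + unitVec j, i) - s (x, j)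

/-- The differential of a `2`-form, evaluated on the cube at `x` in the directions `i, j, k`. -/
def diff₂ (ω : Vertex → Fin 4 → Fin 4 → A) (x : Vertex) (i j k : Fin 4) : A :=
  ω (x + unitVec i) j k - ω x j k - (ω (x + unitVec j) i k - ω x i k)
    + (ω (x + unitVec k) i j - ω x i j)

/-- `2`-forms are alternating in the two directions. -/
structure IsAlternating (ω : Vertex → Fin 4 → Fin 4 → A) : Prop where
  self : ∀ x i, ω x i i = 0
  symm : ∀ x i j, ω x j i = -ω x i j

theorem isAlternating_curl (s : Edge → A) : IsAlternating (curl s) :=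
  ⟨fun x i => by simp [curl], fun x i j => by simp [curl]; abel⟩

theorem IsAlternating.sub {ω ω' : Vertex → Fin 4 → Fin 4 → A} (h : IsAlternating ω)
    (h' : IsAlternating ω') : IsAlternating (fun x i j => ω x i j - ω' x i j) :=
  ⟨fun x i => by simp [h.self, h'.self], fun x i j => by rw [h.symm, h'.symm]; abel⟩

theorem diff₂_curl (s : Edge → A) (x : Vertex) (i j k : Fin 4) :
    diff₂ (curl s) x i j k = 0 := by
  have e1 := add_right_comm x (unitVec i) (unitVec j)
  have e2 := add_right_comm x (unitVec i) (unitVec k)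
  have e3 := add_right_comm x (unitVec j) (unitVec k)
  simp only [diff₂, curl, e1, e2, e3]; abel

theorem curl_grad (η : Vertex → A) (x : Vertex) (i j : Fin 4) : curl (grad η) x i j = 0 := by
  have e1 := add_right_comm x (unitVec i) (unitVec j)
  simp only [curl, grad, e1]; abel

theorem curl_add (s s' : Edge → A) (x : Vertex) (i j : Fin 4) :
    curl (fun e => s e + s' e) x i j = curl s x i j + curl s' x i j := by
  simp only [curl]; abel

theorem curl_sub (s s' : Edge → A) (x : Vertex) (i j : Fin 4) :
    curl (fun e => s e - s' e) x i j = curl s x i j - curl s' x i j := by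
  simp only [curl]; abel

theorem curl_sum {ι : Type*} (T : Finset ι) (s : ι → Edge → A) (x : Vertex) (i j : Fin 4) :
    curl (fun e => ∑ a ∈ T, s a e) x i j = ∑ a ∈ T, curl (s a) x i j := by
  simp only [curl, Finset.sum_add_distrib, Finset.sum_sub_distrib]

theorem diff₂_sub (ω ω' : Vertex → Fin 4 → Fin 4 → A) (x : Vertex) (i j k : Fin 4) :
    diff₂ (fun x i j => ω x i j - ω' x i j) x i j k = diff₂ ω x i j k - diff₂ ω' x i j k := by
  simp only [diff₂]; abel

theorem unitVec_apply_self (i : Fin 4) : unitVec i i = 1 := by simp [unitVec]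

theorem unitVec_apply_ne {i j : Fin 4} (h : j ≠ i) : unitVec i j = 0 := by simp [unitVec, h]

theorem update_add_unitVec_self (x : Vertex) (i : Fin 4) (t : ℤ) :
    Function.update (x + unitVec i) i t = Function.update x i t := by
  ext j; by_cases h : j = i
  · subst h; simp
  · simp [h, unitVec_apply_ne h]

theorem update_add_unitVec_ne (x : Vertex) {i j : Fin 4} (h : i ≠ j) (t : ℤ) :
    Function.update (x + unitVec j) i t = Function.update x i t + unitVec j := by
  ext k; by_cases hk : k = i
  · subst hk; simp [unitVec_apply_ne h]
  · simp [hk]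

theorem update_succ (x : Vertex) (i : Fin 4) (t : ℤ) :
    Function.update x i (t + 1) = Function.update x i t + unitVec i := by
  ext k; by_cases hk : k = i
  · subst hk; simp [unitVec_apply_self]
  · simp [hk, unitVec_apply_ne hk]

/-- The homotopy operator on `1`-forms that contracts direction `i` to `x i = c`. -/
noncomputable def homotopy₁ (i : Fin 4) (c : ℤ) (s : Edge → A) (x : Vertex) : A :=
  signedSum c (fun t => s (Function.update x i t, i)) (x i)

/-- The homotopy operator on `2`-forms that contracts direction `i` to `x i = c`. -/
noncomputable def homotopy₂ (i : Fin 4) (c : ℤ) (ω : Vertex → Fin 4 → Fin 4 → A) (e : Edge) : A :=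
  signedSum c (fun t => ω (Function.update e.1 i t) i e.2) (e.1 i)

/-- Along the contracted direction no closedness is needed: `homotopy₁` is by construction an
antiderivative along lines parallel to `unitVec i`. -/
theorem grad_homotopy₁_self (i : Fin 4) (c : ℤ) (s : Edge → A) (x : Vertex) :
    grad (homotopy₁ i c s) (x, i) = s (x, i) := by
  simp only [grad, homotopy₁, update_add_unitVec_self, Pi.add_apply, unitVec_apply_self,
    signedSum_succ, Function.update_eq_self]
  abel

/-- Closedness trades the increment of the `i`-component in direction `j` for the increment of the
`j`-component in direction `i`, which telescopes. The boundary term is the restriction to the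
hyperplane. -/
theorem grad_homotopy₁_of_ne {i j : Fin 4} (hij : j ≠ i) (c : ℤ) {s : Edge → A}
    (hs : ∀ x i j, curl s x i j = 0) (x : Vertex) :
    grad (homotopy₁ i c s) (x, j) = s (x, j) - s (Function.update x i c, j) := by
  have key : ∀ t, s (Function.update x i t + unitVec j, i) - s (Function.update x i t, i)
      = s (Function.update x i (t + 1), j) - s (Function.update x i t, j) := by
    intro t
    have := hs (Function.update x i t) i j
    rw [update_succ]
    simp only [curl] at this
    rw [← sub_eq_zero, ← neg_eq_zero, ← this]; abel
  simp only [grad, homotopy₁, update_add_unitVec_ne x hij.symm, Pi.add_apply,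
    unitVec_apply_ne hij.symm, add_zero]
  rw [← signedSum_sub]
  simp only [key]
  rw [signedSum_telescope c (fun t => s (Function.update x i t, j)), Function.update_eq_self]

theorem curl_homotopy₂_self (i k : Fin 4) (c : ℤ) {ω : Vertex → Fin 4 → Fin 4 → A}
    (ha : IsAlternating ω) (x : Vertex) : curl (homotopy₂ i c ω) x i k = ω x i k := by
  by_cases hik : k = i
  · subst hik; rw [ha.self, (isAlternating_curl _).self]
  have hz : ∀ y, homotopy₂ i c ω (y, i) = 0 := fun y =>
    signedSum_eq_zero fun s _ => ha.self _ _
  simp only [curl, hz]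
  simp only [homotopy₂, update_add_unitVec_self, Pi.add_apply, unitVec_apply_self,
    signedSum_succ, Function.update_eq_self]
  abel

/-- The same exchange one degree higher: closedness on the cubes with sides `i, j, k` turns the
integrand into an increment of the `(j, k)`-component in direction `i`. -/
theorem curl_homotopy₂_of_ne {i j k : Fin 4} (hj : j ≠ i) (hk : k ≠ i) (c : ℤ)
    {ω : Vertex → Fin 4 → Fin 4 → A} (hω : ∀ x i j k, diff₂ ω x i j k = 0) (x : Vertex) :
    curl (homotopy₂ i c ω) x j k = ω x j k - ω (Function.update x i c) j k := by
  have key : ∀ t, ω (Function.update x i t) i j + ω (Function.update x i t + unitVec j) i k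
      - ω (Function.update x i t + unitVec k) i j - ω (Function.update x i t) i k
      = ω (Function.update x i (t + 1)) j k - ω (Function.update x i t) j k := by
    intro t
    have := hω (Function.update x i t) i j k
    rw [update_succ]
    simp only [diff₂] at this
    rw [← sub_eq_zero, ← neg_eq_zero, ← this]; abel
  simp only [curl, homotopy₂, update_add_unitVec_ne x hj.symm, update_add_unitVec_ne x hk.symm,
    Pi.add_apply, unitVec_apply_ne hj.symm, unitVec_apply_ne hk.symm, add_zero]
  rw [← signedSum_add, ← signedSum_sub, ← signedSum_sub]
  simp only [key]
  rw [signedSum_telescope c (fun t => ω (Function.update x i t) j k), Function.update_eq_self]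

/-- A closed `2`-form that vanishes on the hyperplane `x i = c` is the differential of its
homotopy. -/
theorem curl_homotopy₂_eq {i : Fin 4} {c : ℤ} {ω : Vertex → Fin 4 → Fin 4 → A}
    (ha : IsAlternating ω) (hω : ∀ x i j k, diff₂ ω x i j k = 0)
    (hc : ∀ x j k, x i = c → ω x j k = 0) (x : Vertex) (j k : Fin 4) :
    curl (homotopy₂ i c ω) x j k = ω x j k := by
  by_cases hj : j = i
  · subst hj; exact curl_homotopy₂_self _ _ _ ha x
  by_cases hk : k = i
  · subst hk
    rw [(isAlternating_curl _).symm, curl_homotopy₂_self _ _ _ ha x, ← ha.symm]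
  · rw [curl_homotopy₂_of_ne hj hk c hω, hc (Function.update x i c) _ _ (by simp), sub_zero]

/-- A closed `1`-form that vanishes on the hyperplane `x i = c` is the differential of its
homotopy. -/
theorem grad_homotopy₁_eq {i : Fin 4} {c : ℤ} {s : Edge → A}
    (hs : ∀ x i j, curl s x i j = 0) (hc : ∀ x j, x i = c → s (x, j) = 0) (e : Edge) :
    grad (homotopy₁ i c s) e = s e := by
  obtain ⟨x, j⟩ := e
  by_cases hj : j = i
  · subst hj; exact grad_homotopy₁_self _ _ _ x
  · rw [grad_homotopy₁_of_ne hj c hs, hc (Function.update x i c) _ (by simp), sub_zero]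

/-- Poincaré lemma for `2`-forms on `ℤ⁴`. -/
theorem exists_curl_eq {ω : Vertex → Fin 4 → Fin 4 → A} (ha : IsAlternating ω)
    (hω : ∀ x i j k, diff₂ ω x i j k = 0) : ∃ s : Edge → A, ∀ x i j, curl s x i j = ω x i j := by
  -- The directions are eliminated one at a time: after treating `J`, the remainder has no component
  -- that involves a direction of `J`.
  have step : ∀ J : Finset (Fin 4), ∃ s : Edge → A,
      ∀ j ∈ J, ∀ x k, ω x j k - curl s x j k = 0 := by
    intro J
    induction J using Finset.induction_on with
    | empty => exact ⟨0, by simp⟩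
    | insert i J hi ih =>
      obtain ⟨s, hs⟩ := ih
      set ω' : Vertex → Fin 4 → Fin 4 → A := fun x j k => ω x j k - curl s x j k with hω'
      have ha' : IsAlternating ω' := ha.sub (isAlternating_curl s)
      have hc' : ∀ x i j k, diff₂ ω' x i j k = 0 := by
        intro x i j k; rw [hω', diff₂_sub, hω, diff₂_curl, sub_zero]
      refine ⟨fun e => s e + homotopy₂ i 0 ω' e, fun j hj x k => ?_⟩
      rw [curl_add, ← sub_sub]
      change ω' x j k - _ = 0
      by_cases hji : j = i
      · subst hji; rw [curl_homotopy₂_self _ _ _ ha', sub_self]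
      · have hjJ : j ∈ J := (Finset.mem_insert.1 hj).resolve_left hji
        by_cases hki : k = i
        · subst hki
          rw [(isAlternating_curl _).symm, curl_homotopy₂_self _ _ _ ha', ha'.symm, sub_neg_eq_add,
            neg_add_cancel]
        -- The new correction changes this component by its values at `x` and at the projection of
        -- `x`; both vanish already, so earlier directions are not spoiled.
        · rw [curl_homotopy₂_of_ne hji hki 0 hc']
          have h1 : ω' x j k = 0 := hs j hjJ x k
          have h2 : ω' (Function.update x i 0) j k = 0 := hs j hjJ _ k
          rw [h1, h2]; simp
  obtain ⟨s, hs⟩ := step Finset.univ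
  exact ⟨s, fun x i j => (sub_eq_zero.1 (hs i (Finset.mem_univ i) x j)).symm⟩

/-- Poincaré lemma for `1`-forms on `ℤ⁴`. -/
theorem exists_grad_eq {s : Edge → A} (hs : ∀ x i j, curl s x i j = 0) :
    ∃ η : Vertex → A, ∀ e, grad η e = s e := by
  have step : ∀ J : Finset (Fin 4), ∃ η : Vertex → A,
      ∀ j ∈ J, ∀ x, s (x, j) - grad η (x, j) = 0 := by
    intro J
    induction J using Finset.induction_on with
    | empty => exact ⟨0, by simp⟩
    | insert i J hi ih =>
      obtain ⟨η, hη⟩ := ih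
      set s' : Edge → A := fun e => s e - grad η e with hs'
      have hc' : ∀ x i j, curl s' x i j = 0 := by
        intro x i j; rw [hs', curl_sub, hs, curl_grad, sub_zero]
      refine ⟨fun x => η x + homotopy₁ i 0 s' x, fun j hj x => ?_⟩
      have e1 : s (x, j) - grad (fun x => η x + homotopy₁ i 0 s' x) (x, j)
          = s' (x, j) - grad (homotopy₁ i 0 s') (x, j) := by
        simp only [hs', grad]; abel
      rw [e1]
      by_cases hji : j = i
      · subst hji; rw [grad_homotopy₁_self, sub_self]
      · have hjJ : j ∈ J := (Finset.mem_insert.1 hj).resolve_left hji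
        rw [grad_homotopy₁_of_ne hji 0 hc']
        have h1 : s' (x, j) = 0 := hη j hjJ x
        have h2 : s' (Function.update x i 0, j) = 0 := hη j hjJ _
        rw [h1, h2]; simp
  obtain ⟨η, hη⟩ := step Finset.univ
  exact ⟨η, fun e => (sub_eq_zero.1 (hη e.2 (Finset.mem_univ _) e.1)).symm⟩

/-! ### Pairing with chains -/

/-- The value of a `1`-form on a `1`-chain. -/
noncomputable def pair (γ : OneChain) (s : Edge → A) : A := γ.sum fun e c => c • s e

/-- Stokes: `η` extends to a homomorphism on 0-chains, and the pairing is its value at the boundary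
of `γ`. -/
theorem pair_grad {γ : OneChain} (hγ : chainBoundary γ = 0) (η : Vertex → A) :
    pair γ (grad η) = 0 := by
  let ev : ZeroChain →+ A := Finsupp.liftAddHom fun v => (zmultiplesHom A (η v))
  have hev : ∀ v c, ev (Finsupp.single v c) = c • η v := by intro v c; simp [ev]
  have h : ev (chainBoundary γ) = pair γ (grad η) := by
    unfold chainBoundary pair
    rw [map_finsuppSum]
    refine Finsupp.sum_congr fun e _ => ?_
    rw [map_zsmul, edgeBoundary, map_sub, hev, hev, one_smul, one_smul, grad]
  rw [← h, hγ, map_zero]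

theorem pair_eq_zero_of_closed {γ : OneChain} (hγ : chainBoundary γ = 0) {s : Edge → A}
    (hs : ∀ x i j, curl s x i j = 0) : pair γ s = 0 := by
  obtain ⟨η, hη⟩ := exists_grad_eq hs
  rw [← funext hη]; exact pair_grad hγ η

theorem pair_add (γ : OneChain) (s s' : Edge → A) :
    pair γ (fun e => s e + s' e) = pair γ s + pair γ s' := by
  simp only [pair, smul_add, Finsupp.sum_add]

theorem pair_sub (γ : OneChain) (s s' : Edge → A) :
    pair γ (fun e => s e - s' e) = pair γ s - pair γ s' := by
  simp only [pair, smul_sub, Finsupp.sum_sub]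

theorem pair_sum {ι : Type*} (γ : OneChain) (T : Finset ι) (s : ι → Edge → A) :
    pair γ (fun e => ∑ a ∈ T, s a e) = ∑ a ∈ T, pair γ (s a) := by
  simp only [pair, Finsupp.sum, Finset.smul_sum]
  exact Finset.sum_comm

theorem pair_congr {γ : OneChain} {s s' : Edge → A} (h : ∀ e ∈ γ.support, s e = s' e) :
    pair γ s = pair γ s' :=
  Finset.sum_congr rfl fun e he => by simp only [h e he]

end Forms

end LatticeGauge
namespace LatticeGauge

/-! ### Plaquettes around an edge -/

/-- The plaquette at `x` in the directions `i ≠ j`. -/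
def squareAt (x : Vertex) (i j : Fin 4) (h : i ≠ j) : Plaquette :=
  if hij : i < j then (x, ⟨(i, j), hij⟩) else (x, ⟨(j, i), lt_of_le_of_ne (not_lt.1 hij) h.symm⟩)

theorem squareAt_cases (x : Vertex) (i j : Fin 4) (h : i ≠ j) :
    (squareAt x i j h).1 = x ∧
      (((squareAt x i j h).2.1.1 = i ∧ (squareAt x i j h).2.1.2 = j) ∨
        ((squareAt x i j h).2.1.1 = j ∧ (squareAt x i j h).2.1.2 = i)) := by
  unfold squareAt; split_ifs <;> simp

theorem plaquette_ext {p q : Plaquette} (h : p.1 = q.1) (h1 : p.2.1.1 = q.2.1.1)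
    (h2 : p.2.1.2 = q.2.1.2) : p = q :=
  Prod.ext h (Subtype.ext (Prod.ext h1 h2))

/-- Plaquettes with the same base point and the same unordered pair of directions are equal. -/
theorem plaquette_ext_of_dirs {p q : Plaquette} {i j : Fin 4} (h : p.1 = q.1)
    (hp : (p.2.1.1 = i ∧ p.2.1.2 = j) ∨ (p.2.1.1 = j ∧ p.2.1.2 = i))
    (hq : (q.2.1.1 = i ∧ q.2.1.2 = j) ∨ (q.2.1.1 = j ∧ q.2.1.2 = i)) : p = q := by
  have h1 := p.2.2; have h2 := q.2.2
  rcases hp with hp | hp <;> rcases hq with hq | hq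
  · exact plaquette_ext h (hp.1.trans hq.1.symm) (hp.2.trans hq.2.symm)
  · rw [hp.1, hp.2] at h1; rw [hq.1, hq.2] at h2; exact absurd h1 (lt_asymm h2)
  · rw [hp.1, hp.2] at h1; rw [hq.1, hq.2] at h2; exact absurd h1 (lt_asymm h2)
  · exact plaquette_ext h (hp.1.trans hq.1.symm) (hp.2.trans hq.2.symm)

theorem unitVec_ne_zero (i : Fin 4) : unitVec i ≠ 0 := fun h => by
  have := congrFun h i; simp [unitVec_apply_self] at this

theorem unitVec_injective : Function.Injective unitVec := fun i j h => by
  by_contra hij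
  have := congrFun h i
  rw [unitVec_apply_self, unitVec_apply_ne hij] at this
  exact one_ne_zero this

/-- The six plaquettes that contain the edge `e`. -/
def star (e : Edge) : Finset Plaquette :=
  Finset.univ.image fun jb : {j : Fin 4 // j ≠ e.2} × Bool =>
    squareAt (if jb.2 then e.1 else e.1 - unitVec jb.1) e.2 jb.1 jb.1.2.symm

theorem mem_star_iff {e : Edge} {p : Plaquette} :
    p ∈ star e ↔ ∃ j, ((p.2.1.1 = e.2 ∧ p.2.1.2 = j) ∨ (p.2.1.1 = j ∧ p.2.1.2 = e.2)) ∧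
      (p.1 = e.1 ∨ p.1 = e.1 - unitVec j) := by
  unfold star
  simp only [Finset.mem_image, Finset.mem_univ, true_and]
  constructor
  · rintro ⟨⟨⟨j, hj⟩, b⟩, rfl⟩
    refine ⟨j, (squareAt_cases _ _ _ _).2, ?_⟩
    rw [(squareAt_cases _ _ _ _).1]
    cases b <;> simp
  · rintro ⟨j, hd, hx⟩
    have hj : j ≠ e.2 := by
      rintro rfl
      have := p.2.2
      rcases hd with hd | hd <;> (rw [hd.1, hd.2] at this; exact lt_irrefl _ this)
    rcases hx with hx | hx
    · refine ⟨(⟨j, hj⟩, true), ?_⟩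
      have := squareAt_cases e.1 e.2 j hj.symm
      exact plaquette_ext_of_dirs (by simp [this.1, hx]) this.2 hd
    · refine ⟨(⟨j, hj⟩, false), ?_⟩
      have := squareAt_cases (e.1 - unitVec j) e.2 j hj.symm
      exact plaquette_ext_of_dirs (by simp [this.1, hx]) this.2 hd

/-- Three transverse directions, with a square on either side of the edge for each. -/
theorem card_star (e : Edge) : (star e).card = 6 := by
  unfold star
  rw [Finset.card_image_of_injective]
  · rw [Finset.card_univ, Fintype.card_prod, Fintype.card_bool, Fintype.card_subtype_compl]
    simp
  · rintro ⟨⟨j, hj⟩, b⟩ ⟨⟨j', hj'⟩, b'⟩ h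
    simp only at h
    have h1 := squareAt_cases (if b then e.1 else e.1 - unitVec j) e.2 j hj.symm
    have h2 := squareAt_cases (if b' then e.1 else e.1 - unitVec j') e.2 j' hj'.symm
    rw [← h] at h2
    have hjj : j = j' := by
      rcases h1.2 with h1 | h1 <;> rcases h2.2 with h2 | h2
      · rw [← h1.2, ← h2.2]
      · exact absurd (h1.1.symm.trans h2.1) hj'.symm
      · exact absurd (h1.1.symm.trans h2.1) hj
      · rw [← h1.1, ← h2.1]
    subst hjj
    have hb := h1.1.symm.trans h2.1
    have : b = b' := by
      cases b <;> cases b' <;> simp [unitVec_ne_zero, eq_sub_iff_add_eq] at hb ⊢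
    rw [this]

theorem plaquetteBoundary_apply (p : Plaquette) (e : Edge) :
    plaquetteBoundary p e = (if (p.1, p.2.1.1) = e then 1 else 0)
      + (if (p.1 + unitVec p.2.1.1, p.2.1.2) = e then 1 else 0)
      - (if (p.1 + unitVec p.2.1.2, p.2.1.1) = e then 1 else 0)
      - (if (p.1, p.2.1.2) = e then 1 else 0) := by
  unfold plaquetteBoundary
  simp [Finsupp.single_apply]

theorem plaquetteBoundary_apply_fst (x y : Vertex) (i j : Fin 4) (h : i < j) :
    plaquetteBoundary (x, ⟨(i, j), h⟩) (y, i)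
      = (if x = y then 1 else 0) - (if x + unitVec j = y then 1 else 0) := by
  rw [plaquetteBoundary_apply]; simp [h.ne']

theorem plaquetteBoundary_apply_snd (x y : Vertex) (i j : Fin 4) (h : i < j) :
    plaquetteBoundary (x, ⟨(i, j), h⟩) (y, j)
      = (if x + unitVec i = y then 1 else 0) - (if x = y then 1 else 0) := by
  rw [plaquetteBoundary_apply]; simp [h.ne]

theorem plaquetteBoundary_apply_other {x y : Vertex} {i j k : Fin 4} (h : i < j) (hi : i ≠ k)
    (hj : j ≠ k) : plaquetteBoundary (x, ⟨(i, j), h⟩) (y, k) = 0 := by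
  rw [plaquetteBoundary_apply]; simp [hi, hj]

/-- The incidence number of a plaquette in the star of an edge is `1` or `-1`. -/
theorem plaquetteBoundary_of_mem_star {p : Plaquette} {e : Edge} (h : p ∈ star e) :
    plaquetteBoundary p e = 1 ∨ plaquetteBoundary p e = -1 := by
  obtain ⟨j, hd, hx⟩ := mem_star_iff.1 h
  obtain ⟨x, ⟨⟨a, b⟩, hab⟩⟩ := p
  obtain ⟨y, i⟩ := e
  simp only at hd hx hab
  rcases hd with ⟨rfl, rfl⟩ | ⟨rfl, rfl⟩ <;> rcases hx with rfl | rfl <;>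
    simp [plaquetteBoundary_apply_fst, plaquetteBoundary_apply_snd, unitVec_ne_zero]

theorem mem_star_of_plaquetteBoundary_ne_zero {p : Plaquette} {e : Edge}
    (h : plaquetteBoundary p e ≠ 0) : p ∈ star e := by
  obtain ⟨x, ⟨⟨a, b⟩, hab⟩⟩ := p
  obtain ⟨y, i⟩ := e
  rw [mem_star_iff]
  simp only at hab ⊢
  by_cases ha : a = i
  · subst ha
    rw [plaquetteBoundary_apply_fst] at h
    refine ⟨b, Or.inl ⟨rfl, rfl⟩, ?_⟩
    rw [eq_sub_iff_add_eq]
    by_contra hcon; push Not at hcon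
    simp [hcon.1, hcon.2] at h
  · by_cases hb : b = i
    · subst hb
      rw [plaquetteBoundary_apply_snd] at h
      refine ⟨a, Or.inr ⟨rfl, rfl⟩, ?_⟩
      rw [eq_sub_iff_add_eq]
      by_contra hcon; push Not at hcon
      simp [hcon.1, hcon.2] at h
    · exact absurd (plaquetteBoundary_apply_other hab ha hb) h

theorem mem_star_iff_plaquetteBoundary {p : Plaquette} {e : Edge} :
    p ∈ star e ↔ plaquetteBoundary p e ≠ 0 :=
  ⟨fun h => by rcases plaquetteBoundary_of_mem_star h with h | h <;> rw [h] <;> norm_num,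
    mem_star_of_plaquetteBoundary_ne_zero⟩

theorem pair_plaquetteBoundary {A : Type*} [AddCommGroup A] (p : Plaquette) (s : Edge → A) :
    pair (plaquetteBoundary p) s = curl s p.1 p.2.1.1 p.2.1.2 := by
  unfold pair plaquetteBoundary curl
  have h0 : ∀ e, (0 : ℤ) • s e = 0 := fun e => zero_smul _ _
  have h1 : ∀ e (a b : ℤ), (a + b) • s e = a • s e + b • s e := fun e a b => add_smul _ _ _
  have h2 : ∀ e (a b : ℤ), (a - b) • s e = a • s e - b • s e := fun e a b => sub_smul _ _ _
  rw [Finsupp.sum_sub_index h2, Finsupp.sum_sub_index h2, Finsupp.sum_add_index' h0 h1]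
  simp [Finsupp.sum_single_index]

theorem curl_single {A : Type*} [AddCommGroup A] (e : Edge) (g : A) (p : Plaquette) :
    curl (Pi.single e g) p.1 p.2.1.1 p.2.1.2 = plaquetteBoundary p e • g := by
  rw [← pair_plaquetteBoundary, pair, Finsupp.sum]
  by_cases h : e ∈ (plaquetteBoundary p).support
  · rw [Finset.sum_eq_single_of_mem e h]
    · simp
    · intro e' _ hne; simp [hne]
  · rw [Finsupp.notMem_support_iff.1 h, zero_smul]
    refine Finset.sum_eq_zero fun e' he' => ?_
    have : e' ≠ e := by rintro rfl; exact h he'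
    simp [this]

/-- Two squares at the base point of `e` with different transverse directions suffice: their only
common direction is that of the edge, and base points that differ would have to differ by two
distinct unit vectors at once. -/
theorem star_injective {e e' : Edge} (h : star e ⊆ star e') : e = e' := by
  obtain ⟨y, i⟩ := e
  obtain ⟨y', i'⟩ := e'
  have key : ∀ j, j ≠ i → ∃ k, ((i = i' ∧ j = k) ∨ (i = k ∧ j = i')) ∧
      (y = y' ∨ y = y' - unitVec k) := by
    intro j hj
    have hm : squareAt y i j hj.symm ∈ star (y, i) :=
      mem_star_iff.2 ⟨j, (squareAt_cases _ _ _ _).2, Or.inl (squareAt_cases _ _ _ _).1⟩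
    obtain ⟨k, hk, hx⟩ := mem_star_iff.1 (h hm)
    have := squareAt_cases y i j hj.symm
    rw [this.1] at hx
    refine ⟨k, ?_, hx⟩
    rcases this.2 with h | h <;> rw [h.1, h.2] at hk <;> tauto
  have hex : ∀ i : Fin 4, ∃ j k, j ≠ i ∧ k ≠ i ∧ j ≠ k := by decide
  obtain ⟨j, k, hj, hk, hjk⟩ := hex i
  obtain ⟨a, ha, hya⟩ := key j hj
  obtain ⟨b, hb, hyb⟩ := key k hk
  have hi : i = i' := by
    rcases ha with ha | ha
    · exact ha.1
    · rcases hb with hb | hb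
      · exact hb.1
      · exact absurd (ha.2.trans hb.2.symm) hjk
  subst hi
  have haj : a = j := by
    rcases ha with ha | ha
    · exact ha.2.symm
    · exact absurd ha.2 hj
  have hbk : b = k := by
    rcases hb with hb | hb
    · exact hb.2.symm
    · exact absurd hb.2 hk
  subst haj hbk
  have : y = y' := by
    rcases hya with h | hya
    · exact h
    · rcases hyb with h | hyb
      · exact h
      · exact absurd (unitVec_injective (sub_right_injective (hya.symm.trans hyb))) hjk
  rw [this]

end LatticeGauge
namespace LatticeGauge

/-! ### Closed `2`-forms supported on at most six plaquettes -/

/-- A nonempty finite bipartite simple graph of minimal degree two, given by the two end points of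
its edges, has at least four edges. -/
theorem four_le_card_of_two_ends {α V : Type*} {F : Finset α} {a b : α → V}
    (hne : F.Nonempty) (hinj : ∀ p ∈ F, ∀ q ∈ F, a p = a q → b p = b q → p = q)
    (ha : ∀ p ∈ F, ∃ q ∈ F, q ≠ p ∧ a q = a p) (hb : ∀ p ∈ F, ∃ q ∈ F, q ≠ p ∧ b q = b p) :
    4 ≤ F.card := by
  classical
  obtain ⟨p, hp⟩ := hne
  obtain ⟨q, hq, hqp, haq⟩ := ha p hp
  obtain ⟨r, hr, hrp, hbr⟩ := hb p hp
  -- Since `p` and `q` share one end and the graph is simple, their other ends differ; the further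
  -- edges at those two ends are therefore new and distinct.
  have hbq : b q ≠ b p := fun h => hqp (hinj q hq p hp haq h)
  obtain ⟨s, hs, hsq, hbs⟩ := hb q hq
  have hsp : s ≠ p := by rintro rfl; exact hbq hbs.symm
  have hrs : r ≠ s := by rintro rfl; exact hbq (hbs.symm.trans hbr)
  have hqr : q ≠ r := by rintro rfl; exact hbq hbr
  have hsub : ({p, q, r, s} : Finset α) ⊆ F := by
    intro t ht; simp only [Finset.mem_insert, Finset.mem_singleton] at ht
    rcases ht with rfl | rfl | rfl | rfl <;> assumption
  refine le_trans (le_of_eq ?_) (Finset.card_le_card hsub)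
  rw [Finset.card_insert_of_notMem, Finset.card_insert_of_notMem, Finset.card_insert_of_notMem,
    Finset.card_singleton]
  · simpa using hrs
  · simp only [Finset.mem_insert, Finset.mem_singleton, not_or]; exact ⟨hqr, hsq.symm⟩
  · simp only [Finset.mem_insert, Finset.mem_singleton, not_or]
    exact ⟨hqp.symm, hrp.symm, hsp.symm⟩

theorem sum_unitVec_eq {i j k l : Fin 4} (hij : i ≠ j) (hik : i ≠ k) (hil : i ≠ l) (hjk : j ≠ k)
    (hjl : j ≠ l) (hkl : k ≠ l) : unitVec i + unitVec j + unitVec k + unitVec l = 1 := by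
  have h : ∀ i j k l r : Fin 4, i ≠ j → i ≠ k → i ≠ l → j ≠ k → j ≠ l → k ≠ l →
      r = i ∨ r = j ∨ r = k ∨ r = l := by decide
  ext r
  simp only [Pi.add_apply, Pi.one_apply]
  rcases h i j k l r hij hik hil hjk hjl hkl with rfl | rfl | rfl | rfl
  · rw [unitVec_apply_self, unitVec_apply_ne hij, unitVec_apply_ne hik, unitVec_apply_ne hil]; rfl
  · rw [unitVec_apply_self, unitVec_apply_ne hij.symm, unitVec_apply_ne hjk,
      unitVec_apply_ne hjl]; rfl
  · rw [unitVec_apply_self, unitVec_apply_ne hik.symm, unitVec_apply_ne hjk.symm,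
      unitVec_apply_ne hkl]; rfl
  · rw [unitVec_apply_self, unitVec_apply_ne hil.symm, unitVec_apply_ne hjl.symm,
      unitVec_apply_ne hkl.symm]; rfl

/-- The parity of the coordinate sum of a vertex. -/
def IsEvenVertex (x : Vertex) : Prop := Even (∑ r, x r)

theorem sum_unitVec_coords (i : Fin 4) : ∑ r, unitVec i r = 1 := by
  simp [unitVec]

theorem isEvenVertex_sub_unitVec (x : Vertex) (i : Fin 4) :
    IsEvenVertex (x - unitVec i) ↔ ¬ IsEvenVertex x := by
  unfold IsEvenVertex
  simp only [Pi.sub_apply, Finset.sum_sub_distrib, sum_unitVec_coords]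
  exact Int.even_sub_one

section Classification

variable {A : Type*} [AddCommGroup A]

/-- In the hyperplane orthogonal to `k`, the plaquette `p` separates the cubes at `p.1` and at
`backCube k p`. -/
def backCube (k : Fin 4) (p : Plaquette) : Vertex :=
  p.1 + unitVec p.2.1.1 + unitVec p.2.1.2 + unitVec k - 1

/-- The four unit vectors sum to `1`, so the definition of `backCube` subtracts the fourth direction
without having to name it. -/
theorem backCube_eq {k l i j : Fin 4} {p : Plaquette}
    (hp : (p.2.1.1 = i ∧ p.2.1.2 = j) ∨ (p.2.1.1 = j ∧ p.2.1.2 = i))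
    (hij : i ≠ j) (hik : i ≠ k) (hil : i ≠ l) (hjk : j ≠ k)
    (hjl : j ≠ l) (hkl : k ≠ l) : backCube k p = p.1 - unitVec l := by
  unfold backCube
  rw [← sum_unitVec_eq hij hik hil hjk hjl hkl]
  rcases hp with hp | hp <;> rw [hp.1, hp.2] <;> abel

theorem exists_fourth : ∀ i j k : Fin 4, i ≠ j → i ≠ k → j ≠ k →
    ∃ l, i ≠ l ∧ j ≠ l ∧ k ≠ l := by decide

open Classical in
/-- The even one of the two cubes adjacent to `p` in the hyperplane orthogonal to `k`. -/
noncomputable def evenCube (k : Fin 4) (p : Plaquette) : Vertex :=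
  if IsEvenVertex p.1 then p.1 else backCube k p

open Classical in
/-- The odd one of the two cubes adjacent to `p` in the hyperplane orthogonal to `k`. -/
noncomputable def oddCube (k : Fin 4) (p : Plaquette) : Vertex :=
  if IsEvenVertex p.1 then backCube k p else p.1

/-- `p` lies in the hyperplane `x k = m`. -/
def InHyperplane (k : Fin 4) (m : ℤ) (p : Plaquette) : Prop :=
  p.2.1.1 ≠ k ∧ p.2.1.2 ≠ k ∧ p.1 k = m

theorem isEvenVertex_backCube {k : Fin 4} {m : ℤ} {p : Plaquette} (hp : InHyperplane k m p) :
    IsEvenVertex (backCube k p) ↔ ¬ IsEvenVertex p.1 := by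
  obtain ⟨l, h1, h2, h3⟩ := exists_fourth _ _ k p.2.2.ne hp.1 hp.2.1
  rw [backCube_eq (Or.inl ⟨rfl, rfl⟩) p.2.2.ne hp.1 h1 hp.2.1 h2 h3, isEvenVertex_sub_unitVec]

theorem evenCube_eq {k : Fin 4} {m : ℤ} {q : Plaquette} (hq : InHyperplane k m q) {c : Vertex}
    (hc : c = q.1 ∨ c = backCube k q) (he : IsEvenVertex c) : evenCube k q = c := by
  unfold evenCube
  rcases hc with rfl | rfl
  · rw [if_pos he]
  · rw [if_neg ((isEvenVertex_backCube hq).1 he)]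

theorem oddCube_eq {k : Fin 4} {m : ℤ} {q : Plaquette} (hq : InHyperplane k m q) {c : Vertex}
    (hc : c = q.1 ∨ c = backCube k q) (he : ¬ IsEvenVertex c) : oddCube k q = c := by
  unfold oddCube
  rcases hc with rfl | rfl
  · rw [if_neg he]
  · rw [if_pos (by by_contra h; exact he ((isEvenVertex_backCube hq).2 h))]

/-- This makes the graph simple whose vertices are the cubes of the hyperplane and whose edges are
its plaquettes; parity of the coordinate sum makes it bipartite. -/
theorem eq_of_evenCube_of_oddCube {k : Fin 4} {m : ℤ} {p q : Plaquette}
    (hp : InHyperplane k m p) (hq : InHyperplane k m q) (he : evenCube k p = evenCube k q)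
    (ho : oddCube k p = oddCube k q) : p = q := by
  obtain ⟨l, h1, h2, h3⟩ := exists_fourth _ _ k p.2.2.ne hp.1 hp.2.1
  obtain ⟨l', h1', h2', h3'⟩ := exists_fourth _ _ k q.2.2.ne hq.1 hq.2.1
  have e1 := backCube_eq (p := p) (Or.inl ⟨rfl, rfl⟩) p.2.2.ne hp.1 h1 hp.2.1 h2 h3
  have e2 := backCube_eq (p := q) (Or.inl ⟨rfl, rfl⟩) q.2.2.ne hq.1 h1' hq.2.1 h2' h3'
  -- The front cube of one plaquette cannot be the back cube of the other in both roles, since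
  -- coordinate sums would decrease around a cycle.
  have swap : ∀ x y : Vertex, x = y - unitVec l' → x - unitVec l = y → False := by
    intro x y hx hy
    have h1 := congrArg (fun z : Vertex => ∑ r, z r) hx
    have h2 := congrArg (fun z : Vertex => ∑ r, z r) hy
    simp only [Pi.sub_apply, Finset.sum_sub_distrib, sum_unitVec_coords] at h1 h2
    omega
  have hboth : p.1 = q.1 ∧ p.1 - unitVec l = q.1 - unitVec l' := by
    unfold evenCube at he
    unfold oddCube at ho
    rw [e1, e2] at he ho
    split_ifs at he ho with hep heq heq
    · exact ⟨he, ho⟩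
    · exact (swap _ _ he ho).elim
    · exact (swap _ _ ho he).elim
    · exact ⟨ho, he⟩
  have hl : l = l' := by
    have := hboth.2; rw [hboth.1] at this
    exact unitVec_injective (sub_right_injective this)
  subst hl
  have hd : ∀ a b c d k l : Fin 4, a < b → c < d → a ≠ k → b ≠ k → c ≠ k → d ≠ k → a ≠ l → b ≠ l →
      c ≠ l → d ≠ l → k ≠ l → a = c ∧ b = d := by decide
  have := hd _ _ _ _ k l p.2.2 q.2.2 hp.1 hp.2.1 hq.1 hq.2.1 h1 h2 h1' h2' h3
  exact plaquette_ext hboth.1 this.1 this.2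

variable {ω : Vertex → Fin 4 → Fin 4 → A}

theorem IsAlternating.exists_plaquette (ha : IsAlternating ω) {S : Finset Plaquette}
    (hS : ∀ p, p ∈ S ↔ ω p.1 p.2.1.1 p.2.1.2 ≠ 0) {x : Vertex} {i j : Fin 4}
    (h : ω x i j ≠ 0) : ∃ p ∈ S, p.1 = x ∧
      ((p.2.1.1 = i ∧ p.2.1.2 = j) ∨ (p.2.1.1 = j ∧ p.2.1.2 = i)) := by
  rcases lt_trichotomy i j with hij | rfl | hij
  · exact ⟨(x, ⟨(i, j), hij⟩), (hS _).2 h, rfl, Or.inl ⟨rfl, rfl⟩⟩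
  · exact absurd (ha.self x i) h
  · refine ⟨(x, ⟨(j, i), hij⟩), (hS _).2 ?_, rfl, Or.inr ⟨rfl, rfl⟩⟩
    simp only; rw [ha.symm]; exact neg_ne_zero.2 h

/-- Every cube that contains a plaquette of the support contains another one. -/
theorem exists_other_plaquette (ha : IsAlternating ω) (hω : ∀ x i j k, diff₂ ω x i j k = 0)
    {S : Finset Plaquette} (hS : ∀ p, p ∈ S ↔ ω p.1 p.2.1.1 p.2.1.2 ≠ 0) {k : Fin 4} {m : ℤ}
    {p : Plaquette} (hpS : p ∈ S) (hp : InHyperplane k m p) {c : Vertex}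
    (hc : c = p.1 ∨ c = backCube k p) :
    ∃ q ∈ S, InHyperplane k m q ∧ q ≠ p ∧ (c = q.1 ∨ c = backCube k q) := by
  obtain ⟨l, hil, hjl, hkl⟩ := exists_fourth _ _ k p.2.2.ne hp.1 hp.2.1
  set i := p.2.1.1 with hi
  set j := p.2.1.2 with hj
  have hij : i ≠ j := p.2.2.ne
  have hik : i ≠ k := hp.1
  have hjk : j ≠ k := hp.2.1
  have hback : backCube k p = p.1 - unitVec l :=
    backCube_eq (Or.inl ⟨rfl, rfl⟩) hij hik hil hjk hjl hkl
  have hck : c k = m := by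
    rcases hc with rfl | rfl
    · exact hp.2.2
    · rw [hback]; simp [unitVec_apply_ne hkl, hp.2.2]
  -- the faces of the cube `c` containing direction `l`
  have side : ∀ a b : Fin 4, a ≠ b → a ≠ k → a ≠ l → b ≠ k → b ≠ l →
      (ω (c + unitVec a) l b ≠ 0 ∨ ω c l b ≠ 0) →
      ∃ q ∈ S, InHyperplane k m q ∧ q ≠ p ∧ (c = q.1 ∨ c = backCube k q) := by
    intro a b hab hak hal hbk hbl h
    have fin : ∀ q ∈ S, ((q.2.1.1 = l ∧ q.2.1.2 = b) ∨ (q.2.1.1 = b ∧ q.2.1.2 = l)) →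
        q.1 k = m → (c = q.1 ∨ c = backCube k q) →
        ∃ q ∈ S, InHyperplane k m q ∧ q ≠ p ∧ (c = q.1 ∨ c = backCube k q) := by
      intro q hq hd hqk hcq
      refine ⟨q, hq, ⟨?_, ?_, hqk⟩, ?_, hcq⟩
      · rcases hd with hd | hd <;> rw [hd.1]
        exacts [hkl.symm, hbk]
      · rcases hd with hd | hd <;> rw [hd.2]
        exacts [hbk, hkl.symm]
      · rintro rfl
        rcases hd with hd | hd
        · exact hil hd.1
        · exact hjl hd.2
    rcases h with h | h
    · obtain ⟨q, hq, hqx, hqd⟩ := ha.exists_plaquette hS h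
      refine fin q hq hqd ?_ (Or.inr ?_)
      · rw [hqx]; simp [unitVec_apply_ne hak.symm, hck]
      · rw [backCube_eq hqd hbl.symm hkl.symm hal.symm hbk hab.symm hak.symm, hqx]; abel
    · obtain ⟨q, hq, hqx, hqd⟩ := ha.exists_plaquette hS h
      exact fin q hq hqd (by rw [hqx, hck]) (Or.inl hqx.symm)
  have hcube := hω c l i j
  simp only [diff₂] at hcube
  by_cases h1 : ω (c + unitVec i) l j ≠ 0 ∨ ω c l j ≠ 0
  · exact side i j hij hik hil hjk hjl h1
  by_cases h2 : ω (c + unitVec j) l i ≠ 0 ∨ ω c l i ≠ 0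
  · exact side j i hij.symm hjk hjl hik hil h2
  -- All four side faces of the cube carry `0`, so closedness equates the values on the two faces
  -- orthogonal to `l`. One of them is `p`, the other is the plaquette sought.
  push Not at h1 h2
  rw [h1.1, h1.2, h2.1, h2.2] at hcube
  simp only [sub_zero, add_zero] at hcube
  have heq := sub_eq_zero.1 hcube
  have hpω := (hS p).1 hpS
  have opp : ∀ z, ω z i j ≠ 0 → z ≠ p.1 → z k = m → (∀ q : Plaquette, q.1 = z →
      q.2.1.1 = i → q.2.1.2 = j → c = q.1 ∨ c = backCube k q) →
      ∃ q ∈ S, InHyperplane k m q ∧ q ≠ p ∧ (c = q.1 ∨ c = backCube k q) := by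
    intro z hz hzp hzk hzc
    refine ⟨(z, p.2), (hS _).2 hz, ⟨hik, hjk, hzk⟩, ?_, hzc _ rfl rfl rfl⟩
    intro h; exact hzp (congrArg Prod.fst h)
  rcases hc with hc | hc
  · refine opp (c + unitVec l) ?_ ?_ ?_ ?_
    · rw [heq, hc]; exact hpω
    · rw [hc]; simp [unitVec_ne_zero]
    · simp [unitVec_apply_ne hkl, hck]
    · intro q hqz hqi hqj
      right
      rw [backCube_eq (Or.inl ⟨hqi, hqj⟩) hij hik hil hjk hjl hkl, hqz]; abel
  · have hcl : c + unitVec l = p.1 := by rw [hc, hback]; abel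
    refine opp c ?_ ?_ hck ?_
    · rw [← heq, hcl]; exact hpω
    · rw [← hcl]; simp [unitVec_ne_zero]
    · intro q hqz _ _; exact Or.inl hqz.symm

open Classical in
/-- An occupied hyperplane contains at least four plaquettes of the support. -/
theorem four_le_card_inHyperplane (ha : IsAlternating ω) (hω : ∀ x i j k, diff₂ ω x i j k = 0)
    {S : Finset Plaquette} (hS : ∀ p, p ∈ S ↔ ω p.1 p.2.1.1 p.2.1.2 ≠ 0) {k : Fin 4} {m : ℤ}
    {p : Plaquette} (hpS : p ∈ S) (hp : InHyperplane k m p) :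
    4 ≤ (S.filter (InHyperplane k m)).card := by
  refine four_le_card_of_two_ends (a := evenCube k) (b := oddCube k)
    ⟨p, Finset.mem_filter.2 ⟨hpS, hp⟩⟩ ?_ ?_ ?_
  · intro p hp q hq
    exact eq_of_evenCube_of_oddCube (Finset.mem_filter.1 hp).2 (Finset.mem_filter.1 hq).2
  · intro p hp
    obtain ⟨hpS, hp⟩ := Finset.mem_filter.1 hp
    have hc : evenCube k p = p.1 ∨ evenCube k p = backCube k p := by
      unfold evenCube; split_ifs <;> simp
    have he : IsEvenVertex (evenCube k p) := by
      unfold evenCube; split_ifs with h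
      exacts [h, (isEvenVertex_backCube hp).2 h]
    obtain ⟨q, hqS, hq, hqp, hcq⟩ := exists_other_plaquette ha hω hS hpS hp hc
    exact ⟨q, Finset.mem_filter.2 ⟨hqS, hq⟩, hqp, evenCube_eq hq hcq he⟩
  · intro p hp
    obtain ⟨hpS, hp⟩ := Finset.mem_filter.1 hp
    have hc : oddCube k p = p.1 ∨ oddCube k p = backCube k p := by
      unfold oddCube; split_ifs <;> simp
    have he : ¬ IsEvenVertex (oddCube k p) := by
      unfold oddCube; split_ifs with h
      exacts [fun h' => (isEvenVertex_backCube hp).1 h' h, h]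
    obtain ⟨q, hqS, hq, hqp, hcq⟩ := exists_other_plaquette ha hω hS hpS hp hc
    exact ⟨q, Finset.mem_filter.2 ⟨hqS, hq⟩, hqp, oddCube_eq hq hcq he⟩

open Classical in
/-- A closed form supported on at most six plaquettes meets at most three hyperplanes: there is a
direction common to all plaquettes, and the positions in the other directions are fixed. -/
theorem exists_common_direction (ha : IsAlternating ω) (hω : ∀ x i j k, diff₂ ω x i j k = 0)
    {S : Finset Plaquette} (hS : ∀ p, p ∈ S ↔ ω p.1 p.2.1.1 p.2.1.2 ≠ 0) (hcard : S.card ≤ 6)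
    (hne : S.Nonempty) :
    ∃ (i₀ : Fin 4) (m : Fin 4 → ℤ), (∀ p ∈ S, p.2.1.1 = i₀ ∨ p.2.1.2 = i₀) ∧
      ∀ p ∈ S, ∀ k, p.2.1.1 ≠ k → p.2.1.2 ≠ k → p.1 k = m k := by
  -- Double counting: each plaquette lies in two coordinate hyperplanes, giving at most `12`
  -- incidences, and each occupied hyperplane uses at least four of them.
  set Inc : Finset (Plaquette × Fin 4) :=
    (S ×ˢ Finset.univ).filter fun q => q.1.2.1.1 ≠ q.2 ∧ q.1.2.1.2 ≠ q.2 with hInc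
  set f : Plaquette × Fin 4 → Fin 4 × ℤ := fun q => (q.2, q.1.1 q.2) with hf
  set O := Inc.image f with hO
  have hIncCard : Inc.card ≤ 12 := by
    have h2 : ∀ a b : Fin 4, a < b →
        (Finset.univ.filter fun k => a ≠ k ∧ b ≠ k).card = 2 := by decide
    have : Inc.card = ∑ p ∈ S, (Finset.univ.filter fun k => p.2.1.1 ≠ k ∧ p.2.1.2 ≠ k).card := by
      rw [hInc, Finset.card_filter, Finset.sum_product]
      simp only [Finset.card_filter]
    rw [this, Finset.sum_congr rfl fun p _ => h2 _ _ p.2.2]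
    simp; omega
  have hOcard : O.card ≤ 3 := by
    have h4 : ∀ o ∈ O, 4 ≤ (Inc.filter fun q => f q = o).card := by
      intro o ho
      obtain ⟨⟨p, k⟩, hpk, rfl⟩ := Finset.mem_image.1 ho
      simp only [hInc, Finset.mem_filter, Finset.mem_product, Finset.mem_univ, and_true] at hpk
      refine (four_le_card_inHyperplane ha hω hS (k := k) (m := p.1 k) hpk.1
        ⟨hpk.2.1, hpk.2.2, rfl⟩).trans ?_
      refine Finset.card_le_card_of_injOn (fun q => (q, k)) ?_ ?_
      · intro q hq
        obtain ⟨hqS, hq1, hq2, hq3⟩ := Finset.mem_filter.1 hq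
        simp [hInc, hf, hqS, hq1, hq2, hq3]
      · intro q _ q' _ h; exact congrArg Prod.fst h
    have h6 : Inc.card = ∑ o ∈ O, (Inc.filter fun q => f q = o).card := by
      convert Finset.card_eq_sum_card_image f Inc
    have h5 := Finset.card_nsmul_le_sum O _ 4 h4
    rw [smul_eq_mul] at h5
    omega
  have hmem : ∀ p ∈ S, ∀ k, p.2.1.1 ≠ k → p.2.1.2 ≠ k → (k, p.1 k) ∈ O := by
    intro p hp k h1 h2
    exact Finset.mem_image.2 ⟨(p, k), by simp [hInc, hp, h1, h2], rfl⟩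
  -- two directions cannot both be common to all plaquettes
  have hone : ∀ k k' : Fin 4, k ≠ k' → k ∉ O.image Prod.fst → k' ∉ O.image Prod.fst → False := by
    intro k k' hkk hk hk'
    have hall : ∀ a, a ∉ O.image Prod.fst → ∀ p ∈ S, p.2.1.1 = a ∨ p.2.1.2 = a := by
      intro a haO p hp
      by_contra hcon; push Not at hcon
      exact haO (Finset.mem_image.2 ⟨_, hmem p hp a hcon.1 hcon.2, rfl⟩)
    have hex : ∀ k k' : Fin 4, k ≠ k' → ∃ l l', k ≠ l ∧ k ≠ l' ∧ k' ≠ l ∧ k' ≠ l' ∧ l ≠ l' := by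
      decide
    obtain ⟨l, l', hkl, hkl', hk'l, hk'l', hll⟩ := hex k k' hkk
    -- Otherwise all plaquettes would be parallel. The cube in front of one that is extremal in
    -- direction `l` needs a second face from `S`, which could only be its translate further out.
    obtain ⟨p, hpS, hmax⟩ := Finset.exists_max_image S (fun p => p.1 l) hne
    have hdir : ∀ q ∈ S, (q.2.1.1 = k ∧ q.2.1.2 = k') ∨ (q.2.1.1 = k' ∧ q.2.1.2 = k) := by
      intro q hq
      have h1 := hall k hk q hq
      have h2 := hall k' hk' q hq
      rcases h1 with h1 | h1 <;> rcases h2 with h2 | h2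
      · exact absurd (h1.symm.trans h2) hkk
      · exact Or.inl ⟨h1, h2⟩
      · exact Or.inr ⟨h2, h1⟩
      · exact absurd (h1.symm.trans h2) hkk
    have hpl : InHyperplane l' (p.1 l') p := by
      rcases hdir p hpS with h | h
      · exact ⟨by rw [h.1]; exact hkl', by rw [h.2]; exact hk'l', rfl⟩
      · exact ⟨by rw [h.1]; exact hk'l', by rw [h.2]; exact hkl', rfl⟩
    obtain ⟨q, hqS, hq, hqp, hc⟩ := exists_other_plaquette ha hω hS hpS hpl (Or.inl rfl)
    have hqb := backCube_eq (p := q) (k := l') (l := l) (hdir q hqS) hkk hkl' hkl hk'l' hk'l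
      hll.symm
    rcases hc with hc | hc
    · exact hqp (plaquette_ext_of_dirs hc.symm (hdir q hqS) (hdir p hpS))
    · have := hmax q hqS
      have h2 := congrFun (hc.trans hqb) l
      simp only [Pi.sub_apply, unitVec_apply_self] at h2
      omega
  have hcardle : (O.image Prod.fst).card ≤ O.card := Finset.card_image_le
  obtain ⟨i₀, hi₀⟩ : ∃ i₀, i₀ ∉ O.image Prod.fst := by
    by_contra hcon; push Not at hcon
    have : O.image Prod.fst = Finset.univ := Finset.eq_univ_iff_forall.2 hcon
    rw [this] at hcardle
    simp at hcardle; omega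
  have himg : O.image Prod.fst = Finset.univ.erase i₀ := by
    ext k
    simp only [Finset.mem_erase, Finset.mem_univ, and_true]
    constructor
    · rintro h rfl; exact hi₀ h
    · intro h; by_contra hk; exact hone k i₀ h hk hi₀
  -- Three occupied directions and at most three hyperplanes: there is exactly one hyperplane for
  -- each direction, and its position is `m`.
  have hinj : Set.InjOn Prod.fst (O : Set (Fin 4 × ℤ)) := by
    apply Finset.card_image_iff.1
    apply le_antisymm hcardle
    rw [himg, Finset.card_erase_of_mem (Finset.mem_univ _)]
    simpa using hOcard
  have hm : ∀ k, ∃ m, ∀ m', (k, m') ∈ O → m' = m := by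
    intro k
    by_cases h : ∃ m, (k, m) ∈ O
    · obtain ⟨m, hm⟩ := h
      exact ⟨m, fun m' hm' => congrArg Prod.snd (hinj hm' hm rfl)⟩
    · push Not at h
      exact ⟨0, fun m' hm' => absurd hm' (h m')⟩
  choose m hm using hm
  refine ⟨i₀, m, ?_, fun p hp k h1 h2 => hm k _ (hmem p hp k h1 h2)⟩
  intro p hp
  by_contra hcon; push Not at hcon
  exact hi₀ (Finset.mem_image.2 ⟨_, hmem p hp i₀ hcon.1 hcon.2, rfl⟩)

/-- A nonzero closed `2`-form supported on at most six plaquettes is the differential of a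
`1`-form supported on a single edge. -/
theorem eq_curl_single_of_card_le_six (ha : IsAlternating ω)
    (hω : ∀ x i j k, diff₂ ω x i j k = 0)
    {S : Finset Plaquette} (hS : ∀ p, p ∈ S ↔ ω p.1 p.2.1.1 p.2.1.2 ≠ 0) (hcard : S.card ≤ 6)
    (hne : S.Nonempty) :
    ∃ (e : Edge) (g : A), S = star e ∧ ∀ x i j, ω x i j = curl (Pi.single e g) x i j := by
  classical
  obtain ⟨i₀, m, hcom, hpos⟩ := exists_common_direction ha hω hS hcard hne
  have h0 : ∀ x j k, j ≠ i₀ → k ≠ i₀ → ω x j k = 0 := by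
    intro x j k hj hk
    by_contra h
    obtain ⟨p, hp, _, hd⟩ := ha.exists_plaquette hS h
    rcases hd with hd | hd <;> rcases hcom p hp with h' | h' <;> simp_all
  have hsup : ∀ x j k, k ≠ i₀ → k ≠ j → ω x i₀ j ≠ 0 → x k = m k := by
    intro x j k hk hkj h
    obtain ⟨p, hp, rfl, hd⟩ := ha.exists_plaquette hS h
    rcases hd with hd | hd
    · exact hpos p hp k (by rw [hd.1]; exact hk.symm) (by rw [hd.2]; exact hkj.symm)
    · exact hpos p hp k (by rw [hd.1]; exact hkj.symm) (by rw [hd.2]; exact hk.symm)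
  have hcl : ∀ x j k, j ≠ i₀ → k ≠ i₀ →
      ω (x + unitVec j) i₀ k - ω x i₀ k = ω (x + unitVec k) i₀ j - ω x i₀ j := by
    intro x j k hj hk
    have := hω x i₀ j k
    simp only [diff₂, h0 _ j k hj hk] at this
    rw [← sub_eq_zero, ← neg_eq_zero, ← this]; abel
  -- In `hcl`, the term at `x + unitVec k` drops out because its `k`-coordinate is `m k + 1`.
  have hfirst : ∀ x j k, j ≠ i₀ → k ≠ i₀ → j ≠ k → (∀ r, r ≠ i₀ → r ≠ j → x r = m r) →
      ω x i₀ j = ω x i₀ k - ω (x + unitVec j) i₀ k := by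
    intro x j k hj hk hjk hx
    have h1 : ω (x + unitVec k) i₀ j = 0 := by
      by_contra h
      have := hsup _ _ k hk hjk.symm h
      simp [unitVec_apply_self, hx k hk hjk.symm] at this
    have := hcl x j k hj hk
    rw [h1, zero_sub] at this
    rw [← neg_sub, this, neg_neg]
  obtain ⟨j₁, hj₁⟩ : ∃ j, j ≠ i₀ := (by decide : ∀ i : Fin 4, ∃ j, j ≠ i) i₀
  -- The primitive is `F` in direction `i₀`, living on the line where all other coordinates are
  -- fixed; the choice of `j₁` does not matter by `hFk`.
  set F : Vertex → A := fun x => if ∀ r, r ≠ i₀ → x r = m r then ω x i₀ j₁ else 0 with hF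
  have hFne : ∀ x, F x ≠ 0 → ∀ r, r ≠ i₀ → x r = m r := by
    intro x hx; by_contra h; exact hx (by rw [hF]; simp only [if_neg h])
  have hshift : ∀ x j, j ≠ i₀ → F x ≠ 0 → F (x + unitVec j) = 0 := by
    intro x j hj hx
    by_contra h
    have h1 := hFne _ h j hj
    have h2 := hFne _ hx j hj
    simp [unitVec_apply_self, h2] at h1
  have hFk : ∀ x k, k ≠ i₀ → (∀ r, r ≠ i₀ → x r = m r) → ω x i₀ k = F x := by
    intro x k hk hx
    rw [hF]; simp only [if_pos hx]
    by_cases hkj : k = j₁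
    · rw [hkj]
    · rw [hfirst x k j₁ hk hj₁ hkj fun r hr _ => hx r hr]
      have : ω (x + unitVec k) i₀ j₁ = 0 := by
        by_contra h
        have := hsup _ _ k hk hkj h
        simp [unitVec_apply_self, hx k hk] at this
      rw [this, sub_zero]
  have hform : ∀ x j, j ≠ i₀ → ω x i₀ j = F x - F (x + unitVec j) := by
    intro x j hj
    by_cases hx : ∀ r, r ≠ i₀ → r ≠ j → x r = m r
    · obtain ⟨k, hk1, hk2⟩ :=
        (by decide : ∀ i j : Fin 4, i ≠ j → ∃ k, i ≠ k ∧ j ≠ k) i₀ j hj.symm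
      have hk : ∀ y : Vertex, (∀ r, r ≠ i₀ → r ≠ j → y r = m r) → ω y i₀ k = F y := by
        intro y hy
        by_cases hyj : y j = m j
        · refine hFk y k hk1.symm fun r hr => ?_
          by_cases hrj : r = j
          · rw [hrj]; exact hyj
          · exact hy r hr hrj
        · have e1 : ω y i₀ k = 0 := by
            by_contra h; exact hyj (hsup _ _ j hj hk2 h)
          have e2 : F y = 0 := by
            by_contra h; exact hyj (hFne _ h j hj)
          rw [e1, e2]
      rw [hfirst x j k hj hk1.symm hk2 hx, hk x hx, hk]
      intro r hr hrj
      simp [unitVec_apply_ne hrj, hx r hr hrj]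
    · have e1 : ω x i₀ j = 0 := by
        by_contra h; exact hx fun r hr hrj => hsup _ _ r hr hrj h
      have e2 : F x = 0 := by
        by_contra h; exact hx fun r hr _ => hFne _ h r hr
      have e3 : F (x + unitVec j) = 0 := by
        by_contra h; refine hx fun r hr hrj => ?_
        have := hFne _ h r hr
        simpa [unitVec_apply_ne hrj] using this
      rw [e1, e2, e3, sub_zero]
  -- A transverse neighbour of `y` is off the line, so nothing cancels and `y` contributes all six
  -- plaquettes around it. With at most six available, `F` has a single nonzero value.
  have hstar : ∀ y, F y ≠ 0 → star (y, i₀) ⊆ S := by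
    intro y hy p hp
    obtain ⟨j, hd, hx⟩ := mem_star_iff.1 hp
    have hj : j ≠ i₀ := by
      rintro rfl
      have := p.2.2
      rcases hd with hd | hd <;> (rw [hd.1, hd.2] at this; exact lt_irrefl _ this)
    have hne : ω p.1 i₀ j ≠ 0 := by
      rw [hform _ _ hj]
      rcases hx with hx | hx
      · rw [hx, hshift y j hj hy, sub_zero]; exact hy
      · have e1 : F (y - unitVec j) = 0 := by
          by_contra h
          have := hshift _ j hj h
          rw [sub_add_cancel] at this
          exact hy this
        rw [hx]; simp only [sub_add_cancel, e1, zero_sub]; exact neg_ne_zero.2 hy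
    rw [hS]
    rcases hd with hd | hd
    · rw [hd.1, hd.2]; exact hne
    · rw [hd.1, hd.2, ha.symm]; exact neg_ne_zero.2 hne
  obtain ⟨y, hy⟩ : ∃ y, F y ≠ 0 := by
    by_contra hcon; push Not at hcon
    obtain ⟨p, hp⟩ := hne
    have hpω := (hS p).1 hp
    rcases hcom p hp with h | h
    · have hj : p.2.1.2 ≠ i₀ := by rw [← h]; exact p.2.2.ne'
      rw [h, hform _ _ hj, hcon, hcon, sub_zero] at hpω
      exact hpω rfl
    · have hj : p.2.1.1 ≠ i₀ := by rw [← h]; exact p.2.2.ne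
      rw [h, ha.symm, hform _ _ hj, hcon, hcon] at hpω
      simp at hpω
  have hSy : ∀ z, F z ≠ 0 → S = star (z, i₀) := fun z hz =>
    (Finset.eq_of_subset_of_card_le (hstar z hz) (by rw [card_star]; exact hcard)).symm
  refine ⟨(y, i₀), F y, hSy y hy, ?_⟩
  have hFz : ∀ z, F z = (Pi.single (y, i₀) (F y) : Edge → A) (z, i₀) := by
    intro z
    by_cases hz : z = y
    · subst hz; simp
    · rw [Pi.single_eq_of_ne (by simpa using hz)]
      by_contra h
      have := star_injective (e := (z, i₀)) (e' := (y, i₀))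
        (by rw [← hSy z h, ← hSy y hy])
      exact hz (congrArg Prod.fst this)
  have hzero : ∀ z j, j ≠ i₀ → (Pi.single (y, i₀) (F y) : Edge → A) (z, j) = 0 := by
    intro z j hj; exact Pi.single_eq_of_ne (by simp [hj]) _
  have hi : ∀ x j, j ≠ i₀ → ω x i₀ j = curl (Pi.single (y, i₀) (F y)) x i₀ j := by
    intro x j hj
    rw [hform x j hj]
    simp only [curl, hzero _ j hj, ← hFz]; abel
  intro x i j
  by_cases h1 : i = i₀
  · subst h1
    by_cases h2 : j = i
    · subst h2; rw [ha.self, (isAlternating_curl _).self]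
    · exact hi x j h2
  · by_cases h2 : j = i₀
    · subst h2; rw [ha.symm, (isAlternating_curl _).symm, hi x i h1]
    · rw [h0 x i j h1 h2]; simp [curl, hzero _ i h1, hzero _ j h2]

end Classification

end LatticeGauge
namespace LatticeGauge

/-! ### Poincaré lemmas with controlled supports, and on boxes. -/

section LocalPoincare

variable {A : Type*} [AddCommGroup A]

theorem signedSum_change_base (a b : ℤ) (f : ℤ → A) (t : ℤ) :
    signedSum a f t = signedSum a f b + signedSum b f t := by
  have := signedSum_telescope b (signedSum a f) t
  simp only [signedSum_succ, add_sub_cancel_left] at this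
  rw [this]; abel

/-! ### Compactly supported forms on `ℤ⁴` -/

/-- A closed `2`-form supported in a cube of `ℤ⁴` is the differential of a `1`-form supported in
the same cube. -/
theorem exists_curl_eq_of_compact {ω : Vertex → Fin 4 → Fin 4 → A} (ha : IsAlternating ω)
    (hω : ∀ x i j k, diff₂ ω x i j k = 0) {p : Vertex} {k : ℤ} (hk : 0 ≤ k)
    (hsupp : ∀ x i j, ω x i j ≠ 0 → ∀ l, |x l - p l| ≤ k) :
    ∃ τ : Edge → A, (∀ x i j, curl τ x i j = ω x i j) ∧
      ∀ e, τ e ≠ 0 → ∀ l, |e.1 l - p l| ≤ k := by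
  have hz : ∀ x i j l, (x l ≤ p l - k - 1 ∨ p l + k + 1 ≤ x l) → ω x i j = 0 := by
    intro x i j l h; by_contra h'
    have := abs_le.1 (hsupp x i j h' l); omega
  set a := p 0 - k - 1 with hadef
  set b := p 0 + k + 1 with hbdef
  -- Integrating from the left gives a primitive vanishing on the left of the cube but with a tail
  -- to the right; `τL` is its mirror image. The tail is to be gauged away.
  set τR := homotopy₂ 0 a ω with hτR
  set τL := homotopy₂ 0 b ω with hτL
  have hR : ∀ x i j, curl τR x i j = ω x i j :=
    curl_homotopy₂_eq ha hω fun x j k hx => hz x j k 0 (Or.inl hx.le)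
  have hL : ∀ x i j, curl τL x i j = ω x i j :=
    curl_homotopy₂_eq ha hω fun x j k hx => hz x j k 0 (Or.inr hx.ge)
  have hR0 : ∀ x j, x 0 ≤ a → τR (x, j) = 0 := fun x j hx =>
    signedSum_eq_zero fun s hs => hz _ _ _ 0 (Or.inl (by
      simp only [Function.update_self]; rcases hs with hs | hs <;> simp only at hs <;> omega))
  have hL0 : ∀ x j, b ≤ x 0 → τL (x, j) = 0 := fun x j hx =>
    signedSum_eq_zero fun s hs => hz _ _ _ 0 (Or.inr (by
      simp only [Function.update_self]; rcases hs with hs | hs <;> simp only at hs <;> omega))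
  have hRs : ∀ x j l, l ≠ 0 → τR (x, j) ≠ 0 → |x l - p l| ≤ k := by
    intro x j l hl h
    by_contra hcon
    refine h (signedSum_eq_zero fun s _ => ?_)
    by_contra h'
    have := hsupp _ _ _ h' l
    rw [Function.update_of_ne hl] at this
    exact hcon this
  -- The tail is closed, independent of coordinate `0`, and supported in a tube around the cube: in
  -- effect a closed compactly supported 1-form in three dimensions.
  set δ : Edge → A := fun e => τR e - τL e with hδ
  have hδ' : ∀ x j, δ (x, j) = signedSum a (fun t => ω (Function.update x 0 t) 0 j) b := by
    intro x j
    simp only [hδ, hτR, hτL, homotopy₂]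
    rw [signedSum_change_base a b]; abel
  have hδc : ∀ x i j, curl δ x i j = 0 := by
    intro x i j; rw [hδ, curl_sub, hR, hL, sub_self]
  have hδ0 : ∀ x j t, δ (Function.update x 0 t, j) = δ (x, j) := by
    intro x j t; rw [hδ', hδ']; simp only [Function.update_idem]
  have hδs : ∀ x j l, l ≠ 0 → δ (x, j) ≠ 0 → |x l - p l| ≤ k := by
    intro x j l hl h
    by_contra hcon
    refine h ?_
    rw [hδ']
    refine signedSum_eq_zero fun s _ => ?_
    by_contra h'
    have := hsupp _ _ _ h' l
    rw [Function.update_of_ne hl] at this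
    exact hcon this
  have hδz : ∀ x j l, l ≠ 0 → (x l ≤ p l - k - 1 ∨ p l + k + 1 ≤ x l) → δ (x, j) = 0 := by
    intro x j l hl h; by_contra h'
    have := abs_le.1 (hδs x j l hl h'); omega
  set a₁ := p 1 - k - 1 with ha₁
  set b₁ := p 1 + k + 1 with hb₁
  -- A potential of the tail, still independent of coordinate `0`.
  set η := homotopy₁ 1 a₁ δ with hη
  have hηδ : ∀ e, grad η e = δ e :=
    grad_homotopy₁_eq hδc fun x j hx => hδz x j 1 (by decide) (Or.inl hx.le)
  have hη2δ : ∀ e, grad (homotopy₁ 1 b₁ δ) e = δ e :=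
    grad_homotopy₁_eq hδc fun x j hx => hδz x j 1 (by decide) (Or.inr hx.ge)
  have hη0 : ∀ x t, η (Function.update x 0 t) = η x := by
    intro x t
    simp only [hη, homotopy₁]
    rw [Function.update_of_ne (by decide)]
    congr 1; ext s
    rw [Function.update_comm (by decide), hδ0]
  have hηs : ∀ x l, l ≠ 0 → l ≠ 1 → ∀ c, homotopy₁ 1 c δ x ≠ 0 → |x l - p l| ≤ k := by
    intro x l hl hl1 c h
    by_contra hcon
    refine h (signedSum_eq_zero fun s _ => ?_)
    by_contra h'
    have := hδs _ _ l hl h'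
    rw [Function.update_of_ne hl1] at this
    exact hcon this
  -- The potentials from the two sides of direction `1` differ by a quantity constant in direction
  -- `2` and zero far out, so they agree. Hence `η` vanishes on both sides and lives in the tube.
  have hηη : ∀ x, η x = homotopy₁ 1 b₁ δ x := by
    intro x
    set C : Vertex → A := fun x => η x - homotopy₁ 1 b₁ δ x with hC
    have hCg : ∀ y, C (y + unitVec 2) - C y = 0 := by
      intro y
      have h1 := hηδ (y, 2)
      have h2 := hη2δ (y, 2)
      simp only [grad] at h1 h2
      have : C (y + unitVec 2) - C y = (η (y + unitVec 2) - η y)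
          - (homotopy₁ 1 b₁ δ (y + unitVec 2) - homotopy₁ 1 b₁ δ y) := by
        simp only [hC]; abel
      rw [this, h1, h2, sub_self]
    set c₂ := p 2 + k + 1 with hc₂
    have htel := signedSum_telescope c₂ (fun t => C (Function.update x 2 t)) (x 2)
    simp only [update_succ, hCg, Function.update_eq_self] at htel
    rw [signedSum_eq_zero fun _ _ => rfl] at htel
    have hCz : C (Function.update x 2 c₂) = 0 := by
      have hfar : ∀ c, homotopy₁ 1 c δ (Function.update x 2 c₂) = 0 := by
        intro c; by_contra h
        have := abs_le.1 (hηs _ 2 (by decide) (by decide) c h)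
        simp only [Function.update_self] at this; omega
      simp only [hC, hη, hfar, sub_zero]
    rw [hCz, sub_zero] at htel
    exact sub_eq_zero.1 htel.symm
  have hηsupp : ∀ x l, l ≠ 0 → η x ≠ 0 → |x l - p l| ≤ k := by
    intro x l hl h
    by_cases hl1 : l = 1
    · subst hl1
      rw [abs_le]
      constructor
      · by_contra hcon
        refine h (signedSum_eq_zero fun s hs => hδz _ _ 1 (by decide) (Or.inl ?_))
        simp only [Function.update_self]; omega
      · by_contra hcon
        rw [hηη] at h
        refine h (signedSum_eq_zero fun s hs => hδz _ _ 1 (by decide) (Or.inr ?_))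
        simp only [Function.update_self]; omega
    · exact hηs x l hl hl1 a₁ h
  -- Cutting the potential off to the left of `b` removes exactly the tail of `τR`.
  set ζ : Vertex → A := fun x => if b ≤ x 0 then η x else 0 with hζ
  refine ⟨fun e => τR e - grad ζ e, ?_, ?_⟩
  · intro x i j; rw [curl_sub, curl_grad, sub_zero, hR]
  · rintro ⟨x, j⟩ h l
    simp only at h ⊢
    have hxj : (x + unitVec j) 0 = x 0 ∨ (j = 0 ∧ (x + unitVec j) 0 = x 0 + 1) := by
      by_cases hj : j = 0
      · right; subst hj; simp [unitVec_apply_self]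
      · left; simp [unitVec_apply_ne (Ne.symm hj)]
    have hlow : a < x 0 := by
      by_contra hcon
      apply h
      rw [hR0 x j (by omega)]
      simp only [grad, hζ]
      rw [if_neg (by omega), if_neg (by omega)]; simp
    have hhigh : x 0 < b := by
      by_contra hcon
      apply h
      have e1 : τR (x, j) = δ (x, j) := by
        simp only [hδ, hL0 x j (by omega), sub_zero]
      rw [e1, ← hηδ]
      simp only [grad, hζ]
      rw [if_pos (by omega), if_pos (by omega)]; simp
    by_cases hl : l = 0
    · subst hl; rw [abs_le]; omega
    · by_cases hτ : τR (x, j) = 0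
      · rw [hτ, zero_sub] at h
        have hg := neg_ne_zero.1 h
        simp only [grad, hζ] at hg
        rw [if_neg (show ¬ b ≤ x 0 by omega), sub_zero] at hg
        rcases hxj with hx | ⟨rfl, hx⟩
        · rw [if_neg (by omega)] at hg; exact absurd rfl hg
        · split_ifs at hg with hcase
          · have e1 : x + unitVec 0 = Function.update x 0 (x 0 + 1) := by
              rw [update_succ, Function.update_eq_self]
            rw [e1, hη0] at hg
            exact hηsupp x l hl hg
          · exact absurd rfl hg
      · exact hRs x j l hl hτ

/-! ### Forms on boxes -/

theorem mem_box {N : ℕ} {x : Vertex} : x ∈ box N ↔ ∀ l, -(N : ℤ) ≤ x l ∧ x l ≤ N := by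
  simp [box]

theorem mem_boxEdges {N : ℕ} {e : Edge} : e ∈ boxEdges N ↔ e.1 ∈ box N ∧ e.1 e.2 < N := by
  simp only [boxEdges, Finset.mem_filter, Finset.mem_product, Finset.mem_univ, and_true]
  refine and_congr_right fun h => ?_
  rw [mem_box] at h ⊢
  constructor
  · intro h'; have := (h' e.2).2; simp [unitVec_apply_self] at this; omega
  · intro h' l
    by_cases hl : l = e.2
    · subst hl; simp only [Pi.add_apply, unitVec_apply_self]; have := h e.2; omega
    · simp only [Pi.add_apply, unitVec_apply_ne hl, add_zero]; exact h l

theorem mem_boxPlaquettes {N : ℕ} {p : Plaquette} :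
    p ∈ boxPlaquettes N ↔ p.1 ∈ box N ∧ p.1 p.2.1.1 < N ∧ p.1 p.2.1.2 < N := by
  have hne := p.2.2.ne
  simp only [boxPlaquettes, Finset.mem_filter, Finset.mem_product, Finset.mem_univ, and_true]
  refine and_congr_right fun h => ?_
  have e1 : ∀ i, p.1 + unitVec i ∈ box N ↔ p.1 i < N := by
    intro i
    have := mem_boxEdges (N := N) (e := (p.1, i))
    simp only [boxEdges, Finset.mem_filter, Finset.mem_product, Finset.mem_univ, and_true, h,
      true_and] at this
    exact this
  rw [e1, e1]
  refine ⟨fun h => ⟨h.1, h.2.1⟩, fun h' => ⟨h'.1, h'.2, ?_⟩⟩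
  rw [mem_box] at h ⊢
  intro l
  simp only [Pi.add_apply]
  by_cases hl : l = p.2.1.1
  · rw [hl, unitVec_apply_self, unitVec_apply_ne hne]; have := h p.2.1.1; omega
  · by_cases hl' : l = p.2.1.2
    · rw [hl', unitVec_apply_self, unitVec_apply_ne hne.symm]; have := h p.2.1.2; omega
    · rw [unitVec_apply_ne hl, unitVec_apply_ne hl']; have := h l; omega

/-- The nearest point of the box. -/
def clampBox (N : ℕ) (x : Vertex) : Vertex := fun i => max (-(N : ℤ)) (min (x i) N)

/-- The edge at `x` in direction `i` is not collapsed by `clampBox`. -/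
def InRange (N : ℕ) (x : Vertex) (i : Fin 4) : Prop := -(N : ℤ) ≤ x i ∧ x i < N

instance (N : ℕ) (x : Vertex) (i : Fin 4) : Decidable (InRange N x i) := by
  unfold InRange; infer_instance

theorem clampBox_mem (N : ℕ) (x : Vertex) : clampBox N x ∈ box N := by
  rw [mem_box]; intro l; simp only [clampBox]; omega

theorem clampBox_eq_self {N : ℕ} {x : Vertex} (h : x ∈ box N) : clampBox N x = x := by
  rw [mem_box] at h; ext l; have := h l; simp only [clampBox]; omega

theorem clampBox_add {N : ℕ} {x : Vertex} {i : Fin 4} (h : InRange N x i) :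
    clampBox N (x + unitVec i) = clampBox N x + unitVec i := by
  unfold InRange at h
  ext l; simp only [clampBox, Pi.add_apply]
  by_cases hl : l = i
  · subst hl; rw [unitVec_apply_self]; omega
  · rw [unitVec_apply_ne hl]; simp

theorem clampBox_add_of_not {N : ℕ} {x : Vertex} {i : Fin 4} (h : ¬ InRange N x i) :
    clampBox N (x + unitVec i) = clampBox N x := by
  unfold InRange at h
  ext l; simp only [clampBox, Pi.add_apply]
  by_cases hl : l = i
  · subst hl; rw [unitVec_apply_self]; omega
  · rw [unitVec_apply_ne hl]; simp

theorem inRange_add {N : ℕ} {x : Vertex} {i j : Fin 4} (h : j ≠ i) :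
    InRange N (x + unitVec i) j ↔ InRange N x j := by
  simp [InRange, unitVec_apply_ne h]

theorem InRange.clampBox_lt {N : ℕ} {x : Vertex} {i : Fin 4} (h : InRange N x i) :
    clampBox N x i < N := by
  unfold InRange at h; simp only [clampBox]; omega

/-- The pullback of a `1`-form on the box to `ℤ⁴`. -/
def pullback₁ (N : ℕ) (s : Edge → A) (e : Edge) : A :=
  if InRange N e.1 e.2 then s (clampBox N e.1, e.2) else 0

/-- The pullback of a `2`-form on the box to `ℤ⁴`. -/
def pullback₂ (N : ℕ) (ω : Vertex → Fin 4 → Fin 4 → A) (x : Vertex) (i j : Fin 4) :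
    A :=
  if InRange N x i ∧ InRange N x j then ω (clampBox N x) i j else 0

/-- Clamping to the box maps an edge to an edge or collapses it to a vertex. Pulling back along such
a cellular map commutes with differentials: when a side of a square collapses, the opposite sides
cancel or vanish. -/
theorem curl_pullback₁ {N : ℕ} {s : Edge → A}
    (hs : ∀ x ∈ box N, ∀ i j, i ≠ j → x i < N → x j < N → curl s x i j = 0) (x : Vertex)
    (i j : Fin 4) : curl (pullback₁ N s) x i j = 0 := by
  by_cases hij : i = j
  · subst hij; exact (isAlternating_curl _).self x i
  have r₁ := inRange_add (N := N) (x := x) hij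
  have r₂ := inRange_add (N := N) (x := x) (Ne.symm hij)
  simp only [curl, pullback₁, r₁, r₂]
  by_cases hi : InRange N x i <;> by_cases hj : InRange N x j
  · simp only [hi, hj, if_true, clampBox_add]
    exact hs _ (clampBox_mem N x) i j hij hi.clampBox_lt hj.clampBox_lt
  · simp [hi, hj, clampBox_add_of_not hj]
  · simp [hi, hj, clampBox_add_of_not hi]
  · simp [hi, hj]

theorem IsAlternating.pullback₂ {ω : Vertex → Fin 4 → Fin 4 → A} (ha : IsAlternating ω) (N : ℕ) :
    IsAlternating (pullback₂ N ω) := by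
  constructor
  · intro x i; simp [LatticeGauge.pullback₂, ha.self]
  · intro x i j
    simp only [LatticeGauge.pullback₂]
    by_cases h : InRange N x i ∧ InRange N x j
    · rw [if_pos h, if_pos h.symm, ha.symm]
    · rw [if_neg h, if_neg fun h' => h h'.symm, neg_zero]

theorem IsAlternating.diff₂_of_not_distinct {ω : Vertex → Fin 4 → Fin 4 → A}
    (ha : IsAlternating ω) {i j k : Fin 4} (h : i = j ∨ i = k ∨ j = k) (x : Vertex) :
    diff₂ ω x i j k = 0 := by
  unfold diff₂
  rcases h with rfl | rfl | rfl
  · simp [ha.self]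
  · rw [ha.symm _ i j, ha.symm _ i j, ha.self, ha.self]; abel
  · simp [ha.self]

/-- A `2`-form on the box is closed. -/
def IsClosedOnBox (N : ℕ) (ω : Vertex → Fin 4 → Fin 4 → A) : Prop :=
  ∀ x ∈ box N, ∀ i j k, i ≠ j → i ≠ k → j ≠ k → x i < N → x j < N → x k < N →
    diff₂ ω x i j k = 0

theorem diff₂_pullback₂ {N : ℕ} {ω : Vertex → Fin 4 → Fin 4 → A} (ha : IsAlternating ω)
    (hω : IsClosedOnBox N ω) (x : Vertex) (i j k : Fin 4) :
    diff₂ (pullback₂ N ω) x i j k = 0 := by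
  by_cases hd : i = j ∨ i = k ∨ j = k
  · exact (ha.pullback₂ N).diff₂_of_not_distinct hd x
  push Not at hd
  obtain ⟨hij, hik, hjk⟩ := hd
  have r₁ := inRange_add (N := N) (x := x) hij
  have r₂ := inRange_add (N := N) (x := x) hij.symm
  have r₃ := inRange_add (N := N) (x := x) hik
  have r₄ := inRange_add (N := N) (x := x) hik.symm
  have r₅ := inRange_add (N := N) (x := x) hjk
  have r₆ := inRange_add (N := N) (x := x) hjk.symm
  simp only [diff₂, pullback₂, r₁, r₂, r₃, r₄, r₅, r₆]
  by_cases hi : InRange N x i <;> by_cases hj : InRange N x j <;> by_cases hk : InRange N x k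
  · simp only [hi, hj, hk, and_self, if_true, clampBox_add]
    exact hω _ (clampBox_mem N x) i j k hij hik hjk hi.clampBox_lt hj.clampBox_lt hk.clampBox_lt
  · simp [hi, hj, hk, clampBox_add_of_not hk]
  · simp [hi, hj, hk, clampBox_add_of_not hj]
  · simp [hi, hj, hk]
  · simp [hi, hj, hk, clampBox_add_of_not hi]
  · simp [hi, hj, hk]
  · simp [hi, hj, hk]
  · simp [hi, hj, hk]

theorem pullback₂_eq {N : ℕ} (ω : Vertex → Fin 4 → Fin 4 → A) {x : Vertex} (hx : x ∈ box N)
    {i j : Fin 4} (hi : x i < N) (hj : x j < N) : pullback₂ N ω x i j = ω x i j := by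
  have h := mem_box.1 hx
  rw [pullback₂, if_pos ⟨⟨(h i).1, hi⟩, (h j).1, hj⟩, clampBox_eq_self hx]

/-- Poincaré lemma for `2`-forms on the box. -/
theorem exists_curl_eq_on_box {N : ℕ} {ω : Vertex → Fin 4 → Fin 4 → A} (ha : IsAlternating ω)
    (hω : IsClosedOnBox N ω) :
    ∃ τ : Edge → A, ∀ x ∈ box N, ∀ i j, x i < N → x j < N → curl τ x i j = ω x i j := by
  obtain ⟨τ, hτ⟩ := exists_curl_eq (ha.pullback₂ N) (diff₂_pullback₂ ha hω)
  exact ⟨τ, fun x hx i j hi hj => by rw [hτ, pullback₂_eq ω hx hi hj]⟩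

/-- A closed `1`-form on the box vanishes on cycles. -/
theorem pair_eq_zero_of_closed_on_box {N : ℕ} {γ : OneChain} (hγ : chainBoundary γ = 0)
    (hbox : ∀ e ∈ γ.support, e ∈ boxEdges N) {s : Edge → A}
    (hs : ∀ x ∈ box N, ∀ i j, i ≠ j → x i < N → x j < N → curl s x i j = 0) : pair γ s = 0 := by
  rw [← pair_eq_zero_of_closed hγ (curl_pullback₁ hs)]
  refine pair_congr fun e he => ?_
  obtain ⟨h1, h2⟩ := mem_boxEdges.1 (hbox e he)
  rw [pullback₁, if_pos ⟨(mem_box.1 h1 e.2).1, h2⟩, clampBox_eq_self h1]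

/-- A closed `2`-form on the box that is supported in a small cube is the differential of a `1`-form
on the box that is supported in the same cube. -/
theorem exists_local_curl_eq_on_box {N : ℕ} {ω : Vertex → Fin 4 → Fin 4 → A}
    (ha : IsAlternating ω) (hω : IsClosedOnBox N ω) {p : Vertex} {k : ℤ} (hk : 0 ≤ k)
    (hkN : k < N) (hp : p ∈ box N)
    (hsupp : ∀ x ∈ box N, ∀ i j, ω x i j ≠ 0 → ∀ l, |x l - p l| ≤ k) :
    ∃ τ : Edge → A, (∀ x ∈ box N, ∀ i j, x i < N → x j < N → curl τ x i j = ω x i j) ∧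
      ∀ e ∈ boxEdges N, τ e ≠ 0 → ∀ l, |e.1 l - p l| ≤ k := by
  rw [mem_box] at hp
  have hsupp' : ∀ x i j, pullback₂ N ω x i j ≠ 0 → ∀ l, |clampBox N x l - p l| ≤ k := by
    intro x i j h l
    unfold pullback₂ at h
    split_ifs at h
    · exact hsupp _ (clampBox_mem N x) i j h l
    · exact absurd rfl h
  have hpa := ha.pullback₂ N
  have hpc := diff₂_pullback₂ ha hω
  -- a homotopy from a side on which the form vanishes, if the cube touches the opposite side
  have side : ∀ l c, (∀ x i j, x l = c → pullback₂ N ω x i j = 0) →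
      (∀ e ∈ boxEdges N, homotopy₂ l c (pullback₂ N ω) e ≠ 0 → |e.1 l - p l| ≤ k) →
      ∃ τ : Edge → A, (∀ x ∈ box N, ∀ i j, x i < N → x j < N → curl τ x i j = ω x i j) ∧
        ∀ e ∈ boxEdges N, τ e ≠ 0 → ∀ l, |e.1 l - p l| ≤ k := by
    intro l c hc hl
    refine ⟨homotopy₂ l c (pullback₂ N ω), fun x hx i j hi hj => ?_, fun e he hne r => ?_⟩
    · rw [curl_homotopy₂_eq hpa hpc hc, pullback₂_eq ω hx hi hj]
    · by_cases hr : r = l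
      · subst hr; exact hl e he hne
      · by_contra hcon
        refine hne (signedSum_eq_zero fun s _ => ?_)
        by_contra h'
        have := hsupp' _ _ _ h' r
        rw [show clampBox N (Function.update e.1 l s) r = clampBox N e.1 r by
          simp [clampBox, hr], clampBox_eq_self (mem_boxEdges.1 he).1] at this
        exact hcon this
  -- Because `k < N`, a cube that touches this side of the box does not reach the opposite one, so
  -- the pullback vanishes beyond level `p l + k` and the homotopy can start there.
  by_cases hleft : ∃ l, p l - k ≤ -(N : ℤ)
  · obtain ⟨l, hl⟩ := hleft
    have hzero : ∀ x i j, p l + k + 1 ≤ x l → pullback₂ N ω x i j = 0 := by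
      intro x i j hx; by_contra h
      have h1 := abs_le.1 (hsupp' x i j h l)
      have := hp l
      simp only [clampBox] at h1; omega
    refine side l (p l + k + 1) (fun x i j hx => hzero x i j hx.ge) fun e he hne => ?_
    have hel := mem_box.1 (mem_boxEdges.1 he).1 l
    have : e.1 l < p l + k + 1 := by
      by_contra hcon
      refine hne (signedSum_eq_zero fun s hs => hzero _ _ _ ?_)
      simp only [Function.update_self]; omega
    rw [abs_le]; omega
  by_cases hright : ∃ l, (N : ℤ) ≤ p l + k
  · obtain ⟨l, hl⟩ := hright
    have hzero : ∀ x i j, x l ≤ p l - k - 1 → pullback₂ N ω x i j = 0 := by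
      intro x i j hx; by_contra h
      have h1 := abs_le.1 (hsupp' x i j h l)
      have := hp l
      simp only [clampBox] at h1; omega
    refine side l (p l - k - 1) (fun x i j hx => hzero x i j hx.le) fun e he hne => ?_
    have hel := mem_box.1 (mem_boxEdges.1 he).1 l
    have : p l - k - 1 < e.1 l := by
      by_contra hcon
      refine hne (signedSum_eq_zero fun s hs => hzero _ _ _ ?_)
      simp only [Function.update_self]; omega
    rw [abs_le]; omega
  -- The cube lies strictly inside the box. A point clamped into it was not moved, so the pullback
  -- has compact support.
  · push Not at hleft hright
    obtain ⟨τ, h1, h2⟩ := exists_curl_eq_of_compact hpa hpc hk (p := p) (fun x i j h l => by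
      have h1 := abs_le.1 (hsupp' x i j h l)
      have h2 := hleft l
      have h3 := hright l
      rw [abs_le]; simp only [clampBox] at h1; omega)
    exact ⟨τ, fun x hx i j hi hj => by rw [h1, pullback₂_eq ω hx hi hj], fun e _ he => h2 e he⟩

end LocalPoincare

end LatticeGauge
namespace LatticeGauge

/-! ### Clusters of plaquettes -/

/-- Plaquettes whose base points have sup-distance at most one. -/
def Near (p q : Plaquette) : Prop := ∀ l, |p.1 l - q.1 l| ≤ 1

theorem Near.symm {p q : Plaquette} (h : Near p q) : Near q p := fun l => by
  rw [abs_sub_comm]; exact h l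

open Classical in
/-- The connected component of `p` in the set `V` of plaquettes. -/
noncomputable def cluster (V : Finset Plaquette) (p : Plaquette) : Finset Plaquette :=
  V.filter fun q => Relation.ReflTransGen (fun a b => Near a b ∧ b ∈ V) p q

section Cluster

variable {V : Finset Plaquette} {p q : Plaquette}

theorem mem_cluster :
    q ∈ cluster V p ↔ q ∈ V ∧ Relation.ReflTransGen (fun a b => Near a b ∧ b ∈ V) p q := by
  simp [cluster]

theorem cluster_subset : cluster V p ⊆ V := fun _ h => (mem_cluster.1 h).1

theorem self_mem_cluster (hp : p ∈ V) : p ∈ cluster V p :=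
  mem_cluster.2 ⟨hp, Relation.ReflTransGen.refl⟩

theorem mem_cluster_of_near {a b : Plaquette} (ha : a ∈ cluster V p) (hb : b ∈ V)
    (hab : Near a b) : b ∈ cluster V p :=
  mem_cluster.2 ⟨hb, (mem_cluster.1 ha).2.tail ⟨hab, hb⟩⟩

theorem cluster_symm (hp : p ∈ V) (hq : q ∈ cluster V p) : p ∈ cluster V q := by
  obtain ⟨hqV, h⟩ := mem_cluster.1 hq
  refine mem_cluster.2 ⟨hp, ?_⟩
  clear hq hqV
  induction h with
  | refl => exact Relation.ReflTransGen.refl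
  | @tail b c hab hbc ih =>
    have hb : b ∈ V := by
      rcases Relation.ReflTransGen.cases_tail hab with h | ⟨_, _, h⟩
      · rw [h]; exact hp
      · exact h.2
    exact Relation.ReflTransGen.head ⟨hbc.1.symm, hb⟩ ih

theorem cluster_eq (hp : p ∈ V) (hq : q ∈ cluster V p) : cluster V q = cluster V p := by
  have hq' := cluster_symm hp hq
  ext r
  constructor
  · intro hr
    exact mem_cluster.2 ⟨(mem_cluster.1 hr).1, (mem_cluster.1 hq).2.trans (mem_cluster.1 hr).2⟩
  · intro hr
    exact mem_cluster.2 ⟨(mem_cluster.1 hr).1, (mem_cluster.1 hq').2.trans (mem_cluster.1 hr).2⟩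

/-- A path from `p` to a missing plaquette must leave `B` at some step. -/
theorem exists_near_of_ne_cluster {B : Finset Plaquette} (hB : B ⊆ cluster V p) (hp : p ∈ B)
    (hne : B ≠ cluster V p) : ∃ a ∈ B, ∃ b ∈ cluster V p, b ∉ B ∧ Near a b := by
  obtain ⟨q, hq, hqB⟩ : ∃ q ∈ cluster V p, q ∉ B := by
    by_contra hcon; push Not at hcon; exact hne (Finset.Subset.antisymm hB hcon)
  obtain ⟨hqV, h⟩ := mem_cluster.1 hq
  clear hq hqV
  induction h with
  | refl => exact absurd hp hqB
  | @tail b c hab hbc ih =>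
    by_cases hb : b ∈ B
    · exact ⟨b, hb, c, mem_cluster.2 ⟨hbc.2, hab.tail hbc⟩, hqB, hbc.1⟩
    · exact ih hb

/-- Clusters can be built up by adding neighbours one at a time. -/
theorem cluster_induction {P : Finset Plaquette → Prop} (hp : p ∈ V) (base : P {p})
    (step : ∀ B a b, p ∈ B → a ∈ B → b ∉ B → Near a b → P B → P (insert b B)) :
    P (cluster V p) := by
  have key : ∀ m (B : Finset Plaquette), B ⊆ cluster V p → p ∈ B → P B →
      (cluster V p \ B).card = m → P (cluster V p) := by
    intro m
    induction m with
    | zero =>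
      intro B hB _ hPB hm
      have := Finset.sdiff_eq_empty_iff_subset.1 (Finset.card_eq_zero.1 hm)
      rwa [Finset.Subset.antisymm this hB]
    | succ m ih =>
      intro B hB hpB hPB hm
      have hne : B ≠ cluster V p := by
        rintro rfl; simp at hm
      obtain ⟨a, ha, b, hb, hbB, hab⟩ := exists_near_of_ne_cluster hB hpB hne
      refine ih (insert b B) (Finset.insert_subset hb hB) (Finset.mem_insert_of_mem hpB)
        (step B a b hpB ha hbB hab hPB) ?_
      rw [Finset.sdiff_insert, Finset.card_erase_of_mem (Finset.mem_sdiff.2 ⟨hb, hbB⟩), hm]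
      rfl
  exact key _ {p} (by simpa using self_mem_cluster hp) (by simp) base rfl

/-- Each plaquette added to a connected set enlarges its radius by at most one; this converts the
size of a vortex into a localization in space. -/
theorem dist_le_of_mem_cluster (hp : p ∈ V) (hq : q ∈ cluster V p) (l : Fin 4) :
    |q.1 l - p.1 l| ≤ (cluster V p).card := by
  refine cluster_induction (P := fun B => ∀ q ∈ B, |q.1 l - p.1 l| ≤ B.card) hp ?_ ?_ q hq
  · intro q hq; rw [Finset.mem_singleton.1 hq]; simp
  · intro B a b _ ha hb hab hB q hq
    rw [Finset.card_insert_of_notMem hb]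
    push_cast
    rcases Finset.mem_insert.1 hq with rfl | hq
    · have h1 := abs_le.1 (hB a ha); have h2 := abs_le.1 (hab l)
      rw [abs_le]; omega
    · have := hB q hq; omega

/-- The plaquettes near `p`. -/
noncomputable def nbrs (p : Plaquette) : Finset Plaquette :=
  (Fintype.piFinset fun l => Finset.Icc (p.1 l - 1) (p.1 l + 1)) ×ˢ Finset.univ

theorem mem_nbrs : q ∈ nbrs p ↔ Near p q := by
  simp only [nbrs, Finset.mem_product, Fintype.mem_piFinset, Finset.mem_Icc, Finset.mem_univ,
    and_true, Near]
  refine forall_congr' fun l => ?_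
  rw [abs_le]; constructor <;> intro h <;> constructor <;> omega

theorem card_directions : Fintype.card {ij : Fin 4 × Fin 4 // ij.1 < ij.2} = 6 := by decide

/-- There are `3^4` base points and six pairs of directions, with `p` itself included. -/
theorem card_nbrs (p : Plaquette) : (nbrs p).card = 486 := by
  have h : ∀ l, (Finset.Icc (p.1 l - 1) (p.1 l + 1)).card = 3 := fun l => by
    rw [Int.card_Icc]; omega
  rw [nbrs, Finset.card_product, Fintype.card_piFinset, Finset.card_univ, card_directions]
  simp only [h]; simp

open Classical in
/-- Walks of `m` steps from `p`, as lists of plaquettes. -/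
noncomputable def walks : ℕ → Plaquette → Finset (List Plaquette)
  | 0, p => {[p]}
  | m + 1, p => (nbrs p).biUnion fun q => (walks m q).image (List.cons p)

theorem card_walks_le (m : ℕ) (p : Plaquette) : (walks m p).card ≤ 486 ^ m := by
  induction m generalizing p with
  | zero => simp [walks]
  | succ m ih =>
    rw [walks, pow_succ, mul_comm]
    refine Finset.card_biUnion_le.trans ?_
    refine (Finset.sum_le_card_nsmul _ _ (486 ^ m) fun q _ =>
      Finset.card_image_le.trans (ih q)).trans ?_
    rw [card_nbrs, smul_eq_mul]

theorem cons_mem_walks {m : ℕ} {w : List Plaquette} (hpq : Near p q) (hw : w ∈ walks m q) :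
    p :: w ∈ walks (m + 1) p := by
  rw [walks, Finset.mem_biUnion]
  exact ⟨q, mem_nbrs.2 hpq, Finset.mem_image.2 ⟨w, hw, rfl⟩⟩

/-- A detour `a, b, a` spliced in where the walk visits `a` costs two steps. Hence a cluster of `k`
plaquettes is the range of a walk of `2 (k - 1)` steps, which yields an exponential count of
clusters. -/
theorem exists_walk_insert {m : ℕ} {a b : Plaquette} (hab : Near a b) {w : List Plaquette}
    (hw : w ∈ walks m p) (ha : a ∈ w) :
    ∃ w' ∈ walks (m + 2) p, w'.toFinset = insert b w.toFinset := by
  induction m generalizing p w with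
  | zero =>
    simp only [walks, Finset.mem_singleton] at hw
    subst hw
    simp only [List.mem_singleton] at ha
    subst ha
    refine ⟨[a, b, a], cons_mem_walks hab (cons_mem_walks hab.symm (by simp [walks])), ?_⟩
    ext; simp
  | succ m ih =>
    have hw0 := hw
    rw [walks, Finset.mem_biUnion] at hw
    obtain ⟨q, hq, hw⟩ := hw
    obtain ⟨w₀, hw₀, rfl⟩ := Finset.mem_image.1 hw
    by_cases hap : a = p
    · subst hap
      refine ⟨a :: b :: a :: w₀, cons_mem_walks hab (cons_mem_walks hab.symm hw0), ?_⟩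
      ext; simp
    · have ha' : a ∈ w₀ := by simpa [hap] using ha
      obtain ⟨w', hw', hset⟩ := ih hw₀ ha'
      refine ⟨p :: w', cons_mem_walks (mem_nbrs.1 hq) hw', ?_⟩
      rw [List.toFinset_cons, List.toFinset_cons, hset, Finset.insert_comm]

open Classical in
/-- A finite family that contains all clusters of `p` of size `k`. -/
noncomputable def clusterCandidates (k : ℕ) (p : Plaquette) : Finset (Finset Plaquette) :=
  ((walks (2 * (k - 1)) p).image List.toFinset).filter fun S => S.card = k

theorem card_clusterCandidates_le (k : ℕ) (p : Plaquette) :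
    (clusterCandidates k p).card ≤ (486 ^ 2) ^ k := by
  refine (Finset.card_filter_le _ _).trans (Finset.card_image_le.trans ((card_walks_le _ p).trans ?_))
  rw [← pow_mul]
  exact Nat.pow_le_pow_right (by norm_num) (by omega)

theorem cluster_mem_candidates (hp : p ∈ V) :
    cluster V p ∈ clusterCandidates (cluster V p).card p := by
  unfold clusterCandidates
  refine Finset.mem_filter.2 ⟨Finset.mem_image.2 ?_, rfl⟩
  refine cluster_induction
    (P := fun B => ∃ w ∈ walks (2 * (B.card - 1)) p, w.toFinset = B) hp ?_ ?_
  · exact ⟨[p], by simp [walks], by simp⟩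
  · rintro B a b hpB ha hb hab ⟨w, hw, rfl⟩
    obtain ⟨w', hw', hset⟩ := exists_walk_insert hab hw (List.mem_toFinset.1 ha)
    refine ⟨w', ?_, hset⟩
    rw [Finset.card_insert_of_notMem hb]
    have : 1 ≤ w.toFinset.card := Finset.card_pos.2 ⟨p, hpB⟩
    rwa [show 2 * (w.toFinset.card + 1 - 1) = 2 * (w.toFinset.card - 1) + 2 by omega]

end Cluster

/-! ### Decomposition of the curl of a `1`-form into clusters -/

section Vortices

variable {A : Type*} [AddCommGroup A]

open Classical in
/-- The plaquettes of the box at which the curl of `s` does not vanish. -/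
noncomputable def vortexSupport (N : ℕ) (s : Edge → A) : Finset Plaquette :=
  (boxPlaquettes N).filter fun p => curl s p.1 p.2.1.1 p.2.1.2 ≠ 0

theorem mem_vortexSupport {N : ℕ} {s : Edge → A} {p : Plaquette} :
    p ∈ vortexSupport N s ↔ p ∈ boxPlaquettes N ∧ curl s p.1 p.2.1.1 p.2.1.2 ≠ 0 := by
  simp [vortexSupport]

/-- `S` contains the plaquette at `x` in the directions `i, j`. -/
def HasSquare (S : Finset Plaquette) (x : Vertex) (i j : Fin 4) : Prop :=
  ∃ p ∈ S, p.1 = x ∧ ((p.2.1.1 = i ∧ p.2.1.2 = j) ∨ (p.2.1.1 = j ∧ p.2.1.2 = i))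

theorem HasSquare.symm {S : Finset Plaquette} {x : Vertex} {i j : Fin 4} (h : HasSquare S x i j) :
    HasSquare S x j i := by
  obtain ⟨p, hp, hx, hd⟩ := h; exact ⟨p, hp, hx, hd.symm⟩

theorem hasSquare_iff {S : Finset Plaquette} {p : Plaquette} :
    HasSquare S p.1 p.2.1.1 p.2.1.2 ↔ p ∈ S := by
  constructor
  · rintro ⟨q, hq, hx, hd⟩
    rwa [plaquette_ext_of_dirs hx.symm (Or.inl ⟨rfl, rfl⟩) hd]
  · intro h; exact ⟨p, h, rfl, Or.inl ⟨rfl, rfl⟩⟩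

open Classical in
/-- The restriction of the curl of `s` to the plaquettes in `S`. -/
noncomputable def cutCurl (S : Finset Plaquette) (s : Edge → A) (x : Vertex) (i j : Fin 4) : A :=
  if HasSquare S x i j then curl s x i j else 0

theorem isAlternating_cutCurl (S : Finset Plaquette) (s : Edge → A) :
    IsAlternating (cutCurl S s) := by
  have ha := isAlternating_curl s
  constructor
  · intro x i; simp [cutCurl, ha.self]
  · intro x i j
    unfold cutCurl
    by_cases h : HasSquare S x i j
    · rw [if_pos h, if_pos h.symm, ha.symm]
    · rw [if_neg h, if_neg fun h' => h h'.symm, neg_zero]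

theorem hasSquare_vortexSupport {N : ℕ} {s : Edge → A} {x : Vertex} (hx : x ∈ box N)
    {i j : Fin 4} (hi : x i < N) (hj : x j < N) (h : curl s x i j ≠ 0) :
    HasSquare (vortexSupport N s) x i j := by
  have ha := isAlternating_curl s
  rcases lt_trichotomy i j with hij | rfl | hij
  · exact ⟨(x, ⟨(i, j), hij⟩), mem_vortexSupport.2 ⟨mem_boxPlaquettes.2 ⟨hx, hi, hj⟩, h⟩, rfl,
      Or.inl ⟨rfl, rfl⟩⟩
  · exact absurd (ha.self x i) h
  · refine ⟨(x, ⟨(j, i), hij⟩), mem_vortexSupport.2 ⟨mem_boxPlaquettes.2 ⟨hx, hj, hi⟩, ?_⟩, rfl,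
      Or.inr ⟨rfl, rfl⟩⟩
    simp only; rw [ha.symm]; exact neg_ne_zero.2 h

theorem add_unitVec_mem_box {N : ℕ} {x : Vertex} (hx : x ∈ box N) {i : Fin 4} (hi : x i < N) :
    x + unitVec i ∈ box N := by
  rw [mem_box] at hx ⊢
  intro l
  by_cases hl : l = i
  · subst hl; simp only [Pi.add_apply, unitVec_apply_self]; have := hx l; omega
  · simp only [Pi.add_apply, unitVec_apply_ne hl, add_zero]; exact hx l

theorem unitVec_mem_Icc (i l : Fin 4) : 0 ≤ unitVec i l ∧ unitVec i l ≤ 1 := by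
  by_cases h : l = i
  · subst h; rw [unitVec_apply_self]; omega
  · rw [unitVec_apply_ne h]; omega

/-- A union of clusters carries a closed part of the curl. -/
theorem isClosedOnBox_cutCurl {N : ℕ} {s : Edge → A} {S : Finset Plaquette}
    (hS : ∀ a ∈ S, ∀ b ∈ vortexSupport N s, Near a b → b ∈ S) :
    IsClosedOnBox N (cutCurl S s) := by
  intro x hx i j k hij hik hjk hi hj hk
  -- Once `S` meets the unit cube at `x`, every plaquette of the cube with nonzero curl is near it
  -- and hence in `S`. So the cut form either agrees with the curl on all faces or vanishes on all
  -- of them.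
  have hspread : ∀ y a b, HasSquare S y a b → ∀ z c d, (∀ l, |y l - z l| ≤ 1) → z ∈ box N →
      z c < N → z d < N → cutCurl S s z c d = curl s z c d := by
    intro y a b hy z c d hyz hz hc hd
    unfold cutCurl
    by_cases h0 : curl s z c d = 0
    · rw [h0, ite_self]
    · obtain ⟨q, hq, hqz, hqd⟩ := hasSquare_vortexSupport hz hc hd h0
      obtain ⟨p, hp, hpy, _⟩ := hy
      rw [if_pos ⟨q, hS p hp q hq (fun l => by rw [hpy, hqz]; exact hyz l), hqz, hqd⟩]
  have hclose : ∀ (o o' : Vertex), (∀ l, 0 ≤ o l ∧ o l ≤ 1) → (∀ l, 0 ≤ o' l ∧ o' l ≤ 1) →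
      ∀ l, |(x + o) l - (x + o') l| ≤ 1 := by
    intro o o' ho ho' l
    have := ho l; have := ho' l
    simp only [Pi.add_apply]; rw [abs_le]; omega
  by_cases hex : ∃ o : Vertex, (∀ l, 0 ≤ o l ∧ o l ≤ 1) ∧ ∃ a b, HasSquare S (x + o) a b
  · obtain ⟨o, ho, a, b, hab⟩ := hex
    have hz : ∀ c d, x c < N → x d < N → cutCurl S s x c d = curl s x c d := by
      intro c d hc hd
      refine hspread _ a b hab x c d ?_ hx hc hd
      have := hclose o 0 ho (fun l => by simp)
      rwa [add_zero] at this
    have hu : ∀ r c d, x r < N → c ≠ r → d ≠ r → x c < N → x d < N →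
        cutCurl S s (x + unitVec r) c d = curl s (x + unitVec r) c d := by
      intro r c d hr hcr hdr hc hd
      refine hspread _ a b hab _ c d (hclose o _ ho (unitVec_mem_Icc r))
        (add_unitVec_mem_box hx hr) ?_ ?_
      · simpa [unitVec_apply_ne hcr] using hc
      · simpa [unitVec_apply_ne hdr] using hd
    rw [← diff₂_curl s x i j k]
    unfold diff₂
    rw [hz j k hj hk, hz i k hi hk, hz i j hi hj, hu i j k hi hij.symm hik.symm hj hk,
      hu j i k hj hij hjk.symm hi hk, hu k i j hk hik hjk hi hj]
  · push Not at hex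
    have hz : ∀ c d, cutCurl S s x c d = 0 := by
      intro c d
      have := hex 0 (fun l => by simp) c d
      rw [add_zero] at this
      rw [cutCurl, if_neg this]
    have hu : ∀ r c d, cutCurl S s (x + unitVec r) c d = 0 := by
      intro r c d
      rw [cutCurl, if_neg (hex _ (unitVec_mem_Icc r) c d)]
    simp [diff₂, hz, hu]

theorem cutCurl_apply_of_mem {S : Finset Plaquette} {s : Edge → A} {p : Plaquette} (hp : p ∈ S) :
    cutCurl S s p.1 p.2.1.1 p.2.1.2 = curl s p.1 p.2.1.1 p.2.1.2 := by
  rw [cutCurl, if_pos (hasSquare_iff.2 hp)]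

theorem cutCurl_apply_of_notMem {S : Finset Plaquette} {s : Edge → A} {p : Plaquette}
    (hp : p ∉ S) : cutCurl S s p.1 p.2.1.1 p.2.1.2 = 0 := by
  rw [cutCurl, if_neg fun h => hp (hasSquare_iff.1 h)]

end Vortices

end LatticeGauge
namespace LatticeGauge

/-! ### The value of a `1`-form on a loop in terms of minimal vortices -/

section LoopDecomposition

variable {A : Type*} [AddCommGroup A]

open Classical in
/-- The edges of `γ` that are not corner edges. -/
noncomputable def nonCorner (γ : OneChain) : Finset Edge :=
  γ.support.filter fun e => ¬ IsCornerEdge γ e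

theorem mem_nonCorner {γ : OneChain} {e : Edge} :
    e ∈ nonCorner γ ↔ e ∈ γ.support ∧ ¬ IsCornerEdge γ e := by simp [nonCorner]

/-- A distinguished plaquette that contains the edge `e`. -/
def basePlaquette (e : Edge) : Plaquette :=
  squareAt e.1 e.2 (e.2 + 1) ((by decide : ∀ i : Fin 4, i ≠ i + 1) e.2)

theorem basePlaquette_mem_star (e : Edge) : basePlaquette e ∈ star e :=
  mem_star_iff.2 ⟨e.2 + 1, (squareAt_cases _ _ _ _).2, Or.inl (squareAt_cases _ _ _ _).1⟩

/-- The curl of `s` at a distinguished plaquette around `e`, oriented along `e`. -/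
noncomputable def stapleValue (s : Edge → A) (e : Edge) : A :=
  plaquetteBoundary (basePlaquette e) e •
    curl s (basePlaquette e).1 (basePlaquette e).2.1.1 (basePlaquette e).2.1.2

/-- All plaquettes around `e`, oriented along `e`, carry the same curl. -/
def IsUniform (s : Edge → A) (e : Edge) : Prop :=
  ∀ p ∈ star e, plaquetteBoundary p e • curl s p.1 p.2.1.1 p.2.1.2 = stapleValue s e

theorem star_smul_smul {p : Plaquette} {e : Edge} (hp : p ∈ star e) (g : A) :
    plaquetteBoundary p e • plaquetteBoundary p e • g = g := by
  rcases plaquetteBoundary_of_mem_star hp with h | h <;> rw [h] <;> simp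

theorem dist_le_of_mem_star {p : Plaquette} {e : Edge} (hp : p ∈ star e) (l : Fin 4) :
    |e.1 l - p.1 l| ≤ 1 := by
  obtain ⟨j, _, hx⟩ := mem_star_iff.1 hp
  have := unitVec_mem_Icc j l
  rcases hx with hx | hx <;> rw [hx, abs_le]
  · simp
  · simp only [Pi.sub_apply]; omega

theorem near_of_mem_star {p q : Plaquette} {e : Edge} (hp : p ∈ star e) (hq : q ∈ star e) :
    Near p q := by
  intro l
  obtain ⟨j, _, hx⟩ := mem_star_iff.1 hp
  obtain ⟨j', _, hx'⟩ := mem_star_iff.1 hq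
  have := unitVec_mem_Icc j l
  have := unitVec_mem_Icc j' l
  rcases hx with hx | hx <;> rcases hx' with hx' | hx' <;> rw [hx, hx', abs_le] <;>
    (try simp only [Pi.sub_apply]) <;> omega

/-- `p` lies at distance at most `3 k` from an edge of `γ`. -/
def NearLoop (γ : OneChain) (p : Plaquette) (k : ℕ) : Prop :=
  ∃ e ∈ γ.support, ∀ l, |e.1 l - p.1 l| ≤ 3 * k

/-- There is a vortex of at least seven plaquettes near `γ`. -/
def HasLargeVortex (N : ℕ) (γ : OneChain) (s : Edge → A) : Prop :=
  ∃ p ∈ vortexSupport N s, NearLoop γ p (cluster (vortexSupport N s) p).card ∧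
    7 ≤ (cluster (vortexSupport N s) p).card

/-- There is a minimal vortex around a corner edge of `γ`. -/
def HasCornerVortex (N : ℕ) (γ : OneChain) (s : Edge → A) : Prop :=
  ∃ e ∈ γ.support, IsCornerEdge γ e ∧ ∃ p ∈ vortexSupport N s,
    cluster (vortexSupport N s) p = star e

variable {N M : ℕ} {γ : OneChain} {s : Edge → A}

theorem cluster_saturated {V : Finset Plaquette} {p : Plaquette} :
    ∀ a ∈ cluster V p, ∀ b ∈ V, Near a b → b ∈ cluster V p :=
  fun _ ha _ hb hab => mem_cluster_of_near ha hb hab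

/-- Small vortices near the loop are minimal vortices around an edge. -/
theorem small_vortex_eq (hM : ∀ e ∈ γ.support, ∀ l, |e.1 l| ≤ M) (hN : M + 26 ≤ N)
    {p : Plaquette} (hp : p ∈ vortexSupport N s)
    (hnear : NearLoop γ p (cluster (vortexSupport N s) p).card)
    (hcard : (cluster (vortexSupport N s) p).card ≤ 6) :
    ∃ (e : Edge) (g : A), cluster (vortexSupport N s) p = star e ∧
      ∀ x i j, cutCurl (cluster (vortexSupport N s) p) s x i j = curl (Pi.single e g) x i j := by
  set V := vortexSupport N s with hV
  set S := cluster V p with hS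
  -- With at most six plaquettes, `p` is within `18` of the loop and `q` within `6` of `p`.
  have hpos : ∀ q ∈ S, ∀ l, |q.1 l| ≤ M + 24 := by
    intro q hq l
    have h1 := abs_le.1 (dist_le_of_mem_cluster hp hq l)
    rw [← hS] at h1
    obtain ⟨e, he, hdist⟩ := hnear
    have h2 := abs_le.1 (hdist l)
    have h3 := abs_le.1 (hM e he l)
    rw [abs_le]; omega
  have hbox := isClosedOnBox_cutCurl (N := N) (s := s) (S := S) cluster_saturated
  refine eq_curl_single_of_card_le_six (isAlternating_cutCurl S s) ?_ ?_ hcard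
    ⟨p, self_mem_cluster hp⟩
  · intro x i j k
    by_cases hd : i = j ∨ i = k ∨ j = k
    · exact (isAlternating_cutCurl S s).diff₂_of_not_distinct hd x
    push Not at hd
    -- Closedness is needed on all of `ℤ⁴`: cubes that meet the vortex lie in the box, the others
    -- carry the zero form.
    by_cases hex : ∃ o : Vertex, (∀ l, 0 ≤ o l ∧ o l ≤ 1) ∧ ∃ a b, HasSquare S (x + o) a b
    · obtain ⟨o, ho, a, b, q, hq, hqx, _⟩ := hex
      have hx : ∀ l, -(N : ℤ) ≤ x l ∧ x l < N := by
        intro l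
        have h1 := abs_le.1 (hpos q hq l)
        have h2 := ho l
        rw [hqx] at h1
        simp only [Pi.add_apply] at h1
        omega
      exact hbox x (mem_box.2 fun l => ⟨(hx l).1, (hx l).2.le⟩) i j k hd.1 hd.2.1 hd.2.2
        (hx i).2 (hx j).2 (hx k).2
    · push Not at hex
      have hz : ∀ c d, cutCurl S s x c d = 0 := by
        intro c d
        have := hex 0 (fun l => by simp) c d
        rw [add_zero] at this
        rw [cutCurl, if_neg this]
      have hu : ∀ r c d, cutCurl S s (x + unitVec r) c d = 0 := by
        intro r c d
        rw [cutCurl, if_neg (hex _ (unitVec_mem_Icc r) c d)]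
      simp [diff₂, hz, hu]
  · intro q
    constructor
    · intro hq
      rw [cutCurl_apply_of_mem hq]
      exact (mem_vortexSupport.1 (cluster_subset hq)).2
    · intro hq; by_contra h; exact hq (cutCurl_apply_of_notMem h)

/-- Vortices that are far from the loop compared to their size do not contribute. -/
theorem exists_curl_eq_of_not_nearLoop (hM : ∀ e ∈ γ.support, ∀ l, |e.1 l| ≤ M) (hN : M + 26 ≤ N)
    (hne : γ.support.Nonempty) (hbox : ∀ e ∈ γ.support, e ∈ boxEdges N)
    {p : Plaquette} (hp : p ∈ vortexSupport N s)
    (hnear : ¬ NearLoop γ p (cluster (vortexSupport N s) p).card) :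
    ∃ τ : Edge → A, (∀ x ∈ box N, ∀ i j, x i < N → x j < N →
      curl τ x i j = cutCurl (cluster (vortexSupport N s) p) s x i j) ∧ pair γ τ = 0 := by
  set V := vortexSupport N s with hV
  set S := cluster V p with hS
  have hpbox : p.1 ∈ box N := (mem_boxPlaquettes.1 (mem_vortexSupport.1 hp).1).1
  -- Two points of the box are at distance at most `2 N`, while `p` is further than `3 S.card` from
  -- the loop; the local Poincaré lemma thus applies.
  have hcard : (S.card : ℤ) < N := by
    obtain ⟨e, he⟩ := hne
    unfold NearLoop at hnear; push Not at hnear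
    obtain ⟨l, hl⟩ := hnear e he
    have h1 := abs_le.1 (hM e he l)
    have h2 := mem_box.1 hpbox l
    rcases lt_abs.1 hl with h | h <;> omega
  obtain ⟨τ, h1, h2⟩ := exists_local_curl_eq_on_box (isAlternating_cutCurl S s)
    (isClosedOnBox_cutCurl (N := N) (s := s) (S := S) cluster_saturated)
    (p := p.1) (k := S.card) (by positivity) hcard hpbox (by
      intro x _ i j hx l
      have : HasSquare S x i j := by by_contra h; exact hx (by rw [cutCurl, if_neg h])
      obtain ⟨q, hq, rfl, _⟩ := this
      exact dist_le_of_mem_cluster hp hq l)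
  refine ⟨τ, h1, ?_⟩
  rw [pair, Finsupp.sum]
  refine Finset.sum_eq_zero fun e he => ?_
  -- The primitive lives within distance `S.card` of `p`, and the loop stays further away.
  have : τ e = 0 := by
    by_contra h
    exact hnear ⟨e, he, fun l => (h2 e (hbox e he) h l).trans (by omega)⟩
  rw [this, smul_zero]

theorem pair_single (γ : OneChain) (e : Edge) (g : A) :
    pair γ (Pi.single e g) = γ e • g := by
  rw [pair, Finsupp.sum]
  by_cases h : e ∈ γ.support
  · rw [Finset.sum_eq_single_of_mem e h]
    · simp
    · intro e' _ hne; simp [hne]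
  · rw [Finsupp.notMem_support_iff.1 h, zero_smul]
    refine Finset.sum_eq_zero fun e' he' => ?_
    have : e' ≠ e := by rintro rfl; exact h he'
    simp [this]

/-- The staple values around an edge that carries a minimal vortex. -/
theorem smul_curl_of_vortex {S : Finset Plaquette} {e : Edge} {g : A} (hS : S = star e)
    (hcut : ∀ x i j, cutCurl S s x i j = curl (Pi.single e g) x i j) {p : Plaquette}
    (hp : p ∈ star e) : plaquetteBoundary p e • curl s p.1 p.2.1.1 p.2.1.2 = g := by
  rw [← cutCurl_apply_of_mem (S := S) (by rwa [hS]), hcut, curl_single, star_smul_smul hp]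

theorem stapleValue_of_vortex {S : Finset Plaquette} {e : Edge} {g : A} (hS : S = star e)
    (hcut : ∀ x i j, cutCurl S s x i j = curl (Pi.single e g) x i j) : stapleValue s e = g :=
  smul_curl_of_vortex hS hcut (basePlaquette_mem_star e)

open Classical in
/-- If all vortices near `γ` are minimal vortices away from the corners, the value of `s` on `γ` is
the sum of the contributions of the minimal vortices around edges of `γ`. -/
theorem pair_eq_sum_stapleValue (hγ : IsGeneralizedLoop γ)
    (hM : ∀ e ∈ γ.support, ∀ l, |e.1 l| ≤ M) (hN : M + 26 ≤ N)
    (hlarge : ¬ HasLargeVortex N γ s) (hcorner : ¬ HasCornerVortex N γ s) :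
    pair γ s = ∑ e ∈ (nonCorner γ).filter (IsUniform s), γ e • stapleValue s e := by
  by_cases hne : γ.support.Nonempty
  swap
  · rw [Finset.not_nonempty_iff_eq_empty] at hne
    simp [pair, Finsupp.sum, nonCorner, hne]
  have hbox : ∀ e ∈ γ.support, e ∈ boxEdges N := by
    intro e he
    have h : ∀ l, -(N : ℤ) ≤ e.1 l ∧ e.1 l < N := fun l => by
      have := abs_le.1 (hM e he l); omega
    exact mem_boxEdges.2 ⟨mem_box.2 fun l => ⟨(h l).1, (h l).2.le⟩, (h e.2).2⟩
  set V := vortexSupport N s with hV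
  set T := V.image (cluster V) with hT
  -- Each vortex gets a primitive whose pairing with `γ` is known: zero, unless the vortex is the
  -- star of a non-corner edge of `γ`. By `star_injective` the sum has at most one term.
  have hcontr : ∀ S ∈ T, ∃ τ : Edge → A, (∀ x ∈ box N, ∀ i j, x i < N → x j < N →
      curl τ x i j = cutCurl S s x i j) ∧
      pair γ τ = ∑ e ∈ (nonCorner γ).filter (fun e => star e = S), γ e • stapleValue s e := by
    intro S hS
    obtain ⟨p, hp, rfl⟩ := Finset.mem_image.1 hS
    by_cases hnear : NearLoop γ p (cluster V p).card
    · have hcard : (cluster V p).card ≤ 6 := by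
        by_contra h; exact hlarge ⟨p, hp, hnear, Nat.lt_of_not_le h⟩
      obtain ⟨e, g, hSe, hcut⟩ := small_vortex_eq hM hN hp hnear hcard
      refine ⟨Pi.single e g, fun x _ i j _ _ => (hcut x i j).symm, ?_⟩
      rw [pair_single]
      by_cases he : e ∈ nonCorner γ
      · have : (nonCorner γ).filter (fun e => star e = cluster V p) = {e} := by
          ext e'
          simp only [Finset.mem_filter, Finset.mem_singleton]
          constructor
          · rintro ⟨_, h⟩; exact star_injective (by rw [h, hSe])
          · rintro rfl; exact ⟨he, hSe.symm⟩
        rw [this, Finset.sum_singleton, stapleValue_of_vortex hSe hcut]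
      · have hes : e ∉ γ.support := by
          intro hes
          rw [mem_nonCorner] at he; push Not at he
          exact hcorner ⟨e, hes, he hes, p, hp, hSe⟩
        rw [Finsupp.notMem_support_iff.1 hes, zero_smul, Finset.sum_eq_zero]
        intro e' he'
        obtain ⟨h1, h2⟩ := Finset.mem_filter.1 he'
        have : e' = e := star_injective (by rw [h2, hSe])
        rw [this] at h1
        exact absurd h1 he
    · obtain ⟨τ, h1, h2⟩ := exists_curl_eq_of_not_nearLoop hM hN hne hbox hp hnear
      refine ⟨τ, h1, ?_⟩
      rw [h2, Finset.sum_eq_zero]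
      intro e he
      obtain ⟨h1, h3⟩ := Finset.mem_filter.1 he
      refine absurd ⟨e, (mem_nonCorner.1 h1).1, fun l => ?_⟩ hnear
      have hc : (cluster V p).card = 6 := by rw [← h3, card_star]
      have := dist_le_of_mem_star (e := e) (p := p) (by rw [h3]; exact self_mem_cluster hp) l
      rw [hc]; push_cast; omega
  choose! τ hτ hpair using hcontr
  -- The clusters partition the support of the curl, so `s` minus all primitives is closed on the
  -- box and vanishes on the cycle `γ`.
  have hclosed : pair γ (fun e => s e - ∑ S ∈ T, τ S e) = 0 := by
    refine pair_eq_zero_of_closed_on_box hγ.2 hbox fun x hx i j hij hi hj => ?_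
    rw [curl_sub, curl_sum, Finset.sum_congr rfl fun S hS => hτ S hS x hx i j hi hj]
    by_cases h0 : curl s x i j = 0
    · rw [h0, zero_sub, neg_eq_zero]
      refine Finset.sum_eq_zero fun S _ => ?_
      rw [cutCurl, h0, ite_self]
    · obtain ⟨q, hq, hqx, hqd⟩ := hasSquare_vortexSupport hx hi hj h0
      rw [Finset.sum_eq_single_of_mem (cluster V q) (Finset.mem_image_of_mem _ hq)]
      · rw [cutCurl, if_pos ⟨q, self_mem_cluster hq, hqx, hqd⟩, sub_self]
      · intro S hS hSq
        obtain ⟨p, hp, rfl⟩ := Finset.mem_image.1 hS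
        rw [cutCurl, if_neg]
        rintro ⟨q', hq', hqx', hqd'⟩
        have : q' = q := plaquette_ext_of_dirs (hqx'.trans hqx.symm) hqd' hqd
        rw [this] at hq'
        exact hSq (cluster_eq hp hq').symm
  rw [pair_sub, pair_sum, sub_eq_zero, Finset.sum_congr rfl hpair] at hclosed
  rw [hclosed]
  simp only [Finset.sum_filter]
  rw [Finset.sum_comm]
  refine Finset.sum_congr rfl fun e he => ?_
  rw [Finset.sum_ite_eq]
  have hnearStar : ∀ p ∈ star e, ∀ k : ℕ, 1 ≤ k → NearLoop γ p k := fun p hp k hk =>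
    ⟨e, (mem_nonCorner.1 he).1, fun l => (dist_le_of_mem_star hp l).trans (by omega)⟩
  -- A star that is a vortex makes `e` uniform. Conversely, a uniform edge with nonzero value has
  -- its star in one cluster, which equals the star because large vortices are excluded; a uniform
  -- edge with value `0` adds nothing.
  by_cases hmem : star e ∈ T
  · rw [if_pos hmem, if_pos]
    obtain ⟨p, hp, hpe⟩ := Finset.mem_image.1 hmem
    have hc : (cluster V p).card = 6 := by rw [hpe, card_star]
    have hps : p ∈ star e := by rw [← hpe]; exact self_mem_cluster hp
    obtain ⟨e', g, hSe, hcut⟩ := small_vortex_eq hM hN hp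
      (hnearStar p hps _ (by rw [hc]; norm_num)) hc.le
    have hee : e' = e := star_injective (by rw [← hSe, hpe])
    subst hee
    intro q hq
    rw [smul_curl_of_vortex hSe hcut hq, stapleValue_of_vortex hSe hcut]
  · rw [if_neg hmem]
    split_ifs with hu
    swap
    · rfl
    by_cases hz : stapleValue s e = 0
    · rw [hz, smul_zero]
    exfalso
    apply hmem
    have hstar : star e ⊆ V := by
      intro p hp
      have hpd := fun l => abs_le.1 (dist_le_of_mem_star hp l)
      have hel := fun l => abs_le.1 (hM e (mem_nonCorner.1 he).1 l)
      have hx : ∀ l, -(N : ℤ) ≤ p.1 l ∧ p.1 l < N := fun l => by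
        have := hpd l; have := hel l; omega
      refine mem_vortexSupport.2 ⟨mem_boxPlaquettes.2
        ⟨mem_box.2 fun l => ⟨(hx l).1, (hx l).2.le⟩, (hx _).2, (hx _).2⟩, fun h => hz ?_⟩
      rw [← hu p hp, h, smul_zero]
    have hb := basePlaquette_mem_star e
    have hsub : star e ⊆ cluster V (basePlaquette e) := fun q hq =>
      mem_cluster_of_near (self_mem_cluster (hstar hb)) (hstar hq) (near_of_mem_star hb hq)
    have hcard : (cluster V (basePlaquette e)).card ≤ 6 := by
      by_contra h
      have h7 : 7 ≤ (cluster V (basePlaquette e)).card := Nat.lt_of_not_le h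
      exact hlarge ⟨_, hstar hb, hnearStar _ hb _ (le_trans (by norm_num) h7), h7⟩
    refine Finset.mem_image.2 ⟨basePlaquette e, hstar hb, ?_⟩
    exact (Finset.eq_of_subset_of_card_le hsub (by rw [card_star]; exact hcard)).symm

end LoopDecomposition

end LatticeGauge
namespace LatticeGauge

/-! ### Gibbs weights -/

section Gibbs

set_option linter.unusedSectionVars false

variable {n N : ℕ}

/-- The extension of a configuration by zero to all edges. -/
noncomputable def OneForm.extend (σ : OneForm n N) (e : Edge) : ZMod n :=
  if h : e ∈ boxEdges N then σ ⟨e, h⟩ else 0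

/-- The restriction of a `1`-form to the box. -/
def restrictBox (N : ℕ) (τ : Edge → ZMod n) : OneForm n N := fun e => τ e

/-- The curl of a configuration at a positively oriented plaquette. -/
noncomputable def OneForm.curlAt (σ : OneForm n N) (p : Plaquette) : ZMod n :=
  curl σ.extend p.1 p.2.1.1 p.2.1.2

theorem OneForm.eval_eq_pair (σ : OneForm n N) (q : OneChain) : σ.eval q = pair q σ.extend := rfl

theorem OneForm.d_eq (σ : OneForm n N) (p : OrientedPlaquette) :
    σ.d p = (p.1 : ℤ) • σ.curlAt p.2 := by
  rw [OneForm.curlAt, ← pair_plaquetteBoundary, OneForm.d, OneForm.eval_eq_pair, orientedBoundary,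
    pair, pair, Finsupp.sum_smul_index' (h := fun e c => c • σ.extend e) (fun _ => zero_smul ℤ _),
    Finsupp.smul_sum]
  simp only [smul_smul, smul_eq_mul]

theorem OneForm.extend_add (σ σ' : OneForm n N) :
    (σ + σ').extend = fun e => σ.extend e + σ'.extend e := by
  ext e; unfold OneForm.extend; split_ifs <;> simp

theorem OneForm.extend_sub (σ σ' : OneForm n N) :
    (σ - σ').extend = fun e => σ.extend e - σ'.extend e := by
  ext e; unfold OneForm.extend; split_ifs <;> simp

theorem curl_extend_restrictBox (τ : Edge → ZMod n) {p : Plaquette} (hp : p ∈ boxPlaquettes N) :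
    (restrictBox N τ).curlAt p = curl τ p.1 p.2.1.1 p.2.1.2 := by
  obtain ⟨h1, h2, h3⟩ := mem_boxPlaquettes.1 hp
  have hne := p.2.2.ne
  have h4 := add_unitVec_mem_box h1 h2
  have h5 := add_unitVec_mem_box h1 h3
  have hb : ∀ e ∈ boxEdges N, (restrictBox N τ).extend e = τ e := by
    intro e he; rw [OneForm.extend, dif_pos he]; rfl
  unfold OneForm.curlAt curl
  rw [hb (p.1, p.2.1.1) (mem_boxEdges.2 ⟨h1, h2⟩), hb (p.1, p.2.1.2) (mem_boxEdges.2 ⟨h1, h3⟩),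
    hb (_, p.2.1.2) (mem_boxEdges.2 ⟨h4, ?_⟩), hb (_, p.2.1.1) (mem_boxEdges.2 ⟨h5, ?_⟩)]
  · simpa [unitVec_apply_ne hne] using h2
  · simpa [unitVec_apply_ne hne.symm] using h3

theorem OneForm.curlAt_sub (σ σ' : OneForm n N) (p : Plaquette) :
    (σ - σ').curlAt p = σ.curlAt p - σ'.curlAt p := by
  rw [OneForm.curlAt, OneForm.extend_sub, curl_sub]; rfl

theorem OneForm.curlAt_add (σ σ' : OneForm n N) (p : Plaquette) :
    (σ + σ').curlAt p = σ.curlAt p + σ'.curlAt p := by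
  rw [OneForm.curlAt, OneForm.extend_add, curl_add]; rfl

variable [NeZero n] (ρ : AddChar (ZMod n) ℂ) (β : ℝ)

theorem char_neg (g : ZMod n) : ρ (-g) = (starRingEnd ℂ) (ρ g) :=
  AddChar.map_neg_eq_conj ρ g

theorem char_norm (g : ZMod n) : ‖ρ g‖ = 1 := AddChar.norm_apply ρ g

/-- The weight of a plaquette, accounting for both orientations. -/
noncomputable def plaquetteWeight (g : ZMod n) : ℝ := Real.exp (2 * β * (ρ g).re)

theorem plaquetteWeight_pos (g : ZMod n) : 0 < plaquetteWeight ρ β g := Real.exp_pos _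

theorem plaquetteWeight_neg (g : ZMod n) : plaquetteWeight ρ β (-g) = plaquetteWeight ρ β g := by
  rw [plaquetteWeight, plaquetteWeight, char_neg, Complex.conj_re]

/-- The unnormalized weight of a configuration. -/
noncomputable def weight (σ : OneForm n N) : ℝ :=
  ∏ p ∈ boxPlaquettes N, plaquetteWeight ρ β (σ.curlAt p)

theorem weight_pos (σ : OneForm n N) : 0 < weight ρ β σ :=
  Finset.prod_pos fun _ _ => plaquetteWeight_pos ρ β _

theorem exp_wilsonAction (σ : OneForm n N) :
    Real.exp (-β * wilsonAction ρ σ) = weight ρ β σ := by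
  rw [weight]
  simp only [plaquetteWeight]
  rw [← Real.exp_sum]
  congr 1
  rw [wilsonAction, orientedBoxPlaquettes, Finset.sum_product_right, neg_mul_neg, Finset.mul_sum]
  refine Finset.sum_congr rfl fun p _ => ?_
  have : (Finset.univ : Finset ℤˣ) = {1, -1} := rfl
  rw [this, Finset.sum_pair (by decide)]
  simp only [OneForm.d_eq, Units.val_one, one_smul, Units.val_neg, neg_smul, char_neg,
    Complex.conj_re]
  ring

/-- The normalizing constant of `weight`. -/
noncomputable def totalWeight (N : ℕ) : ℝ := ∑ σ : OneForm n N, weight ρ β σ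

theorem totalWeight_pos (N : ℕ) : 0 < totalWeight ρ β N :=
  Finset.sum_pos (fun σ _ => weight_pos ρ β σ) Finset.univ_nonempty

theorem expectation_eq (f : OneForm n N → ℂ) :
    expectation ρ N β f = (∑ σ, f σ * (weight ρ β σ : ℂ)) / (totalWeight ρ β N : ℂ) := by
  have hc : (Fintype.card (OneForm n N) : ℝ) ≠ 0 := by
    exact_mod_cast Fintype.card_ne_zero
  have hZ := (totalWeight_pos ρ β N).ne'
  have hg : ∀ σ : OneForm n N, gibbsWeight ρ N β σ = weight ρ β σ / totalWeight ρ β N := by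
    intro σ
    rw [gibbsWeight, partitionFunction]
    simp only [exp_wilsonAction, uniformWeight]
    rw [← Finset.sum_mul, ← totalWeight, mul_inv, inv_inv]
    field_simp
  rw [expectation, Finset.sum_div]
  refine Finset.sum_congr rfl fun σ _ => ?_
  rw [hg]; push_cast; ring

/-- The expectation of a real function. -/
noncomputable def mean (f : OneForm n N → ℝ) : ℝ :=
  (∑ σ, f σ * weight ρ β σ) / totalWeight ρ β N

variable {ρ β}

theorem mean_mono {f g : OneForm n N → ℝ} (h : ∀ σ, f σ ≤ g σ) : mean ρ β f ≤ mean ρ β g := by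
  unfold mean
  refine div_le_div_of_nonneg_right (Finset.sum_le_sum fun σ _ => ?_) (totalWeight_pos ρ β N).le
  exact mul_le_mul_of_nonneg_right (h σ) (weight_pos ρ β σ).le

theorem mean_sum {ι : Type*} (T : Finset ι) (f : ι → OneForm n N → ℝ) :
    mean ρ β (fun σ => ∑ i ∈ T, f i σ) = ∑ i ∈ T, mean ρ β (f i) := by
  unfold mean
  rw [← Finset.sum_div, Finset.sum_comm]
  simp only [Finset.sum_mul]

theorem mean_add (f g : OneForm n N → ℝ) :
    mean ρ β (fun σ => f σ + g σ) = mean ρ β f + mean ρ β g := by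
  unfold mean; rw [← add_div, ← Finset.sum_add_distrib]; simp only [add_mul]

theorem mean_const_mul (c : ℝ) (f : OneForm n N → ℝ) :
    mean ρ β (fun σ => c * f σ) = c * mean ρ β f := by
  unfold mean; simp only [mul_assoc]; rw [← Finset.mul_sum, mul_div_assoc]

theorem mean_const (c : ℝ) : mean ρ β (fun _ : OneForm n N => c) = c := by
  unfold mean
  rw [← Finset.mul_sum, ← totalWeight, mul_div_assoc, div_self (totalWeight_pos ρ β N).ne', mul_one]

theorem norm_expectation_le {f : OneForm n N → ℂ} {g : OneForm n N → ℝ} (h : ∀ σ, ‖f σ‖ ≤ g σ) :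
    ‖expectation ρ N β f‖ ≤ mean ρ β g := by
  rw [expectation_eq, mean, norm_div, Complex.norm_real, Real.norm_eq_abs,
    abs_of_pos (totalWeight_pos ρ β N)]
  refine div_le_div_of_nonneg_right ((norm_sum_le _ _).trans (Finset.sum_le_sum fun σ _ => ?_))
    (totalWeight_pos ρ β N).le
  rw [norm_mul, Complex.norm_real, Real.norm_eq_abs, abs_of_pos (weight_pos ρ β σ)]
  exact mul_le_mul_of_nonneg_right (h σ) (weight_pos ρ β σ).le

theorem expectation_sub (f g : OneForm n N → ℂ) :
    expectation ρ N β f - expectation ρ N β g = expectation ρ N β (fun σ => f σ - g σ) := by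
  unfold expectation; rw [← Finset.sum_sub_distrib]; simp only [sub_mul]

theorem expectation_const (c : ℂ) : expectation ρ N β (fun _ => c) = c := by
  rw [expectation_eq, ← Finset.mul_sum, ← Complex.ofReal_sum, ← totalWeight, mul_div_assoc, div_self,
    mul_one]
  exact_mod_cast (totalWeight_pos ρ β N).ne'

variable (ρ β)

open Classical in
/-- The probability of an event. -/
noncomputable def prob (P : OneForm n N → Prop) : ℝ := mean ρ β fun σ => if P σ then 1 else 0

variable {ρ β}

theorem prob_le_sum {ι : Type*} {P : OneForm n N → Prop} (T : Finset ι)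
    (Q : ι → OneForm n N → Prop) (h : ∀ σ, P σ → ∃ i ∈ T, Q i σ) :
    prob ρ β P ≤ ∑ i ∈ T, prob ρ β (Q i) := by
  classical
  unfold prob
  rw [← mean_sum]
  refine mean_mono fun σ => ?_
  have h0 : ∀ i ∈ T, (0 : ℝ) ≤ if Q i σ then 1 else 0 := fun i _ => by split_ifs <;> norm_num
  split_ifs with hP
  · obtain ⟨i, hi, hQ⟩ := h σ hP
    refine le_trans ?_ (Finset.single_le_sum h0 hi)
    simp [hQ]
  · exact Finset.sum_nonneg h0

/-! ### Peierls estimate -/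

theorem plaquetteWeight_le {g : ZMod n} (hg : g ≠ 0) :
    plaquetteWeight ρ β g ≤ lam ρ β ^ 2 * plaquetteWeight ρ β 0 := by
  have h := le_ciSup (f := fun g : {g : ZMod n // g ≠ 0} =>
    Real.exp (β * (ρ g).re) / Real.exp (β * (ρ 0).re)) (Set.finite_range _).bddAbove ⟨g, hg⟩
  change _ ≤ lam ρ β at h
  simp only at h
  rw [div_le_iff₀ (Real.exp_pos _)] at h
  have h2 : ∀ x : ℝ, Real.exp (2 * β * x) = Real.exp (β * x) ^ 2 := by
    intro x; rw [← Real.exp_nat_mul]; congr 1; push_cast; ring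
  rw [plaquetteWeight, plaquetteWeight, h2, h2, ← mul_pow]
  exact pow_le_pow_left₀ (Real.exp_pos _).le h 2

theorem prob_eq (P : OneForm n N → Prop) [DecidablePred P] :
    prob ρ β P = (∑ σ with P σ, weight ρ β σ) / totalWeight ρ β N := by
  have h : ∀ σ : OneForm n N, (@ite ℝ (P σ) (Classical.propDecidable _) 1 0) * weight ρ β σ
      = if P σ then weight ρ β σ else 0 := fun σ => by by_cases h : P σ <;> simp [h]
  rw [prob, mean, Finset.sum_filter, Finset.sum_congr rfl fun σ _ => h σ]

/-- `S` is one of the clusters of plaquettes with nonvanishing curl. -/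
def IsVortex (σ : OneForm n N) (S : Finset Plaquette) : Prop :=
  ∃ p ∈ vortexSupport N σ.extend, cluster (vortexSupport N σ.extend) p = S

/-- The Peierls transformation. The shift `τ` is a primitive of the curl of `σ₀` on `S`, so it
depends only on `σ₀` and serves all `σ` with the same curl on `S`. Subtracting it leaves the
plaquettes off `S` unchanged and gains `λ²` at each plaquette of `S`. -/
theorem weight_le_of_isVortex {S : Finset Plaquette} {σ₀ : OneForm n N} (h₀ : IsVortex σ₀ S) :
    ∃ τ : OneForm n N, ∀ σ : OneForm n N, (∀ p ∈ S, σ.curlAt p = σ₀.curlAt p) →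
      weight ρ β σ ≤ (lam ρ β ^ 2) ^ S.card * weight ρ β (σ - τ) := by
  obtain ⟨p₀, hp₀, rfl⟩ := h₀
  set V := vortexSupport N σ₀.extend with hV
  set S := cluster V p₀ with hS
  obtain ⟨τ, hτ⟩ := exists_curl_eq_on_box (isAlternating_cutCurl S σ₀.extend)
    (isClosedOnBox_cutCurl (N := N) (s := σ₀.extend) (S := S) cluster_saturated)
  refine ⟨restrictBox N τ, fun σ hσ => ?_⟩
  have hSbox : S ⊆ boxPlaquettes N := fun p hp => (mem_vortexSupport.1 (cluster_subset hp)).1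
  have hcurl : ∀ p ∈ boxPlaquettes N, (restrictBox N τ).curlAt p
      = cutCurl S σ₀.extend p.1 p.2.1.1 p.2.1.2 := by
    intro p hp
    obtain ⟨h1, h2, h3⟩ := mem_boxPlaquettes.1 hp
    rw [curl_extend_restrictBox τ hp, hτ _ h1 _ _ h2 h3]
  unfold weight
  rw [← Finset.prod_sdiff hSbox, ← Finset.prod_sdiff hSbox, mul_left_comm]
  have hout : ∀ p ∈ boxPlaquettes N \ S, plaquetteWeight ρ β ((σ - restrictBox N τ).curlAt p)
      = plaquetteWeight ρ β (σ.curlAt p) := by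
    intro p hp
    obtain ⟨h1, h2⟩ := Finset.mem_sdiff.1 hp
    rw [OneForm.curlAt_sub, hcurl p h1, cutCurl_apply_of_notMem h2, sub_zero]
  have hin : ∀ p ∈ S, plaquetteWeight ρ β ((σ - restrictBox N τ).curlAt p)
      = plaquetteWeight ρ β 0 := by
    intro p hp
    rw [OneForm.curlAt_sub, hcurl p (hSbox hp), cutCurl_apply_of_mem hp, hσ p hp]
    rw [OneForm.curlAt, sub_self]
  rw [Finset.prod_congr rfl hout, Finset.prod_congr rfl hin]
  refine mul_le_mul_of_nonneg_left ?_ (Finset.prod_nonneg fun p _ => (plaquetteWeight_pos ρ β _).le)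
  rw [← Finset.prod_const, ← Finset.prod_mul_distrib]
  refine Finset.prod_le_prod (fun p _ => (plaquetteWeight_pos ρ β _).le) fun p hp => ?_
  refine plaquetteWeight_le ?_
  rw [hσ p hp]
  exact (mem_vortexSupport.1 (cluster_subset hp)).2

/-- A sum over the at most `n ^ S.card` curl patterns on `S`. For each pattern the Peierls
transformation is a translation, so the shifted weights sum to at most the total weight. -/
theorem prob_isVortex_le (S : Finset Plaquette) :
    prob ρ β (fun σ : OneForm n N => IsVortex σ S) ≤ (n * lam ρ β ^ 2) ^ S.card := by
  classical
  have hL : 0 ≤ lam ρ β ^ 2 := sq_nonneg _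
  have hone : ∀ a : S → ZMod n, ∑ σ : OneForm n N with IsVortex σ S ∧
      (fun p : S => σ.curlAt p) = a, weight ρ β σ ≤ (lam ρ β ^ 2) ^ S.card * totalWeight ρ β N := by
    intro a
    rcases Finset.eq_empty_or_nonempty (Finset.univ.filter fun σ : OneForm n N => IsVortex σ S ∧
      (fun p : S => σ.curlAt p) = a) with h | ⟨σ₀, h₀⟩
    · rw [h, Finset.sum_empty]
      exact mul_nonneg (pow_nonneg hL _) (totalWeight_pos ρ β N).le
    · simp only [Finset.mem_filter, Finset.mem_univ, true_and] at h₀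
      obtain ⟨τ, hτ⟩ := weight_le_of_isVortex (ρ := ρ) (β := β) h₀.1
      calc ∑ σ : OneForm n N with IsVortex σ S ∧ (fun p : S => σ.curlAt p) = a, weight ρ β σ
          ≤ ∑ σ : OneForm n N with IsVortex σ S ∧ (fun p : S => σ.curlAt p) = a,
              (lam ρ β ^ 2) ^ S.card * weight ρ β (σ - τ) := by
            refine Finset.sum_le_sum fun σ hσ => hτ σ fun p hp => ?_
            simp only [Finset.mem_filter, Finset.mem_univ, true_and] at hσ
            exact congrFun (hσ.2.trans h₀.2.symm) ⟨p, hp⟩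
        _ ≤ ∑ σ : OneForm n N, (lam ρ β ^ 2) ^ S.card * weight ρ β (σ - τ) :=
            Finset.sum_le_sum_of_subset_of_nonneg (Finset.filter_subset _ _) fun σ _ _ =>
              mul_nonneg (pow_nonneg hL _) (weight_pos ρ β _).le
        _ = (lam ρ β ^ 2) ^ S.card * totalWeight ρ β N := by
            rw [← Finset.mul_sum, totalWeight]
            exact congrArg _ (Equiv.sum_comp (Equiv.subRight τ) (weight ρ β))
  rw [prob_eq, div_le_iff₀ (totalWeight_pos ρ β N),
    ← Finset.sum_fiberwise _ (fun (σ : OneForm n N) (p : S) => σ.curlAt p)]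
  simp only [Finset.filter_filter]
  refine (Finset.sum_le_card_nsmul _ _ _ fun a _ => hone a).trans (le_of_eq ?_)
  rw [Finset.card_univ, Fintype.card_fun, ZMod.card, Fintype.card_coe, nsmul_eq_mul, mul_pow]
  push_cast; ring

/-- The probability that `p` lies in a vortex of `k` plaquettes decays exponentially in `k`. -/
theorem prob_cluster_card_le (p : Plaquette) (k : ℕ) :
    prob ρ β (fun σ : OneForm n N => p ∈ vortexSupport N σ.extend ∧
      (cluster (vortexSupport N σ.extend) p).card = k) ≤ (486 ^ 2 * n * lam ρ β ^ 2) ^ k := by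
  have hx : 0 ≤ (n * lam ρ β ^ 2) ^ k := by positivity
  refine (prob_le_sum (clusterCandidates k p) (fun S σ => IsVortex σ S) ?_).trans ?_
  · rintro σ ⟨hp, rfl⟩
    exact ⟨_, cluster_mem_candidates hp, p, hp, rfl⟩
  · refine (Finset.sum_le_card_nsmul _ _ ((n * lam ρ β ^ 2) ^ k) fun S hS => ?_).trans ?_
    · have := prob_isVortex_le (ρ := ρ) (β := β) (N := N) S
      rwa [(Finset.mem_filter.1 hS).2] at this
    · rw [nsmul_eq_mul, mul_assoc, mul_pow (486 ^ 2 : ℝ)]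
      refine mul_le_mul_of_nonneg_right ?_ hx
      exact_mod_cast card_clusterCandidates_le k p

/-! ### Bounds for the exceptional events -/

theorem sum_Icc_pow_le {z : ℝ} (h0 : 0 ≤ z) (h1 : z ≤ 1 / 2) (m K : ℕ) :
    ∑ k ∈ Finset.Icc m K, z ^ k ≤ 2 * z ^ m := by
  have hsub : Finset.Icc m K ⊆ Finset.Ico m (m + (K + 1)) := by
    intro k hk; simp only [Finset.mem_Icc, Finset.mem_Ico] at hk ⊢; omega
  refine (Finset.sum_le_sum_of_subset_of_nonneg hsub fun k _ _ => pow_nonneg h0 k).trans ?_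
  rw [Finset.sum_Ico_eq_sum_range, add_tsub_cancel_left]
  simp only [pow_add]
  rw [← Finset.mul_sum, mul_comm]
  refine mul_le_mul_of_nonneg_right ?_ (pow_nonneg h0 m)
  exact (Finset.sum_le_sum fun k _ => pow_le_pow_left₀ h0 h1 k).trans (sum_geometric_two_le (K + 1))

/-- The plaquettes at distance at most `r` from the edge `e`. -/
noncomputable def plaquetteBall (e : Edge) (r : ℕ) : Finset Plaquette :=
  (Fintype.piFinset fun l => Finset.Icc (e.1 l - r) (e.1 l + r)) ×ˢ Finset.univ

theorem card_plaquetteBall (e : Edge) (r : ℕ) : (plaquetteBall e r).card = (2 * r + 1) ^ 4 * 6 := by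
  have h : ∀ l, (Finset.Icc (e.1 l - r) (e.1 l + r)).card = 2 * r + 1 := fun l => by
    rw [Int.card_Icc]; omega
  rw [plaquetteBall, Finset.card_product, Fintype.card_piFinset, Finset.card_univ, card_directions]
  simp only [h]; simp

theorem mem_plaquetteBall {e : Edge} {r : ℕ} {p : Plaquette} (h : ∀ l, |e.1 l - p.1 l| ≤ r) :
    p ∈ plaquetteBall e r := by
  simp only [plaquetteBall, Finset.mem_product, Fintype.mem_piFinset, Finset.mem_Icc,
    Finset.mem_univ, and_true]
  intro l; have := abs_le.1 (h l); omega

/-- The expansion parameter of the Peierls estimates. -/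
noncomputable def peierls (ρ : AddChar (ZMod n) ℂ) (β : ℝ) : ℝ :=
  14406 * 486 ^ 2 * n * lam ρ β ^ 2

theorem peierls_nonneg : 0 ≤ peierls ρ β := by unfold peierls; positivity

theorem le_peierls_pow (k : ℕ) : (486 ^ 2 * n * lam ρ β ^ 2) ^ k ≤ peierls ρ β ^ k := by
  refine pow_le_pow_left₀ (by positivity) ?_ k
  unfold peierls
  have : 0 ≤ (n : ℝ) * lam ρ β ^ 2 := by positivity
  nlinarith

theorem prob_mem_vortexSupport_le (h : peierls ρ β ≤ 1 / 2) (p : Plaquette) :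
    prob ρ β (fun σ : OneForm n N => p ∈ vortexSupport N σ.extend) ≤ 2 * peierls ρ β := by
  refine (prob_le_sum (Finset.Icc 1 (boxPlaquettes N).card) (fun k σ =>
    p ∈ vortexSupport N σ.extend ∧ (cluster (vortexSupport N σ.extend) p).card = k) ?_).trans ?_
  · intro σ hp
    refine ⟨_, Finset.mem_Icc.2 ⟨Finset.card_pos.2 ⟨p, self_mem_cluster hp⟩,
      Finset.card_le_card ?_⟩, hp, rfl⟩
    exact fun q hq => (mem_vortexSupport.1 (cluster_subset hq)).1
  · refine (Finset.sum_le_sum fun k _ => (prob_cluster_card_le p k).trans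
      (le_peierls_pow k)).trans ?_
    simpa using sum_Icc_pow_le peierls_nonneg h 1 (boxPlaquettes N).card

/-- Union bound over the edge of the loop, the size `k ≥ 7` and the location within distance `3 k`.
Seven plaquettes give a factor `λ²` more than the `λ^12` of minimal vortices. -/
theorem prob_hasLargeVortex_le (h : peierls ρ β ≤ 1 / 2) (γ : OneChain) :
    prob ρ β (fun σ : OneForm n N => HasLargeVortex N γ σ.extend)
      ≤ loopLength γ * (2 * peierls ρ β ^ 7) := by
  have hk : ∀ (e : Edge) (k : ℕ), k ∈ Finset.Icc 7 (boxPlaquettes N).card →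
      ∑ p ∈ plaquetteBall e (3 * k), prob ρ β (fun σ : OneForm n N =>
        p ∈ vortexSupport N σ.extend ∧ (cluster (vortexSupport N σ.extend) p).card = k)
        ≤ peierls ρ β ^ k := by
    intro e k hk
    have hk1 : 1 ≤ k := by have := (Finset.mem_Icc.1 hk).1; omega
    refine (Finset.sum_le_card_nsmul _ _ _ fun p _ => prob_cluster_card_le p k).trans ?_
    rw [card_plaquetteBall, nsmul_eq_mul]
    -- The factor `14406 = 7^4 * 6` in `peierls` absorbs the number of plaquettes within distance `3
    -- k`.
    have hc : (2 * (3 * k) + 1) ^ 4 * 6 ≤ 14406 ^ k := by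
      have h7 : 2 * (3 * k) + 1 ≤ 7 ^ k := by
        have := one_add_mul_le_pow (R := ℤ) (a := 6) (by norm_num) k
        have h2 : (1 : ℤ) + k * 6 ≤ 7 ^ k := by simpa using this
        have h3 : 1 + k * 6 ≤ 7 ^ k := by exact_mod_cast h2
        omega
      calc (2 * (3 * k) + 1) ^ 4 * 6 ≤ (7 ^ k) ^ 4 * 6 ^ k :=
            Nat.mul_le_mul (Nat.pow_le_pow_left h7 4) (Nat.le_self_pow (by omega) 6)
        _ = 14406 ^ k := by rw [pow_right_comm, ← mul_pow]; norm_num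
    calc (((2 * (3 * k) + 1) ^ 4 * 6 : ℕ) : ℝ) * (486 ^ 2 * n * lam ρ β ^ 2) ^ k
        ≤ (14406 : ℝ) ^ k * (486 ^ 2 * n * lam ρ β ^ 2) ^ k := by
          refine mul_le_mul_of_nonneg_right ?_ (by positivity)
          exact_mod_cast hc
      _ = peierls ρ β ^ k := by rw [← mul_pow, peierls]; ring
  have he : ∀ e : Edge, prob ρ β (fun σ : OneForm n N => ∃ p ∈ vortexSupport N σ.extend,
      (∀ l, |e.1 l - p.1 l| ≤ 3 * (cluster (vortexSupport N σ.extend) p).card) ∧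
        7 ≤ (cluster (vortexSupport N σ.extend) p).card) ≤ 2 * peierls ρ β ^ 7 := by
    intro e
    refine (prob_le_sum (Finset.Icc 7 (boxPlaquettes N).card) (fun k σ =>
      ∃ p ∈ vortexSupport N σ.extend, (∀ l, |e.1 l - p.1 l| ≤ 3 * (k : ℤ)) ∧
        (cluster (vortexSupport N σ.extend) p).card = k) ?_).trans ?_
    · rintro σ ⟨p, hp, hd, h7⟩
      refine ⟨_, Finset.mem_Icc.2 ⟨h7, Finset.card_le_card ?_⟩, p, hp, hd, rfl⟩
      exact fun q hq => (mem_vortexSupport.1 (cluster_subset hq)).1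
    · refine (Finset.sum_le_sum fun k hk' => ?_).trans (sum_Icc_pow_le peierls_nonneg h 7 _)
      refine (prob_le_sum (plaquetteBall e (3 * k)) (fun p σ => p ∈ vortexSupport N σ.extend ∧
        (cluster (vortexSupport N σ.extend) p).card = k) ?_).trans (hk e k hk')
      rintro σ ⟨p, hp, hd, hc⟩
      exact ⟨p, mem_plaquetteBall fun l => by push_cast; exact hd l, hp, hc⟩
  refine (prob_le_sum γ.support (fun e σ => ∃ p ∈ vortexSupport N σ.extend,
      (∀ l, |e.1 l - p.1 l| ≤ 3 * (cluster (vortexSupport N σ.extend) p).card) ∧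
        7 ≤ (cluster (vortexSupport N σ.extend) p).card) ?_).trans ?_
  · rintro σ ⟨p, hp, ⟨e, he, hd⟩, h7⟩
    exact ⟨e, he, p, hp, hd, h7⟩
  · refine (Finset.sum_le_card_nsmul _ _ _ fun e _ => he e).trans (le_of_eq ?_)
    rw [nsmul_eq_mul, loopLength]

/-- A vortex that is the star of `e` is the cluster of `basePlaquette e` and has six plaquettes. -/
theorem prob_hasCornerVortex_le (γ : OneChain) :
    prob ρ β (fun σ : OneForm n N => HasCornerVortex N γ σ.extend)
      ≤ cornerCount γ * peierls ρ β ^ 6 := by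
  classical
  refine (prob_le_sum (γ.support.filter (IsCornerEdge γ)) (fun e σ =>
    basePlaquette e ∈ vortexSupport N σ.extend ∧
      (cluster (vortexSupport N σ.extend) (basePlaquette e)).card = 6) ?_).trans ?_
  · rintro σ ⟨e, he, hc, p, hp, hpe⟩
    have hb : basePlaquette e ∈ cluster (vortexSupport N σ.extend) p := by
      rw [hpe]; exact basePlaquette_mem_star e
    exact ⟨e, Finset.mem_filter.2 ⟨he, hc⟩, cluster_subset hb,
      by rw [cluster_eq hp hb, hpe, card_star]⟩
  · refine (Finset.sum_le_card_nsmul _ _ _ fun e _ => (prob_cluster_card_le _ 6).trans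
      (le_peierls_pow 6)).trans (le_of_eq ?_)
    rw [nsmul_eq_mul, cornerCount]

end Gibbs

end LatticeGauge
namespace LatticeGauge

/-! ### Integrating out the edges of the loop -/

section Conditioning

set_option linter.unusedSectionVars false

variable {n N : ℕ}

/-- The configuration with the single nonzero value `t` at the edge `e`. -/
noncomputable def bump (N : ℕ) (e : Edge) (t : ZMod n) : OneForm n N :=
  restrictBox N (Pi.single e t)

theorem curlAt_add_bump (σ : OneForm n N) (e : Edge) (t : ZMod n) {p : Plaquette}
    (hp : p ∈ boxPlaquettes N) :
    (σ + bump N e t).curlAt p = σ.curlAt p + plaquetteBoundary p e • t := by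
  rw [OneForm.curlAt_add, bump, curl_extend_restrictBox _ hp, curl_single]

theorem eval_add_bump (σ : OneForm n N) {γ : OneChain} (hbox : ∀ e ∈ γ.support, e ∈ boxEdges N)
    (e : Edge) (t : ZMod n) : (σ + bump N e t).eval γ = σ.eval γ + γ e • t := by
  rw [OneForm.eval_eq_pair, OneForm.extend_add, pair_add, OneForm.eval_eq_pair]
  congr 1
  rw [← pair_single γ e t]
  refine pair_congr fun e' he' => ?_
  rw [OneForm.extend, dif_pos (hbox e' he')]; rfl

/-- This is why corner edges are set aside: changing the spin at one non-corner edge does not affect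
the plaquettes around another. -/
theorem disjoint_star {γ : OneChain} {e e' : Edge} (he : e ∈ nonCorner γ) (he' : e' ∈ nonCorner γ)
    (hne : e' ≠ e) {p : Plaquette} (hp : p ∈ star e') : plaquetteBoundary p e = 0 := by
  by_contra h
  rw [mem_nonCorner] at he he'
  exact he.2 ⟨he.1, e', he'.1, hne, p, h, mem_star_iff_plaquetteBoundary.1 hp⟩

variable {γ : OneChain}

theorem isUniform_add_bump_of_ne (hstar : ∀ e ∈ γ.support, star e ⊆ boxPlaquettes N) {e e' : Edge}
    (he : e ∈ nonCorner γ) (he' : e' ∈ nonCorner γ) (hne : e' ≠ e) (σ : OneForm n N) (t : ZMod n) :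
    stapleValue (σ + bump N e t).extend e' = stapleValue σ.extend e' ∧
      (IsUniform (σ + bump N e t).extend e' ↔ IsUniform σ.extend e') := by
  have hc : ∀ p ∈ star e', (σ + bump N e t).curlAt p = σ.curlAt p := by
    intro p hp
    rw [curlAt_add_bump σ e t (hstar e' (mem_nonCorner.1 he').1 hp), disjoint_star he he' hne hp,
      zero_smul, add_zero]
  have hs : stapleValue (σ + bump N e t).extend e' = stapleValue σ.extend e' := by
    unfold stapleValue
    rw [show curl (σ + bump N e t).extend _ _ _ = _ from hc _ (basePlaquette_mem_star e')]
    rfl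
  refine ⟨hs, ?_⟩
  unfold IsUniform
  rw [hs]
  refine forall₂_congr fun p hp => ?_
  rw [show curl (σ + bump N e t).extend p.1 p.2.1.1 p.2.1.2 = _ from hc p hp]
  rfl

/-- Changing the spin at `e` shifts all six oriented values by the same amount, so uniformity is
decided by the other spins and one may condition on it. -/
theorem isUniform_add_bump_self (hstar : ∀ e ∈ γ.support, star e ⊆ boxPlaquettes N) {e : Edge}
    (he : e ∈ nonCorner γ) (σ : OneForm n N) (t : ZMod n) :
    stapleValue (σ + bump N e t).extend e = stapleValue σ.extend e + t ∧
      (IsUniform (σ + bump N e t).extend e ↔ IsUniform σ.extend e) := by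
  have hc : ∀ p ∈ star e, plaquetteBoundary p e • (σ + bump N e t).curlAt p
      = plaquetteBoundary p e • σ.curlAt p + t := by
    intro p hp
    rw [curlAt_add_bump σ e t (hstar e (mem_nonCorner.1 he).1 hp), smul_add, star_smul_smul hp]
  have hs : stapleValue (σ + bump N e t).extend e = stapleValue σ.extend e + t :=
    hc _ (basePlaquette_mem_star e)
  refine ⟨hs, ?_⟩
  unfold IsUniform
  rw [hs]
  refine forall₂_congr fun p hp => ?_
  rw [show plaquetteBoundary p e • curl (σ + bump N e t).extend p.1 p.2.1.1 p.2.1.2 = _ from hc p hp,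
    add_left_inj]
  rfl

variable [NeZero n] (ρ : AddChar (ZMod n) ℂ) (β : ℝ)

theorem plaquetteWeight_pow_six (g : ZMod n) :
    plaquetteWeight ρ β g ^ 6 = Real.exp (12 * β * (ρ g).re) := by
  rw [plaquetteWeight, ← Real.exp_nat_mul]; congr 1; push_cast; ring

theorem sum_char_mul_weight :
    ∑ g, ρ g * ((plaquetteWeight ρ β g ^ 6 : ℝ) : ℂ)
      = theta ρ β * ((∑ g, plaquetteWeight ρ β g ^ 6 : ℝ) : ℂ) := by
  have hne : ((∑ g, plaquetteWeight ρ β g ^ 6 : ℝ) : ℂ) ≠ 0 := by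
    have : 0 < ∑ g, plaquetteWeight ρ β g ^ 6 :=
      Finset.sum_pos (fun g _ => pow_pos (plaquetteWeight_pos ρ β g) 6) Finset.univ_nonempty
    exact_mod_cast this.ne'
  simp only [plaquetteWeight_pow_six] at hne ⊢
  rw [theta, ← Complex.ofReal_sum, div_mul_cancel₀ _ hne]

/-- The conditional expectation of the loop variable at a uniform edge. -/
theorem sum_shifted_weight (c : ℤ) (hc : c = 1 ∨ c = -1) (h : ZMod n) :
    ∑ t, ρ (c • t) * ((plaquetteWeight ρ β (h + t) ^ 6 : ℝ) : ℂ)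
      = ∑ t, ρ (-(c • h)) * theta ρ β * ((plaquetteWeight ρ β (h + t) ^ 6 : ℝ) : ℂ) := by
  have e1 : ∑ t, ρ (c • t) * ((plaquetteWeight ρ β (h + t) ^ 6 : ℝ) : ℂ)
      = ∑ u, ρ (-(c • h)) * (ρ (c • u) * ((plaquetteWeight ρ β u ^ 6 : ℝ) : ℂ)) := by
    refine Fintype.sum_equiv (Equiv.addLeft h) _ _ fun t => ?_
    rw [Equiv.coe_addLeft, ← mul_assoc, ← AddChar.map_add_eq_mul, smul_add, neg_add_cancel_left]
  have e2 : ∑ t, ρ (-(c • h)) * theta ρ β * ((plaquetteWeight ρ β (h + t) ^ 6 : ℝ) : ℂ)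
      = ∑ u, ρ (-(c • h)) * theta ρ β * ((plaquetteWeight ρ β u ^ 6 : ℝ) : ℂ) :=
    Fintype.sum_equiv (Equiv.addLeft h) _ _ fun t => rfl
  have e3 : ∑ u, ρ (c • u) * ((plaquetteWeight ρ β u ^ 6 : ℝ) : ℂ)
      = ∑ u, ρ u * ((plaquetteWeight ρ β u ^ 6 : ℝ) : ℂ) := by
    rcases hc with rfl | rfl
    · simp
    · refine Fintype.sum_equiv (Equiv.neg (ZMod n)) _ _ fun t => ?_
      rw [Equiv.neg_apply, plaquetteWeight_neg]; simp
  rw [e1, e2, ← Finset.mul_sum, ← Finset.mul_sum, e3, sum_char_mul_weight, mul_assoc]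
  push_cast; ring

open Classical in
/-- The loop variable after integrating out the uniform edges in `T`. -/
noncomputable def reducedLoop (γ : OneChain) (T : Finset Edge) (σ : OneForm n N) : ℂ :=
  ρ (σ.eval γ - ∑ e ∈ T.filter (IsUniform σ.extend), γ e • stapleValue σ.extend e)
    * theta ρ β ^ (T.filter (IsUniform σ.extend)).card

/-- At a uniform edge the six surrounding plaquettes depend on the new spin through a single value,
up to sign, and the plaquette weight is even; hence the sixth power, the source of the `12` in `θ`.
-/
theorem weight_add_bump (hstar : ∀ e ∈ γ.support, star e ⊆ boxPlaquettes N) {e : Edge}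
    (he : e ∈ nonCorner γ) {σ : OneForm n N} (hu : IsUniform σ.extend e) (t : ZMod n) :
    weight ρ β (σ + bump N e t)
      = (∏ p ∈ boxPlaquettes N \ star e, plaquetteWeight ρ β (σ.curlAt p))
        * plaquetteWeight ρ β (stapleValue σ.extend e + t) ^ 6 := by
  have hsub := hstar e (mem_nonCorner.1 he).1
  unfold weight
  rw [← Finset.prod_sdiff hsub]
  congr 1
  · refine Finset.prod_congr rfl fun p hp => ?_
    obtain ⟨h1, h2⟩ := Finset.mem_sdiff.1 hp
    have h0 : plaquetteBoundary p e = 0 := by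
      by_contra h; exact h2 (mem_star_iff_plaquetteBoundary.2 h)
    rw [curlAt_add_bump σ e t h1, h0, zero_smul, add_zero]
  · rw [← card_star e, ← Finset.prod_const]
    refine Finset.prod_congr rfl fun p hp => ?_
    have hp' : plaquetteBoundary p e • σ.curlAt p = stapleValue σ.extend e := hu p hp
    rw [curlAt_add_bump σ e t (hsub hp), ← hp']
    rcases plaquetteBoundary_of_mem_star hp with h | h <;> rw [h]
    · simp
    · rw [← plaquetteWeight_neg]; congr 1; simp; ring

/-- Averaging over the spin at `e`: translations permute the configurations, so it suffices to
compare sums over the spin at `e` with the other spins fixed. -/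
theorem sum_eq_of_sum_bump_eq {F G : OneForm n N → ℂ} (e : Edge)
    (h : ∀ σ, ∑ t, F (σ + bump N e t) = ∑ t, G (σ + bump N e t)) : ∑ σ, F σ = ∑ σ, G σ := by
  have key : ∀ F : OneForm n N → ℂ, ∑ σ, ∑ t, F (σ + bump N e t) = n * ∑ σ, F σ := by
    intro F
    rw [Finset.sum_comm]
    have : ∀ t : ZMod n, ∑ σ, F (σ + bump N e t) = ∑ σ, F σ := fun t =>
      Equiv.sum_comp (Equiv.addRight (bump N e t)) F
    rw [Finset.sum_congr rfl fun t _ => this t, Finset.sum_const, Finset.card_univ, ZMod.card,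
      nsmul_eq_mul]
  have hn : (n : ℂ) ≠ 0 := by exact_mod_cast NeZero.ne n
  refine mul_left_cancel₀ hn ?_
  rw [← key F, ← key G]
  exact Finset.sum_congr rfl fun σ _ => h σ

theorem sum_reducedLoop_insert (hγ : IsGeneralizedLoop γ)
    (hbox : ∀ e ∈ γ.support, e ∈ boxEdges N)
    (hstar : ∀ e ∈ γ.support, star e ⊆ boxPlaquettes N) {T : Finset Edge} (hT : T ⊆ nonCorner γ)
    {e : Edge} (he : e ∈ nonCorner γ) (heT : e ∉ T) :
    ∑ σ : OneForm n N, reducedLoop ρ β γ (insert e T) σ * (weight ρ β σ : ℂ)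
      = ∑ σ : OneForm n N, reducedLoop ρ β γ T σ * (weight ρ β σ : ℂ) := by
  classical
  symm
  refine sum_eq_of_sum_bump_eq e fun σ => ?_
  have hins : ∀ σ : OneForm n N, reducedLoop ρ β γ (insert e T) σ =
      if IsUniform σ.extend e then
        reducedLoop ρ β γ T σ * (ρ (-(γ e • stapleValue σ.extend e)) * theta ρ β)
      else reducedLoop ρ β γ T σ := by
    intro σ
    unfold reducedLoop
    rw [Finset.filter_insert]
    split_ifs with hu
    · have hnot : e ∉ T.filter (IsUniform σ.extend) := fun h => heT (Finset.mem_filter.1 h).1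
      rw [Finset.sum_insert hnot, Finset.card_insert_of_notMem hnot, pow_succ,
        show σ.eval γ - (γ e • stapleValue σ.extend e +
          ∑ x ∈ T.filter (IsUniform σ.extend), γ x • stapleValue σ.extend x)
          = (σ.eval γ - ∑ x ∈ T.filter (IsUniform σ.extend), γ x • stapleValue σ.extend x)
            + -(γ e • stapleValue σ.extend e) by abel, AddChar.map_add_eq_mul]
      ring
    · rfl
  have hne : ∀ e' ∈ T, e' ≠ e := by rintro e' he' rfl; exact heT he'
  have hshift : ∀ t, reducedLoop ρ β γ T (σ + bump N e t)
      = reducedLoop ρ β γ T σ * ρ (γ e • t) := by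
    intro t
    have hfil : T.filter (IsUniform (σ + bump N e t).extend) = T.filter (IsUniform σ.extend) :=
      Finset.filter_congr fun e' he' =>
        (isUniform_add_bump_of_ne hstar he (hT he') (hne e' he') σ t).2
    unfold reducedLoop
    rw [hfil, eval_add_bump σ hbox, Finset.sum_congr rfl fun e' he' => by
      rw [(isUniform_add_bump_of_ne hstar he (hT (Finset.mem_filter.1 he').1)
        (hne e' (Finset.mem_filter.1 he').1) σ t).1],
      add_sub_right_comm, AddChar.map_add_eq_mul]
    ring
  by_cases hu : IsUniform σ.extend e
  · have hce : γ e = 1 ∨ γ e = -1 := by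
      have h0 : γ e ≠ 0 := Finsupp.mem_support_iff.1 (mem_nonCorner.1 he).1
      rcases hγ.1 e with h | h | h
      · exact Or.inr h
      · exact absurd h h0
      · exact Or.inl h
    have hsum := sum_shifted_weight ρ β (γ e) hce (stapleValue σ.extend e)
    set R := ∏ p ∈ boxPlaquettes N \ star e, plaquetteWeight ρ β (σ.curlAt p) with hR
    have e1 : ∀ t, reducedLoop ρ β γ T (σ + bump N e t) * (weight ρ β (σ + bump N e t) : ℂ)
        = reducedLoop ρ β γ T σ * R *
          (ρ (γ e • t) * ((plaquetteWeight ρ β (stapleValue σ.extend e + t) ^ 6 : ℝ) : ℂ)) := by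
      intro t
      rw [hshift, weight_add_bump ρ β hstar he hu, ← hR, Complex.ofReal_mul]; ring
    have e2 : ∀ t, reducedLoop ρ β γ (insert e T) (σ + bump N e t)
          * (weight ρ β (σ + bump N e t) : ℂ)
        = reducedLoop ρ β γ T σ * R * (ρ (-(γ e • stapleValue σ.extend e)) * theta ρ β *
          ((plaquetteWeight ρ β (stapleValue σ.extend e + t) ^ 6 : ℝ) : ℂ)) := by
      intro t
      have hb := isUniform_add_bump_self hstar he σ t
      rw [hins, if_pos (hb.2.2 hu), hb.1, hshift, weight_add_bump ρ β hstar he hu, ← hR,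
        Complex.ofReal_mul]
      -- The loop value and the subtracted value at `e` move together, so the reduced loop no longer
      -- depends on `t`.
      have : ρ (γ e • t) * ρ (-(γ e • (stapleValue σ.extend e + t)))
          = ρ (-(γ e • stapleValue σ.extend e)) := by
        rw [← AddChar.map_add_eq_mul]; congr 1; rw [smul_add]; abel
      rw [← this]; ring
    rw [Finset.sum_congr rfl fun t _ => e1 t, Finset.sum_congr rfl fun t _ => e2 t,
      ← Finset.mul_sum, ← Finset.mul_sum, hsum]
  · refine Finset.sum_congr rfl fun t _ => ?_
    rw [hins, if_neg fun h => hu ((isUniform_add_bump_self hstar he σ t).2.1 h)]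

/-- The expectation of the Wilson loop does not change when the uniform edges away from the corners
are integrated out. -/
theorem expectation_wilsonLoop_eq (hγ : IsGeneralizedLoop γ)
    (hbox : ∀ e ∈ γ.support, e ∈ boxEdges N)
    (hstar : ∀ e ∈ γ.support, star e ⊆ boxPlaquettes N) :
    expectation ρ N β (wilsonLoop ρ γ) = expectation ρ N β (reducedLoop ρ β γ (nonCorner γ)) := by
  have key : ∀ T : Finset Edge, T ⊆ nonCorner γ →
      ∑ σ : OneForm n N, reducedLoop ρ β γ T σ * (weight ρ β σ : ℂ)
        = ∑ σ : OneForm n N, wilsonLoop ρ γ σ * (weight ρ β σ : ℂ) := by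
    intro T
    induction T using Finset.induction_on with
    | empty =>
      intro _
      refine Finset.sum_congr rfl fun σ _ => ?_
      simp [reducedLoop, wilsonLoop]
    | insert e T heT ih =>
      intro hT
      rw [Finset.insert_subset_iff] at hT
      rw [sum_reducedLoop_insert ρ β hγ hbox hstar hT.2 hT.1 heT, ih hT.2]
  rw [expectation_eq, expectation_eq, key _ (Finset.Subset.refl _)]

end Conditioning

end LatticeGauge
namespace LatticeGauge

/-! ### Ginibre's inequality for `ℤ_n` -/

section Ginibre

set_option linter.unusedSectionVars false

theorem sum_comp_surjective {G H : Type*} [AddCommGroup G] [AddCommGroup H] [Fintype G] [Fintype H]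
    (π : G →+ H) (hπ : Function.Surjective π) :
    ∃ K : ℝ, 0 < K ∧ ∀ f : H → ℝ, ∑ g, f (π g) = K * ∑ h, f h := by
  classical
  refine ⟨((Finset.univ.filter fun g => π g = 0).card : ℝ), ?_, fun f => ?_⟩
  · exact_mod_cast Finset.card_pos.2 ⟨0, by simp⟩
  · rw [← Finset.sum_fiberwise Finset.univ π, Finset.mul_sum]
    refine Finset.sum_congr rfl fun h _ => ?_
    obtain ⟨s, hs⟩ := hπ h
    rw [Finset.sum_congr rfl fun g hg => by rw [(Finset.mem_filter.1 hg).2], Finset.sum_const,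
      nsmul_eq_mul]
    congr 2
    refine Finset.card_bij' (fun g _ => g - s) (fun g _ => g + s) ?_ ?_ ?_ ?_ <;> simp [hs]
    · intro g hg; rw [hg, sub_self]

/-- With `v = y - x` the summand becomes `F v * F (v + 2x)`, a correlation along cosets of `2G`. The
coset sums `g` are constant on these cosets, so the total is, up to a positive factor, a sum of
squares. -/
theorem sum_add_mul_sub_nonneg {G : Type*} [AddCommGroup G] [Fintype G] (F : G → ℝ) :
    0 ≤ ∑ x, ∑ y, F (x + y) * F (y - x) := by
  set g : G → ℝ := fun v => ∑ x, F (v + (x + x)) with hg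
  have hgz : ∀ v z, g (v + (z + z)) = g v := by
    intro v z
    refine Fintype.sum_equiv (Equiv.addRight z) _ _ fun x => ?_
    show F (v + (z + z) + (x + x)) = F (v + ((x + z) + (x + z)))
    congr 1; abel
  have h1 : ∑ x, ∑ y, F (x + y) * F (y - x) = ∑ v, F v * g v := by
    have : ∀ x, ∑ y, F (x + y) * F (y - x) = ∑ v, F v * F (v + (x + x)) := by
      intro x
      refine Fintype.sum_equiv (Equiv.subRight x) _ _ fun y => ?_
      rw [Equiv.subRight_apply, mul_comm]; congr 2; abel
    rw [Finset.sum_congr rfl fun x _ => this x, Finset.sum_comm]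
    simp only [hg, Finset.mul_sum]
  have h2 : (Fintype.card G : ℝ) * ∑ v, F v * g v = ∑ v, g v ^ 2 := by
    have : ∀ z, ∑ v, F (v + (z + z)) * g v = ∑ v, F v * g v := by
      intro z
      refine Fintype.sum_equiv (Equiv.addRight (z + z)) _ _ fun v => ?_
      rw [Equiv.coe_addRight, hgz]
    have h3 : ∑ z : G, ∑ v, F (v + (z + z)) * g v = (Fintype.card G : ℝ) * ∑ v, F v * g v := by
      rw [Finset.sum_congr rfl fun z _ => this z, Finset.sum_const, Finset.card_univ, nsmul_eq_mul]
    rw [← h3, Finset.sum_comm]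
    refine Finset.sum_congr rfl fun v _ => ?_
    rw [← Finset.sum_mul, sq]
  have hc : (0 : ℝ) < Fintype.card G := by exact_mod_cast Fintype.card_pos
  rw [h1]
  refine nonneg_of_mul_nonneg_right ?_ hc
  rw [h2]
  exact Finset.sum_nonneg fun v _ => sq_nonneg _

/-- Every character of `ℤ_n` has a square root on `ℤ_{2n}`. -/
theorem exists_sqrt_char {n : ℕ} [NeZero n] (ρ : AddChar (ZMod n) ℂ) :
    ∃ χ : AddChar (ZMod (2 * n)) ℂ,
      ∀ u, χ u ^ 2 = ρ (ZMod.castHom (Dvd.intro_left 2 rfl) (ZMod n) u) := by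
  have : NeZero (2 * n) := ⟨mul_ne_zero two_ne_zero (NeZero.ne n)⟩
  obtain ⟨η, hη⟩ := IsAlgClosed.exists_pow_nat_eq (ρ 1) (n := 2) (by norm_num)
  have hη1 : η ^ (2 * n) = 1 := by
    rw [pow_mul, hη, ← AddChar.map_nsmul_eq_pow]; simp
  refine ⟨AddChar.zmodChar (2 * n) hη1, fun u => ?_⟩
  rw [AddChar.zmodChar_apply, ← pow_mul, mul_comm, pow_mul, hη, ← AddChar.map_nsmul_eq_pow]
  congr 1
  rw [ZMod.castHom_apply, nsmul_one, ZMod.natCast_val]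

variable {E : Type*} [Fintype E] [DecidableEq E] {n : ℕ} [NeZero n]

/-- Reduction of `ℤ_{2n}`-valued configurations modulo `n`. -/
def reduceConfig (E : Type*) (n : ℕ) : (E → ZMod (2 * n)) →+ (E → ZMod n) where
  toFun x e := ZMod.castHom (Dvd.intro_left 2 rfl) (ZMod n) (x e)
  map_zero' := by ext; simp
  map_add' x y := by ext; simp

theorem reduceConfig_surjective : Function.Surjective (reduceConfig E n) := by
  intro y
  choose x hx using fun e => ZMod.ringHom_surjective
    (ZMod.castHom (Dvd.intro_left 2 rfl : n ∣ 2 * n) (ZMod n)) (y e)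
  exact ⟨x, funext hx⟩

/-- Functions of two configurations that are a nonnegative multiple of `F (x + y) * F (y - x)` after
lifting to `ℤ_{2n}`. -/
def IsSplit (h : (E → ZMod n) × (E → ZMod n) → ℝ) : Prop :=
  ∃ c : ℝ, 0 ≤ c ∧ ∃ F : (E → ZMod (2 * n)) → ℝ, ∀ x y,
    h (reduceConfig E n x, reduceConfig E n y) = c * (F (x + y) * F (y - x))

variable (E n) in
/-- The monoid of split functions. -/
def splitMonoid : Submonoid ((E → ZMod n) × (E → ZMod n) → ℝ) where
  carrier := {h | IsSplit h}
  one_mem' := ⟨1, zero_le_one, fun _ => 1, fun x y => by simp⟩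
  mul_mem' := by
    rintro h h' ⟨c, hc, F, hF⟩ ⟨c', hc', F', hF'⟩
    refine ⟨c * c', mul_nonneg hc hc', fun u => F u * F' u, fun x y => ?_⟩
    rw [Pi.mul_apply, hF, hF']; ring

variable (E n) in
/-- The closed cone generated by split functions. -/
noncomputable def ginibreCone : Subsemiring ((E → ZMod n) × (E → ZMod n) → ℝ) :=
  (splitMonoid E n).subsemiringClosure.topologicalClosure

theorem mem_ginibreCone_of_isSplit {h : (E → ZMod n) × (E → ZMod n) → ℝ} (hh : IsSplit h) :
    h ∈ ginibreCone E n := by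
  apply Subsemiring.le_topologicalClosure
  change h ∈ (splitMonoid E n).subsemiringClosure.toAddSubmonoid
  rw [Submonoid.subsemiringClosure_toAddSubmonoid]
  exact AddSubmonoid.subset_closure hh

theorem isClosed_ginibreCone :
    IsClosed (ginibreCone E n : Set ((E → ZMod n) × (E → ZMod n) → ℝ)) :=
  Subsemiring.isClosed_topologicalClosure _

theorem const_mem_ginibreCone {c : ℝ} (hc : 0 ≤ c) : (fun _ => c) ∈ ginibreCone E n :=
  mem_ginibreCone_of_isSplit ⟨c, hc, fun _ => 1, fun x y => by simp⟩

/-- Nonnegativity of the sum is a closed and additive condition, so split functions suffice. For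
these the sum is lifted to `ℤ_{2n}`, where all fibres have equal size. -/
theorem sum_nonneg_of_mem_ginibreCone {h : (E → ZMod n) × (E → ZMod n) → ℝ}
    (hh : h ∈ ginibreCone E n) : 0 ≤ ∑ x, ∑ y, h (x, y) := by
  have : NeZero (2 * n) := ⟨mul_ne_zero two_ne_zero (NeZero.ne n)⟩
  have hclosed : IsClosed {h : (E → ZMod n) × (E → ZMod n) → ℝ | 0 ≤ ∑ x, ∑ y, h (x, y)} :=
    isClosed_le continuous_const (by fun_prop)
  refine closure_minimal ?_ hclosed hh
  intro h hh
  replace hh : h ∈ (splitMonoid E n).subsemiringClosure.toAddSubmonoid := hh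
  rw [Submonoid.subsemiringClosure_toAddSubmonoid] at hh
  induction hh using AddSubmonoid.closure_induction with
  | mem h hh =>
    obtain ⟨c, hc, F, hF⟩ := hh
    obtain ⟨K, hK, hsum⟩ := sum_comp_surjective (reduceConfig E n) reduceConfig_surjective
    have h1 : K * (K * ∑ x, ∑ y, h (x, y)) = c * ∑ x, ∑ y, F (x + y) * F (y - x) := by
      rw [← hsum, Finset.mul_sum, Finset.mul_sum]
      refine Finset.sum_congr rfl fun x _ => ?_
      rw [← hsum, Finset.mul_sum]
      exact Finset.sum_congr rfl fun y _ => hF x y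
    have h2 : 0 ≤ K * (K * ∑ x, ∑ y, h (x, y)) := by
      rw [h1]; exact mul_nonneg hc (sum_add_mul_sub_nonneg F)
    exact nonneg_of_mul_nonneg_right (nonneg_of_mul_nonneg_right h2 hK) hK
  | zero => simp
  | add h h' _ _ ih ih' =>
    simp only [Set.mem_ofPred_eq, Pi.add_apply, Finset.sum_add_distrib] at ih ih' ⊢
    exact add_nonneg ih ih'

/-- The functions `F` for which `F x + F y` and `F x - F y` belong to the Ginibre cone. -/
def IsGinibre (F : (E → ZMod n) → ℝ) : Prop :=
  (fun z : (E → ZMod n) × (E → ZMod n) => F z.1 + F z.2) ∈ ginibreCone E n ∧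
    (fun z : (E → ZMod n) × (E → ZMod n) => F z.1 - F z.2) ∈ ginibreCone E n

theorem isGinibre_const {c : ℝ} (hc : 0 ≤ c) : IsGinibre (fun _ : E → ZMod n => c) :=
  ⟨const_mem_ginibreCone (add_nonneg hc hc), by
    simp only [sub_self]; exact const_mem_ginibreCone le_rfl⟩

theorem IsGinibre.add {F G : (E → ZMod n) → ℝ} (hF : IsGinibre F) (hG : IsGinibre G) :
    IsGinibre (fun x => F x + G x) := by
  constructor
  · have := add_mem hF.1 hG.1
    convert this using 1; ext z; simp only [Pi.add_apply]; ring
  · have := add_mem hF.2 hG.2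
    convert this using 1; ext z; simp only [Pi.add_apply]; ring

/-- Twice the sum or difference of products is a combination, with coefficients `+1`, of products of
sums and differences of the factors. -/
theorem IsGinibre.mul {F G : (E → ZMod n) → ℝ} (hF : IsGinibre F) (hG : IsGinibre G) :
    IsGinibre (fun x => F x * G x) := by
  have hhalf : (fun _ => (1 / 2 : ℝ)) ∈ ginibreCone E n := const_mem_ginibreCone (by norm_num)
  constructor
  · have := mul_mem hhalf (add_mem (mul_mem hF.1 hG.1) (mul_mem hF.2 hG.2))
    convert this using 1; ext z; simp only [Pi.add_apply, Pi.mul_apply]; ring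
  · have := mul_mem hhalf (add_mem (mul_mem hF.1 hG.2) (mul_mem hF.2 hG.1))
    convert this using 1; ext z; simp only [Pi.add_apply, Pi.mul_apply]; ring

theorem IsGinibre.pow {F : (E → ZMod n) → ℝ} (hF : IsGinibre F) (k : ℕ) :
    IsGinibre (fun x => F x ^ k) := by
  induction k with
  | zero => simpa using isGinibre_const zero_le_one
  | succ k ih => simpa only [pow_succ] using ih.mul hF

theorem IsGinibre.sum {ι : Type*} (T : Finset ι) {F : ι → (E → ZMod n) → ℝ}
    (hF : ∀ i ∈ T, IsGinibre (F i)) : IsGinibre (fun x => ∑ i ∈ T, F i x) := by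
  classical
  induction T using Finset.induction_on with
  | empty => simpa using isGinibre_const le_rfl
  | insert i T hi ih =>
    simp only [Finset.sum_insert hi]
    exact (hF i (Finset.mem_insert_self i T)).add
      (ih fun j hj => hF j (Finset.mem_insert_of_mem hj))

theorem IsGinibre.const_mul {F : (E → ZMod n) → ℝ} (hF : IsGinibre F) {c : ℝ} (hc : 0 ≤ c) :
    IsGinibre (fun x => c * F x) := (isGinibre_const hc).mul hF

open Filter Topology in
-- The exponential is the limit of `(1 + F / k) ^ k`; this is why the cone is taken closed.
theorem IsGinibre.exp {F : (E → ZMod n) → ℝ} (hF : IsGinibre F) :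
    IsGinibre (fun x => Real.exp (F x)) := by
  have happ : ∀ k : ℕ, IsGinibre (fun x => (1 + F x / k) ^ k) := by
    intro k
    have := ((isGinibre_const zero_le_one).add
      (hF.const_mul (c := (k : ℝ)⁻¹) (by positivity))).pow k
    simpa only [div_eq_inv_mul] using this
  have hlim : ∀ t : ℝ, Tendsto (fun k : ℕ => (1 + t / k) ^ k) atTop (𝓝 (Real.exp t)) :=
    fun t => Real.tendsto_one_add_div_pow_exp t
  constructor
  · refine isClosed_ginibreCone.mem_of_tendsto (b := atTop) ?_
      (Eventually.of_forall fun k => (happ k).1)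
    exact tendsto_pi_nhds.2 fun z => (hlim _).add (hlim _)
  · refine isClosed_ginibreCone.mem_of_tendsto (b := atTop) ?_
      (Eventually.of_forall fun k => (happ k).2)
    exact tendsto_pi_nhds.2 fun z => (hlim _).sub (hlim _)

open Filter Topology in
theorem exp_mem_ginibreCone {h : (E → ZMod n) × (E → ZMod n) → ℝ} (hh : h ∈ ginibreCone E n) :
    (fun z => Real.exp (h z)) ∈ ginibreCone E n := by
  refine isClosed_ginibreCone.mem_of_tendsto (b := atTop)
    (f := fun (k : ℕ) (z : (E → ZMod n) × (E → ZMod n)) => (1 + h z / k) ^ k) ?_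
    (Eventually.of_forall fun k => ?_)
  · exact tendsto_pi_nhds.2 fun z => Real.tendsto_one_add_div_pow_exp _
  · have := pow_mem (add_mem (const_mem_ginibreCone (E := E) (n := n) zero_le_one)
      (mul_mem (const_mem_ginibreCone (c := (k : ℝ)⁻¹) (by positivity)) hh)) k
    have heq : (fun z => (1 + h z / (k : ℝ)) ^ k)
        = ((fun _ => 1) + (fun _ => (k : ℝ)⁻¹) * h) ^ k := by ext z; simp [div_eq_inv_mul]
    show _ ∈ ginibreCone E n
    rw [heq]; exact this

/-- The real part of a character of the configuration space. -/
theorem isGinibre_char (ρ : AddChar (ZMod n) ℂ) (c : E → ℤ) :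
    IsGinibre (fun x : E → ZMod n => (ρ (∑ e, c e • x e)).re) := by
  have : NeZero (2 * n) := ⟨mul_ne_zero two_ne_zero (NeZero.ne n)⟩
  obtain ⟨χ, hχ⟩ := exists_sqrt_char ρ
  have hlift : ∀ x : E → ZMod (2 * n),
      ρ (∑ e, c e • reduceConfig E n x e) = χ (∑ e, c e • x e) ^ 2 := by
    intro x
    rw [hχ]; congr 1; rw [map_sum]
    exact Finset.sum_congr rfl fun e _ =>
      (map_zsmul (ZMod.castHom (Dvd.intro_left 2 rfl : n ∣ 2 * n) (ZMod n)) (c e) (x e)).symm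
  have hadd : ∀ x y : E → ZMod (2 * n),
      χ (∑ e, c e • (x + y) e) = χ (∑ e, c e • x e) * χ (∑ e, c e • y e) := by
    intro x y
    rw [← AddChar.map_add_eq_mul]; congr 1
    simp only [Pi.add_apply, smul_add, Finset.sum_add_distrib]
  have hsub : ∀ x y : E → ZMod (2 * n),
      χ (∑ e, c e • (y - x) e) = χ (∑ e, c e • y e) * (starRingEnd ℂ) (χ (∑ e, c e • x e)) := by
    intro x y
    rw [← AddChar.map_neg_eq_conj, ← AddChar.map_add_eq_mul]; congr 1
    simp only [Pi.sub_apply, smul_sub, Finset.sum_sub_distrib]; ring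
  have hnorm : ∀ u, (χ u).re ^ 2 + (χ u).im ^ 2 = 1 := by
    intro u
    have := AddChar.norm_apply χ u
    rw [← Complex.sq_norm_sub_sq_im, this]; ring
  constructor
  -- The identity `cos 2a + cos 2b = 2 cos(a + b) cos(b - a)`; the half angles are the reason for
  -- lifting to `ℤ_{2n}`.
  · refine mem_ginibreCone_of_isSplit ⟨2, by norm_num, fun u => (χ (∑ e, c e • u e)).re, ?_⟩
    intro x y
    simp only [hlift, hadd, hsub]
    have hx := hnorm (∑ e, c e • x e)
    have hy := hnorm (∑ e, c e • y e)
    generalize χ (∑ e, c e • x e) = X at *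
    generalize χ (∑ e, c e • y e) = Y at *
    simp only [sq, Complex.mul_re, Complex.conj_re, Complex.conj_im] at *
    linear_combination (X.im * X.im - X.re * X.re) * hy + (Y.im * Y.im - Y.re * Y.re) * hx
  -- The identity `cos 2a - cos 2b = 2 sin(a + b) sin(b - a)`.
  · refine mem_ginibreCone_of_isSplit ⟨2, by norm_num, fun u => (χ (∑ e, c e • u e)).im, ?_⟩
    intro x y
    simp only [hlift, hadd, hsub]
    have hx := hnorm (∑ e, c e • x e)
    have hy := hnorm (∑ e, c e • y e)
    generalize χ (∑ e, c e • x e) = X at *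
    generalize χ (∑ e, c e • y e) = Y at *
    simp only [sq, Complex.mul_re, Complex.mul_im, Complex.conj_re, Complex.conj_im] at *
    linear_combination (X.im * X.im - X.re * X.re) * hy + (-Y.im * Y.im + Y.re * Y.re) * hx

/-- Ginibre's inequality: adding a ferromagnetic interaction does not decrease the expectation of a
character. -/
theorem ginibre_inequality {F K L : (E → ZMod n) → ℝ} (hF : IsGinibre F) (hK : IsGinibre K)
    (hL : IsGinibre L) :
    (∑ x, F x * Real.exp (K x)) * ∑ x, Real.exp (K x + L x)
      ≤ (∑ x, F x * Real.exp (K x + L x)) * ∑ x, Real.exp (K x) := by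
  -- Duplicated variables: the sum of `(F x - F y) (e^{L x} - e^{L y}) e^{K x + K y}` is twice the
  -- difference of the two sides.
  have hmem := mul_mem (mul_mem hF.2 hL.exp.2) (exp_mem_ginibreCone hK.1)
  have hnn := sum_nonneg_of_mem_ginibreCone hmem
  simp only [Pi.mul_apply] at hnn
  set a := fun x => F x * Real.exp (K x) with ha
  set b := fun x => Real.exp (K x + L x) with hb
  set c := fun x => F x * Real.exp (K x + L x) with hc
  set d := fun x => Real.exp (K x) with hd
  have hexp : ∑ x, ∑ y, (F x - F y) * (Real.exp (L x) - Real.exp (L y)) * Real.exp (K x + K y)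
      = 2 * ((∑ x, c x) * ∑ x, d x) - 2 * ((∑ x, a x) * ∑ x, b x) := by
    have hsplit : ∀ x y, (F x - F y) * (Real.exp (L x) - Real.exp (L y)) * Real.exp (K x + K y)
        = c x * d y + d x * c y - (a x * b y + b x * a y) := by
      intro x y; simp only [ha, hb, hc, hd, Real.exp_add]; ring
    simp only [hsplit, Finset.sum_sub_distrib, Finset.sum_add_distrib, ← Finset.mul_sum,
      ← Finset.sum_mul]
    ring
  rw [hexp] at hnn
  linarith

end Ginibre

end LatticeGauge
namespace LatticeGauge

/-! ### Existence of the infinite volume limit -/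

section InfiniteVolume

set_option linter.unusedSectionVars false

variable {n N : ℕ}

theorem OneForm.eval_eq_sum (σ : OneForm n N) (q : OneChain) :
    σ.eval q = ∑ e : {e : Edge // e ∈ boxEdges N}, q e • σ e := by
  have h1 : ∑ e : {e : Edge // e ∈ boxEdges N}, q e • σ e
      = ∑ e ∈ boxEdges N, q e • σ.extend e := by
    rw [← Finset.sum_coe_sort (boxEdges N)]
    refine Finset.sum_congr rfl fun e _ => ?_
    rw [OneForm.extend, dif_pos e.2]
  rw [h1, OneForm.eval_eq_pair, pair, Finsupp.sum]
  trans ∑ e ∈ q.support ∪ boxEdges N, q e • σ.extend e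
  · refine Finset.sum_subset Finset.subset_union_left fun e _ he => ?_
    rw [Finsupp.notMem_support_iff.1 he, zero_smul]
  · refine (Finset.sum_subset Finset.subset_union_right fun e _ he => ?_).symm
    rw [OneForm.extend, dif_neg he, smul_zero]
  
theorem OneForm.curlAt_eq_eval (σ : OneForm n N) (p : Plaquette) :
    σ.curlAt p = σ.eval (plaquetteBoundary p) := by
  rw [OneForm.curlAt, ← pair_plaquetteBoundary, OneForm.eval_eq_pair]

theorem box_mono {N M : ℕ} (h : N ≤ M) : box N ⊆ box M := by
  intro v hv
  rw [mem_box] at hv ⊢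
  intro l
  have := hv l
  omega

theorem boxEdges_mono {N M : ℕ} (h : N ≤ M) : boxEdges N ⊆ boxEdges M := by
  intro e he
  simp only [boxEdges, Finset.mem_filter, Finset.mem_product] at he ⊢
  exact ⟨⟨box_mono h he.1.1, he.1.2⟩, box_mono h he.2⟩

theorem boxPlaquettes_mono {N M : ℕ} (h : N ≤ M) : boxPlaquettes N ⊆ boxPlaquettes M := by
  intro e he
  simp only [boxPlaquettes, Finset.mem_filter, Finset.mem_product] at he ⊢
  exact ⟨⟨box_mono h he.1.1, he.1.2⟩, box_mono h he.2.1, box_mono h he.2.2.1, box_mono h he.2.2.2⟩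

/-- Restriction of configurations to a smaller box. -/
noncomputable def restrictHom (n N M : ℕ) : OneForm n M →+ OneForm n N where
  toFun σ := restrictBox N σ.extend
  map_zero' := by ext e; simp [restrictBox, OneForm.extend]
  map_add' σ τ := by rw [OneForm.extend_add]; rfl

theorem restrictHom_surjective {N M : ℕ} (h : N ≤ M) :
    Function.Surjective (restrictHom n N M) := by
  intro σ
  refine ⟨restrictBox M σ.extend, funext fun e => ?_⟩
  show (restrictBox M σ.extend).extend e = σ e
  rw [OneForm.extend, dif_pos (boxEdges_mono h e.2), restrictBox, OneForm.extend, dif_pos e.2]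

theorem curlAt_restrictHom {N M : ℕ} (σ : OneForm n M) {p : Plaquette}
    (hp : p ∈ boxPlaquettes N) : (restrictHom n N M σ).curlAt p = σ.curlAt p :=
  curl_extend_restrictBox σ.extend hp

theorem eval_restrictHom {N M : ℕ} (σ : OneForm n M) {q : OneChain}
    (hq : ∀ e ∈ q.support, e ∈ boxEdges N) : (restrictHom n N M σ).eval q = σ.eval q := by
  rw [OneForm.eval_eq_pair, OneForm.eval_eq_pair, pair, pair]
  refine Finset.sum_congr rfl fun e he => ?_
  have h : (restrictHom n N M σ).extend e = σ.extend e := dif_pos (hq e he)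
  simp only [h]

variable [NeZero n] (ρ : AddChar (ZMod n) ℂ) {β : ℝ}

theorem isGinibre_char_eval (q : OneChain) :
    IsGinibre (fun σ : OneForm n N => (ρ (σ.eval q)).re) := by
  simp only [OneForm.eval_eq_sum]
  exact isGinibre_char ρ fun e : {e : Edge // e ∈ boxEdges N} => q e

theorem isGinibre_sum_curlAt (hβ : 0 ≤ β) (T : Finset Plaquette) :
    IsGinibre (fun σ : OneForm n N => ∑ p ∈ T, 2 * β * (ρ (σ.curlAt p)).re) := by
  refine IsGinibre.sum T fun p _ => ?_
  simp only [OneForm.curlAt_eq_eval]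
  exact (isGinibre_char_eval ρ _).const_mul (by positivity)

theorem weight_eq_exp (σ : OneForm n N) :
    weight ρ β σ = Real.exp (∑ p ∈ boxPlaquettes N, 2 * β * (ρ (σ.curlAt p)).re) := by
  rw [Real.exp_sum]; rfl

/-- The measure on the smaller box is that on the larger one with the couplings outside the smaller
box switched off; the spins there integrate to a constant. Ginibre's inequality compares the two. -/
theorem mean_wilson_le {N M : ℕ} (hNM : N ≤ M) (hβ : 0 ≤ β) {γ : OneChain}
    (hγ : ∀ e ∈ γ.support, e ∈ boxEdges N) :
    mean ρ β (fun σ : OneForm n N => (ρ (σ.eval γ)).re)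
      ≤ mean ρ β (fun σ : OneForm n M => (ρ (σ.eval γ)).re) := by
  have hsub := boxPlaquettes_mono hNM
  obtain ⟨C, hC, hsum⟩ := sum_comp_surjective (restrictHom n N M) (restrictHom_surjective hNM)
  have hG := ginibre_inequality (isGinibre_char_eval (N := M) ρ γ)
    (isGinibre_sum_curlAt (N := M) ρ hβ (boxPlaquettes N))
    (isGinibre_sum_curlAt (N := M) ρ hβ (boxPlaquettes M \ boxPlaquettes N))
  have hw : ∀ σ : OneForm n M, Real.exp (∑ p ∈ boxPlaquettes N, 2 * β * (ρ (σ.curlAt p)).re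
      + ∑ p ∈ boxPlaquettes M \ boxPlaquettes N, 2 * β * (ρ (σ.curlAt p)).re) = weight ρ β σ := by
    intro σ
    rw [weight_eq_exp, ← Finset.sum_sdiff hsub, add_comm]
  have hw' : ∀ σ : OneForm n M, Real.exp (∑ p ∈ boxPlaquettes N, 2 * β * (ρ (σ.curlAt p)).re)
      = weight ρ β (restrictHom n N M σ) := by
    intro σ
    rw [weight_eq_exp]
    refine congrArg Real.exp (Finset.sum_congr rfl fun p hp => ?_)
    rw [curlAt_restrictHom σ hp]
  have he : ∀ σ : OneForm n M, σ.eval γ = (restrictHom n N M σ).eval γ :=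
    fun σ => (eval_restrictHom σ hγ).symm
  have hF : ∑ σ : OneForm n M, (ρ (σ.eval γ)).re * weight ρ β (restrictHom n N M σ)
      = C * ∑ σ : OneForm n N, (ρ (σ.eval γ)).re * weight ρ β σ := by
    rw [← hsum]; exact Finset.sum_congr rfl fun σ _ => by rw [he σ]
  simp only [hw, hw'] at hG
  rw [hF, hsum (weight ρ β)] at hG
  unfold mean
  rw [div_le_div_iff₀ (totalWeight_pos ρ β N) (totalWeight_pos ρ β M)]
  refine le_of_mul_le_mul_left ?_ hC
  unfold totalWeight
  linarith

theorem eval_neg (σ : OneForm n N) (q : OneChain) : (-σ).eval q = -σ.eval q := by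
  simp only [OneForm.eval_eq_sum, Pi.neg_apply, smul_neg, Finset.sum_neg_distrib]

theorem weight_neg (σ : OneForm n N) : weight ρ β (-σ) = weight ρ β σ := by
  unfold weight
  refine Finset.prod_congr rfl fun p _ => ?_
  rw [OneForm.curlAt_eq_eval, eval_neg, plaquetteWeight_neg, OneForm.curlAt_eq_eval]

/-- The symmetry `σ ↦ -σ` of the weight kills the imaginary part. -/
theorem expectation_wilsonLoop_eq_mean (γ : OneChain) :
    expectation ρ N β (wilsonLoop ρ γ)
      = (mean ρ β (fun σ : OneForm n N => (ρ (σ.eval γ)).re) : ℂ) := by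
  have him : ∑ σ : OneForm n N, (ρ (σ.eval γ)).im * weight ρ β σ = 0 := by
    have h : ∑ σ : OneForm n N, (ρ (σ.eval γ)).im * weight ρ β σ
        = ∑ σ : OneForm n N, -((ρ (σ.eval γ)).im * weight ρ β σ) := by
      refine Fintype.sum_equiv (Equiv.neg _) _ _ fun σ => ?_
      rw [Equiv.neg_apply, eval_neg, weight_neg, char_neg, Complex.conj_im]; ring
    rw [Finset.sum_neg_distrib] at h
    linarith
  rw [expectation_eq, mean, Complex.ofReal_div]
  congr 1
  apply Complex.ext
  · rw [Complex.ofReal_re, Complex.re_sum]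
    exact Finset.sum_congr rfl fun σ _ => by rw [Complex.re_mul_ofReal]; rfl
  · rw [Complex.ofReal_im, Complex.im_sum, ← him]
    exact Finset.sum_congr rfl fun σ _ => by rw [Complex.im_mul_ofReal]; rfl

open Filter Topology in
theorem tendsto_finiteVolumeWilson (hβ : 0 ≤ β) {γ : OneChain} {N₀ : ℕ}
    (hγ : ∀ e ∈ γ.support, e ∈ boxEdges N₀) :
    Tendsto (finiteVolumeWilson ρ β γ) atTop (𝓝 (infiniteVolumeWilson ρ β γ)) := by
  set f : ℕ → ℝ := fun k => mean ρ β (fun σ : OneForm n (k + N₀) => (ρ (σ.eval γ)).re) with hf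
  have hmono : Monotone f := monotone_nat_of_le_succ fun k =>
    mean_wilson_le ρ (by omega) hβ fun e he => boxEdges_mono (by omega) (hγ e he)
  have hbdd : BddAbove (Set.range f) := by
    refine ⟨1, ?_⟩
    rintro _ ⟨k, rfl⟩
    refine (mean_mono fun σ => ?_).trans_eq (mean_const (1 : ℝ))
    exact (Complex.re_le_norm _).trans_eq (char_norm ρ _)
  have hlim := tendsto_atTop_ciSup hmono hbdd
  have h : Tendsto (finiteVolumeWilson ρ β γ) atTop (𝓝 ((⨆ k, f k : ℝ) : ℂ)) := by
    rw [← tendsto_add_atTop_iff_nat N₀]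
    refine ((Complex.continuous_ofReal.tendsto _).comp hlim).congr fun k => ?_
    rw [finiteVolumeWilson, expectation_wilsonLoop_eq_mean]; rfl
  rw [infiniteVolumeWilson, h.limUnder_eq]
  exact h

end InfiniteVolume

end LatticeGauge
namespace LatticeGauge

/-! ### The single-edge expectation `θ` -/

section Theta

variable {n : ℕ} [NeZero n] {ρ : AddChar (ZMod n) ℂ} {β : ℝ}

/-- `1 - θ(β)`. -/
noncomputable def oneSubTheta (ρ : AddChar (ZMod n) ℂ) (β : ℝ) : ℝ :=
  (∑ g : ZMod n, (1 - (ρ g).re) * plaquetteWeight ρ β g ^ 6) /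
    ∑ g : ZMod n, plaquetteWeight ρ β g ^ 6

theorem sum_plaquetteWeight_pos : 0 < ∑ g : ZMod n, plaquetteWeight ρ β g ^ 6 :=
  Finset.sum_pos (fun g _ => pow_pos (plaquetteWeight_pos ρ β g) 6) Finset.univ_nonempty

theorem theta_eq : theta ρ β = ((1 - oneSubTheta ρ β : ℝ) : ℂ) := by
  have hZ := (sum_plaquetteWeight_pos (ρ := ρ) (β := β)).ne'
  have him : ∑ g : ZMod n, (ρ g).im * plaquetteWeight ρ β g ^ 6 = 0 := by
    have h : ∑ g : ZMod n, (ρ g).im * plaquetteWeight ρ β g ^ 6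
        = ∑ g : ZMod n, -((ρ g).im * plaquetteWeight ρ β g ^ 6) := by
      refine Fintype.sum_equiv (Equiv.neg _) _ _ fun g => ?_
      rw [Equiv.neg_apply, plaquetteWeight_neg, char_neg, Complex.conj_im]; ring
    rw [Finset.sum_neg_distrib] at h
    linarith
  have hreal : 1 - oneSubTheta ρ β = (∑ g : ZMod n, (ρ g).re * plaquetteWeight ρ β g ^ 6) /
      ∑ g : ZMod n, plaquetteWeight ρ β g ^ 6 := by
    rw [oneSubTheta, eq_div_iff hZ, sub_mul, div_mul_cancel₀ _ hZ, one_mul,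
      ← Finset.sum_sub_distrib]
    exact Finset.sum_congr rfl fun g _ => by ring
  have hw : ∀ g : ZMod n, Real.exp (12 * β * (ρ g).re) = plaquetteWeight ρ β g ^ 6 :=
    fun g => (plaquetteWeight_pow_six ρ β g).symm
  rw [hreal, theta, Complex.ofReal_div]
  simp only [hw]
  rw [← Complex.ofReal_sum]
  congr 1
  apply Complex.ext
  · rw [Complex.ofReal_re, Complex.re_sum]
    exact Finset.sum_congr rfl fun g _ => Complex.re_mul_ofReal _ _
  · rw [Complex.ofReal_im, Complex.im_sum, ← him]
    exact Finset.sum_congr rfl fun g _ => Complex.im_mul_ofReal _ _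

theorem char_re_le_one (g : ZMod n) : (ρ g).re ≤ 1 :=
  (Complex.re_le_norm _).trans_eq (char_norm ρ g)

theorem oneSubTheta_nonneg : 0 ≤ oneSubTheta ρ β :=
  div_nonneg (Finset.sum_nonneg fun g _ => mul_nonneg (sub_nonneg.2 (char_re_le_one g))
    (pow_nonneg (plaquetteWeight_pos ρ β g).le 6)) sum_plaquetteWeight_pos.le

/-- The term `g = 0` of the numerator vanishes, and every other term carries `λ^12`. -/
theorem oneSubTheta_le : oneSubTheta ρ β ≤ 2 * n * lam ρ β ^ 12 := by
  have h0 : 0 < plaquetteWeight ρ β 0 ^ 6 := pow_pos (plaquetteWeight_pos ρ β 0) 6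
  have hl : 0 ≤ lam ρ β ^ 12 := by positivity
  rw [oneSubTheta, div_le_iff₀ sum_plaquetteWeight_pos]
  have hterm : ∀ g : ZMod n, (1 - (ρ g).re) * plaquetteWeight ρ β g ^ 6
      ≤ 2 * (lam ρ β ^ 12 * plaquetteWeight ρ β 0 ^ 6) := by
    intro g
    by_cases hg : g = 0
    · subst hg
      rw [AddChar.map_zero_eq_one, Complex.one_re, sub_self, zero_mul]; positivity
    · have h1 : plaquetteWeight ρ β g ^ 6 ≤ lam ρ β ^ 12 * plaquetteWeight ρ β 0 ^ 6 := by
        refine (pow_le_pow_left₀ (plaquetteWeight_pos ρ β g).le (plaquetteWeight_le hg) 6).trans_eq ?_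
        ring
      have h2 : 1 - (ρ g).re ≤ 2 := by
        have := (abs_le.1 ((Complex.abs_re_le_norm (ρ g)).trans_eq (char_norm ρ g))).1
        linarith
      exact mul_le_mul h2 h1 (pow_nonneg (plaquetteWeight_pos ρ β g).le 6) (by norm_num)
  have hZ : plaquetteWeight ρ β 0 ^ 6 ≤ ∑ g : ZMod n, plaquetteWeight ρ β g ^ 6 :=
    Finset.single_le_sum (f := fun g => plaquetteWeight ρ β g ^ 6)
      (fun g _ => pow_nonneg (plaquetteWeight_pos ρ β g).le 6) (Finset.mem_univ 0)
  refine (Finset.sum_le_card_nsmul _ _ _ fun g _ => hterm g).trans ?_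
  rw [Finset.card_univ, ZMod.card, nsmul_eq_mul]
  have := mul_le_mul_of_nonneg_left hZ (by positivity : 0 ≤ 2 * (n : ℝ) * lam ρ β ^ 12)
  linarith

/-- Keep only the `g` that attains the maximum defining `λ`. Together with `oneSubTheta_le` this
makes `1 - θ` comparable to `λ^12`. -/
theorem le_oneSubTheta (hn : 2 ≤ n) (hρ : Function.Injective ρ) (hβ : 0 < β) :
    (1 - Real.cos (2 * Real.pi / n)) / n * lam ρ β ^ 12 ≤ oneSubTheta ρ β := by
  have : Fact (1 < n) := ⟨by omega⟩
  have : Nonempty {g : ZMod n // g ≠ 0} := ⟨⟨1, one_ne_zero⟩⟩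
  have h0 : 0 < plaquetteWeight ρ β 0 := plaquetteWeight_pos ρ β 0
  have hn0 : (0 : ℝ) < n := by exact_mod_cast (by omega : 0 < n)
  obtain ⟨⟨g, hg⟩, hmax⟩ := exists_eq_ciSup_of_finite (f := fun g : {g : ZMod n // g ≠ 0} =>
    Real.exp (β * (ρ g).re) / Real.exp (β * (ρ 0).re))
  change Real.exp (β * (ρ g).re) / Real.exp (β * (ρ 0).re) = lam ρ β at hmax
  have hre : (ρ g).re = Real.cos (2 * Real.pi / n) := by
    have h := hmax
    rw [lam_eq hn ρ hρ hβ.le, ← Real.exp_sub, Real.exp_eq_exp, AddChar.map_zero_eq_one,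
      Complex.one_re] at h
    exact mul_left_cancel₀ hβ.ne' (by linarith)
  have hw : plaquetteWeight ρ β g ^ 6 = lam ρ β ^ 12 * plaquetteWeight ρ β 0 ^ 6 := by
    rw [← hmax, plaquetteWeight_pow_six, plaquetteWeight_pow_six, div_pow, ← Real.exp_nat_mul,
      ← Real.exp_nat_mul, ← Real.exp_sub, ← Real.exp_add]
    congr 1; push_cast; ring
  have hZ : ∑ g : ZMod n, plaquetteWeight ρ β g ^ 6 ≤ n * plaquetteWeight ρ β 0 ^ 6 := by
    refine (Finset.sum_le_card_nsmul _ _ (plaquetteWeight ρ β 0 ^ 6) fun g _ => ?_).trans_eq ?_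
    · refine pow_le_pow_left₀ (plaquetteWeight_pos ρ β g).le (Real.exp_le_exp.2 ?_) 6
      rw [AddChar.map_zero_eq_one, Complex.one_re]
      exact mul_le_mul_of_nonneg_left (char_re_le_one g) (by positivity)
    · rw [Finset.card_univ, ZMod.card, nsmul_eq_mul]
  have hsum : (1 - (ρ g).re) * plaquetteWeight ρ β g ^ 6
      ≤ ∑ g : ZMod n, (1 - (ρ g).re) * plaquetteWeight ρ β g ^ 6 :=
    Finset.single_le_sum (f := fun g => (1 - (ρ g).re) * plaquetteWeight ρ β g ^ 6)
      (fun g _ => mul_nonneg (sub_nonneg.2 (char_re_le_one g))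
        (pow_nonneg (plaquetteWeight_pos ρ β g).le 6)) (Finset.mem_univ g)
  rw [oneSubTheta, le_div_iff₀ sum_plaquetteWeight_pos]
  refine le_trans ?_ hsum
  rw [hw, hre]
  have hδ : 0 ≤ 1 - Real.cos (2 * Real.pi / n) := sub_nonneg.2 (Real.cos_le_one _)
  refine (mul_le_mul_of_nonneg_left hZ (by positivity)).trans_eq ?_
  field_simp

end Theta

/-! ### Elementary estimates -/

section Elementary

variable {a : ℝ}

theorem abs_pow_sub_exp_le (h0 : 0 ≤ a) (h1 : a ≤ 1) (m : ℕ) :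
    |(1 - a) ^ m - Real.exp (-(m * a))| ≤ m * a ^ 2 := by
  have he : Real.exp (-(m * a)) = Real.exp (-a) ^ m := by
    rw [← Real.exp_nat_mul]; congr 1; ring
  rw [he]
  refine (abs_pow_sub_pow_le _ _ m).trans ?_
  have hd : |1 - a - Real.exp (-a)| ≤ a ^ 2 := by
    have := Real.abs_exp_sub_one_sub_id_le (x := -a) (by rw [abs_neg, abs_of_nonneg h0]; exact h1)
    rw [abs_sub_comm, neg_sq] at this
    convert this using 2; ring
  have hm : max |1 - a| |Real.exp (-a)| ^ (m - 1) ≤ 1 := by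
    refine pow_le_one₀ (le_max_of_le_left (abs_nonneg _)) (max_le ?_ ?_)
    · rw [abs_of_nonneg (by linarith)]; linarith
    · rw [abs_of_pos (Real.exp_pos _)]; exact Real.exp_le_one_iff.2 (by linarith)
  calc _ ≤ a ^ 2 * m * 1 := mul_le_mul (mul_le_mul_of_nonneg_right hd (by positivity)) hm
        (pow_nonneg (le_max_of_le_left (abs_nonneg _)) _) (by positivity)
    _ = m * a ^ 2 := by ring

theorem abs_pow_sub_pow_le_mul (h0 : 0 ≤ a) (h1 : a ≤ 1) {k m : ℕ} (hkm : k ≤ m) :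
    |(1 - a) ^ k - (1 - a) ^ m| ≤ a * (m - k) := by
  obtain ⟨j, rfl⟩ := Nat.exists_eq_add_of_le hkm
  have hb := one_add_mul_le_pow (a := -a) (by linarith) j
  rw [← sub_eq_add_neg 1 a] at hb
  have h2 : (1 - a) ^ j ≤ 1 := pow_le_one₀ (by linarith) (by linarith)
  have h3 : (1 - a) ^ k ≤ 1 := pow_le_one₀ (by linarith) (by linarith)
  have h4 : 0 ≤ (1 - a) ^ k := pow_nonneg (by linarith) k
  have h5 : (1 - a) ^ k - (1 - a) ^ (k + j) = (1 - a) ^ k * (1 - (1 - a) ^ j) := by ring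
  rw [h5, abs_of_nonneg (mul_nonneg h4 (by linarith))]
  push_cast
  nlinarith

theorem pow_le_exp (h1 : a ≤ 1) (k : ℕ) : (1 - a) ^ k ≤ Real.exp (-(a * k)) := by
  have he : Real.exp (-(a * k)) = Real.exp (-a) ^ k := by
    rw [← Real.exp_nat_mul]; congr 1; ring
  rw [he]
  exact pow_le_pow_left₀ (by linarith) (Real.one_sub_le_exp_neg a) k

theorem exp_neg_le_inv {t : ℝ} (ht : 0 < t) : Real.exp (-t) ≤ 1 / t := by
  rw [Real.exp_neg, one_div]
  exact inv_anti₀ ht (by linarith [Real.add_one_le_exp t])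

/-- Interpolation between a bound that is good for small `A` and one that is good for large `A`. -/
theorem le_mul_of_interpolation {D A y C₁ C₂ C₃ : ℝ} (hy : 0 ≤ y)
    (hC₁ : 0 ≤ C₁) (hC₂ : 0 ≤ C₂) (hC₃ : 0 ≤ C₃) (h₁ : D ≤ C₁ * A * y ^ 2)
    (h₂ : 0 < A → D ≤ C₂ / A + C₃ * y) : D ≤ (C₁ + C₂ + C₃) * y := by
  -- At `A * y = 1` both `A * y ^ 2` and `1 / A` equal `y`.
  rcases le_or_gt (A * y) 1 with h | h
  · have : C₁ * A * y ^ 2 ≤ C₁ * y := by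
      have := mul_le_mul_of_nonneg_left h (mul_nonneg hC₁ hy); nlinarith
    nlinarith [mul_nonneg hC₂ hy, mul_nonneg hC₃ hy]
  · have hA : 0 < A := by
      by_contra hA
      nlinarith [mul_nonneg (neg_nonneg.2 (not_lt.1 hA)) hy]
    have hinv : C₂ / A ≤ C₂ * y := by
      rw [div_le_iff₀ hA]; nlinarith
    nlinarith [h₂ hA, mul_nonneg hC₁ hy]

end Elementary

end LatticeGauge
namespace LatticeGauge

/-! ### Estimates in finite volume -/

section FiniteVolume

set_option linter.unusedSectionVars false

variable {n N M : ℕ} [NeZero n] {ρ : AddChar (ZMod n) ℂ} {β : ℝ} {γ : OneChain}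

open Classical in
/-- The number of uniform edges of `γ` away from the corners. -/
noncomputable def uniformCount (γ : OneChain) (σ : OneForm n N) : ℕ :=
  ((nonCorner γ).filter (IsUniform σ.extend)).card

theorem card_nonCorner (γ : OneChain) : (nonCorner γ).card + cornerCount γ = loopLength γ := by
  classical
  rw [add_comm, loopLength, cornerCount, nonCorner]
  convert Finset.card_filter_add_card_filter_not (s := γ.support) (IsCornerEdge γ)

theorem uniformCount_le (σ : OneForm n N) : uniformCount γ σ ≤ (nonCorner γ).card := by
  classical
  exact Finset.card_filter_le _ _

theorem star_subset_boxPlaquettes (hM : ∀ e ∈ γ.support, ∀ l, |e.1 l| ≤ M) (hN : M + 26 ≤ N)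
    {e : Edge} (he : e ∈ γ.support) : star e ⊆ boxPlaquettes N := by
  intro p hp
  have hx : ∀ l, -(N : ℤ) ≤ p.1 l ∧ p.1 l < N := fun l => by
    have := abs_le.1 (dist_le_of_mem_star hp l)
    have := abs_le.1 (hM e he l)
    omega
  exact mem_boxPlaquettes.2 ⟨mem_box.2 fun l => ⟨(hx l).1, (hx l).2.le⟩, (hx _).2, (hx _).2⟩

theorem mem_boxEdges_of_abs_le (hM : ∀ e ∈ γ.support, ∀ l, |e.1 l| ≤ M) (hN : M < N)
    {e : Edge} (he : e ∈ γ.support) : e ∈ boxEdges N := by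
  have hx : ∀ l, -(N : ℤ) ≤ e.1 l ∧ e.1 l < N := fun l => by
    have := abs_le.1 (hM e he l)
    omega
  exact mem_boxEdges.2 ⟨mem_box.2 fun l => ⟨(hx l).1, (hx l).2.le⟩, (hx _).2⟩

/-- If the curl vanishes on all six plaquettes, the edge is uniform with value `0`; so one of the
six must be excited, each with probability at most `2 * peierls ρ β`. -/
theorem prob_not_isUniform_le (h : peierls ρ β ≤ 1 / 2) {e : Edge}
    (he : star e ⊆ boxPlaquettes N) :
    prob ρ β (fun σ : OneForm n N => ¬ IsUniform σ.extend e) ≤ 12 * peierls ρ β := by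
  refine (prob_le_sum (star e) (fun p σ => p ∈ vortexSupport N σ.extend) ?_).trans ?_
  · intro σ hσ
    by_contra hno
    push Not at hno
    have h0 : ∀ p ∈ star e, curl σ.extend p.1 p.2.1.1 p.2.1.2 = 0 := by
      intro p hp
      by_contra hc
      exact hno p hp (mem_vortexSupport.2 ⟨he hp, hc⟩)
    refine hσ fun p hp => ?_
    rw [stapleValue, h0 p hp, h0 _ (basePlaquette_mem_star e), smul_zero, smul_zero]
  · refine (Finset.sum_le_card_nsmul _ _ _ fun p _ => prob_mem_vortexSupport_le h p).trans_eq ?_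
    rw [card_star, nsmul_eq_mul]; push_cast; ring

theorem mean_card_sub_uniformCount_le (h : peierls ρ β ≤ 1 / 2)
    (hM : ∀ e ∈ γ.support, ∀ l, |e.1 l| ≤ M) (hN : M + 26 ≤ N) :
    mean ρ β (fun σ : OneForm n N => ((nonCorner γ).card : ℝ) - uniformCount γ σ)
      ≤ (nonCorner γ).card * (12 * peierls ρ β) := by
  classical
  have heq : ∀ σ : OneForm n N, ((nonCorner γ).card : ℝ) - uniformCount γ σ
      = ∑ e ∈ nonCorner γ, if ¬ IsUniform σ.extend e then 1 else 0 := by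
    intro σ
    rw [← Finset.sum_filter, Finset.sum_const, nsmul_eq_mul, mul_one, sub_eq_iff_eq_add,
      ← Finset.card_filter_add_card_filter_not (IsUniform σ.extend), uniformCount]
    push_cast
    rw [add_comm]
  simp only [heq]
  rw [mean_sum, ← nsmul_eq_mul]
  refine Finset.sum_le_card_nsmul _ _ _ fun e he => ?_
  have := prob_not_isUniform_le h (star_subset_boxPlaquettes hM hN (mem_nonCorner.1 he).1)
  refine le_trans (le_of_eq ?_) this
  unfold prob
  congr!

theorem norm_reducedLoop (h1 : oneSubTheta ρ β ≤ 1) (σ : OneForm n N) :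
    ‖reducedLoop ρ β γ (nonCorner γ) σ‖ = (1 - oneSubTheta ρ β) ^ uniformCount γ σ := by
  rw [reducedLoop, norm_mul, char_norm, one_mul, norm_pow, theta_eq, Complex.norm_real,
    Real.norm_eq_abs, abs_of_nonneg (sub_nonneg.2 h1), uniformCount]

theorem exp_loopLength_mul :
    Complex.exp (-(loopLength γ : ℂ) * (1 - theta ρ β))
      = ((Real.exp (-(loopLength γ * oneSubTheta ρ β)) : ℝ) : ℂ) := by
  rw [theta_eq]; push_cast; congr 1; ring

/-- The bound for short loops. Outside the two bad events the reduced loop equals `θ^k`; replacing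
`k` by `ℓ` costs `1 - θ` for each missing edge, and replacing `θ^ℓ` by the exponential costs `ℓ (1 -
θ)²`. -/
theorem norm_finiteVolumeWilson_sub_le (h : peierls ρ β ≤ 1 / 2) (h1 : oneSubTheta ρ β ≤ 1)
    (hγ : IsGeneralizedLoop γ) (hM : ∀ e ∈ γ.support, ∀ l, |e.1 l| ≤ M) (hN : M + 26 ≤ N) :
    ‖finiteVolumeWilson ρ β γ N - Complex.exp (-(loopLength γ : ℂ) * (1 - theta ρ β))‖
      ≤ 4 * loopLength γ * peierls ρ β ^ 7 + 2 * cornerCount γ * peierls ρ β ^ 6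
        + oneSubTheta ρ β * (cornerCount γ + 12 * loopLength γ * peierls ρ β)
        + loopLength γ * oneSubTheta ρ β ^ 2 := by
  classical
  set a := oneSubTheta ρ β with ha
  have h0 : 0 ≤ a := oneSubTheta_nonneg
  have hz : 0 ≤ peierls ρ β := peierls_nonneg
  have hcard := card_nonCorner γ
  have hpoint : ∀ σ : OneForm n N,
      ‖reducedLoop ρ β γ (nonCorner γ) σ - ((1 - a) ^ loopLength γ : ℝ)‖
        ≤ 2 * (if HasLargeVortex N γ σ.extend then 1 else 0)
          + 2 * (if HasCornerVortex N γ σ.extend then 1 else 0)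
          + a * (((nonCorner γ).card : ℝ) - uniformCount γ σ) + a * cornerCount γ := by
    intro σ
    have hk := uniformCount_le (γ := γ) σ
    have hk' : (uniformCount γ σ : ℝ) ≤ (nonCorner γ).card := by exact_mod_cast hk
    have hnn : 0 ≤ a * (((nonCorner γ).card : ℝ) - uniformCount γ σ) + a * cornerCount γ :=
      add_nonneg (mul_nonneg h0 (by linarith)) (by positivity)
    by_cases hbad : HasLargeVortex N γ σ.extend ∨ HasCornerVortex N γ σ.extend
    · have h2 : ‖reducedLoop ρ β γ (nonCorner γ) σ - ((1 - a) ^ loopLength γ : ℝ)‖ ≤ 2 := by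
        refine (norm_sub_le _ _).trans ?_
        rw [norm_reducedLoop h1, Complex.norm_real, Real.norm_eq_abs,
          abs_of_nonneg (pow_nonneg (by linarith) _)]
        have := pow_le_one₀ (n := uniformCount γ σ) (a := 1 - a) (by linarith) (by linarith)
        have := pow_le_one₀ (n := loopLength γ) (a := 1 - a) (by linarith) (by linarith)
        linarith
      have h3 : (2 : ℝ) ≤ 2 * (if HasLargeVortex N γ σ.extend then 1 else 0)
          + 2 * (if HasCornerVortex N γ σ.extend then 1 else 0) := by
        rcases hbad with hb | hb
        · rw [if_pos hb]; split_ifs <;> norm_num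
        · rw [if_pos hb]; split_ifs <;> norm_num
      linarith
    · push Not at hbad
      rw [if_neg hbad.1, if_neg hbad.2]
      have hpair := pair_eq_sum_stapleValue hγ hM hN hbad.1 hbad.2
      have hr : reducedLoop ρ β γ (nonCorner γ) σ = (((1 - a) ^ uniformCount γ σ : ℝ) : ℂ) := by
        rw [reducedLoop, OneForm.eval_eq_pair, hpair, sub_self, AddChar.map_zero_eq_one, one_mul,
          theta_eq, Complex.ofReal_pow, uniformCount]
      rw [hr, ← Complex.ofReal_sub, Complex.norm_real, Real.norm_eq_abs]
      refine (abs_pow_sub_pow_le_mul h0 h1 (hk.trans (by omega))).trans ?_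
      rw [← hcard]; push_cast; linarith
  have hW : finiteVolumeWilson ρ β γ N = expectation ρ N β (reducedLoop ρ β γ (nonCorner γ)) :=
    expectation_wilsonLoop_eq ρ β hγ (fun e he => mem_boxEdges_of_abs_le hM (by omega) he)
      fun e he => star_subset_boxPlaquettes hM hN he
  have hfirst : ‖finiteVolumeWilson ρ β γ N - ((1 - a) ^ loopLength γ : ℝ)‖
      ≤ 2 * (loopLength γ * (2 * peierls ρ β ^ 7)) + 2 * (cornerCount γ * peierls ρ β ^ 6)
        + a * ((nonCorner γ).card * (12 * peierls ρ β)) + a * cornerCount γ := by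
    rw [hW, ← expectation_const (ρ := ρ) (β := β) (N := N) (((1 - a) ^ loopLength γ : ℝ) : ℂ),
      expectation_sub]
    refine (norm_expectation_le hpoint).trans ?_
    rw [mean_add, mean_add, mean_add, mean_const_mul, mean_const_mul, mean_const_mul, mean_const]
    have e1 := prob_hasLargeVortex_le (N := N) h γ
    have e2 := prob_hasCornerVortex_le (N := N) (ρ := ρ) (β := β) γ
    have e3 := mul_le_mul_of_nonneg_left (mean_card_sub_uniformCount_le h hM hN) h0
    have e1' : prob ρ β (fun σ : OneForm n N => HasLargeVortex N γ σ.extend)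
      = mean ρ β (fun σ : OneForm n N => if HasLargeVortex N γ σ.extend then 1 else 0) := by
      unfold prob; congr!
    have e2' : prob ρ β (fun σ : OneForm n N => HasCornerVortex N γ σ.extend)
      = mean ρ β (fun σ : OneForm n N => if HasCornerVortex N γ σ.extend then 1 else 0) := by
      unfold prob; congr!
    rw [← e1', ← e2']
    linarith
  have hsecond : ‖(((1 - a) ^ loopLength γ : ℝ) : ℂ)
      - Complex.exp (-(loopLength γ : ℂ) * (1 - theta ρ β))‖ ≤ loopLength γ * a ^ 2 := by
    rw [exp_loopLength_mul, ← Complex.ofReal_sub, Complex.norm_real, Real.norm_eq_abs]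
    exact abs_pow_sub_exp_le h0 h1 _
  refine (norm_sub_le_norm_sub_add_norm_sub _ (((1 - a) ^ loopLength γ : ℝ) : ℂ) _).trans ?_
  have hle : ((nonCorner γ).card : ℝ) ≤ loopLength γ := by exact_mod_cast (by omega)
  have := mul_le_mul_of_nonneg_left (mul_le_mul_of_nonneg_right hle
    (by positivity : 0 ≤ 12 * peierls ρ β)) h0
  linarith

/-- The bound for long loops. The reduced loop has modulus `θ^k` on every configuration, good or
bad, and typically at least half of the non-corner edges are uniform. -/
theorem norm_finiteVolumeWilson_le (h : peierls ρ β ≤ 1 / 2) (h1 : oneSubTheta ρ β ≤ 1)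
    (hγ : IsGeneralizedLoop γ) (hM : ∀ e ∈ γ.support, ∀ l, |e.1 l| ≤ M) (hN : M + 26 ≤ N)
    (hpos : 0 < (nonCorner γ).card) :
    ‖finiteVolumeWilson ρ β γ N‖
      ≤ Real.exp (-(oneSubTheta ρ β * ((nonCorner γ).card / 2))) + 24 * peierls ρ β := by
  set a := oneSubTheta ρ β with ha
  have h0 : 0 ≤ a := oneSubTheta_nonneg
  have hm : (0 : ℝ) < (nonCorner γ).card := by exact_mod_cast hpos
  set m : ℝ := ((nonCorner γ).card : ℝ) with hmdef
  have hpoint : ∀ σ : OneForm n N, ‖reducedLoop ρ β γ (nonCorner γ) σ‖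
      ≤ Real.exp (-(a * (m / 2))) + 2 / m * (m - uniformCount γ σ) := by
    intro σ
    have hk' : (uniformCount γ σ : ℝ) ≤ m := Nat.cast_le.2 (uniformCount_le (γ := γ) σ)
    have hnn : 0 ≤ 2 / m * (m - uniformCount γ σ) := mul_nonneg (by positivity) (by linarith)
    rw [norm_reducedLoop h1]
    -- The second term is at least `1` when fewer than half of the edges are uniform, as in Markov's
    -- inequality.
    rcases le_or_gt (m / 2) (uniformCount γ σ) with hc | hc
    · have e1 := pow_le_exp h1 (uniformCount γ σ)
      have e2 : Real.exp (-(a * uniformCount γ σ)) ≤ Real.exp (-(a * (m / 2))) :=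
        Real.exp_le_exp.2 (neg_le_neg (mul_le_mul_of_nonneg_left hc h0))
      linarith
    · have e1 : (1 - a) ^ uniformCount γ σ ≤ 1 := pow_le_one₀ (by linarith) (by linarith)
      have e2 : 1 ≤ 2 / m * (m - uniformCount γ σ) := by
        rw [div_mul_eq_mul_div, le_div_iff₀ hm]; linarith
      have := Real.exp_pos (-(a * (m / 2)))
      linarith
  have hW : finiteVolumeWilson ρ β γ N = expectation ρ N β (reducedLoop ρ β γ (nonCorner γ)) :=
    expectation_wilsonLoop_eq ρ β hγ (fun e he => mem_boxEdges_of_abs_le hM (by omega) he)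
      fun e he => star_subset_boxPlaquettes hM hN he
  rw [hW]
  refine (norm_expectation_le hpoint).trans ?_
  rw [mean_add, mean_const, mean_const_mul]
  have e3 := mul_le_mul_of_nonneg_left (mean_card_sub_uniformCount_le h hM hN)
    (by positivity : 0 ≤ 2 / m)
  have e4 : 2 / m * (m * (12 * peierls ρ β)) = 24 * peierls ρ β := by field_simp; ring
  rw [← hmdef, e4] at e3
  linarith

end FiniteVolume

end LatticeGauge
namespace LatticeGauge

/-! ### The main estimate -/

section MainEstimate

set_option linter.unusedSectionVars false

variable {n N M : ℕ} [NeZero n] {ρ : AddChar (ZMod n) ℂ} {β : ℝ} {γ : OneChain}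

theorem one_sub_cos_pos (hn : 2 ≤ n) : 0 < 1 - Real.cos (2 * Real.pi / n) := by
  have hn0 : (0 : ℝ) < n := by exact_mod_cast (by omega : 0 < n)
  have hn2 : (2 : ℝ) ≤ n := by exact_mod_cast hn
  have hpi := Real.pi_pos
  have hx : 0 < 2 * Real.pi / n := by positivity
  have hx2 : 2 * Real.pi / n < 2 * Real.pi := by rw [div_lt_iff₀ hn0]; nlinarith
  refine sub_pos.2 (lt_of_le_of_ne (Real.cos_le_one _) fun h => hx.ne' ?_)
  exact (Real.cos_eq_one_iff_of_lt_of_lt (by linarith) hx2).1 h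

open Filter Topology in
/-- `λ(β)` is positive and tends to `0`. -/
theorem exists_lam_le (hn : 2 ≤ n) (hρ : Function.Injective ρ) {ε : ℝ} (hε : 0 < ε) :
    ∃ b : ℝ, 0 < b ∧ ∀ β, b ≤ β → 0 < lam ρ β ∧ lam ρ β ≤ ε := by
  have hδ := one_sub_cos_pos hn
  have hlim : Tendsto (fun β : ℝ => Real.exp (-β * (1 - Real.cos (2 * Real.pi / n)))) atTop
      (𝓝 0) := by
    refine Real.tendsto_exp_atBot.comp ?_
    exact tendsto_neg_atTop_atBot.atBot_mul_const hδ
  obtain ⟨b, hb⟩ := eventually_atTop.1 (hlim.eventually (eventually_le_nhds hε))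
  refine ⟨max b 1, by positivity, fun β hβ => ?_⟩
  have hβ1 : 1 ≤ β := (le_max_right _ _).trans hβ
  rw [lam_eq hn ρ hρ (by linarith)]
  exact ⟨Real.exp_pos _, hb β ((le_max_left _ _).trans hβ)⟩

/-- The constant in the main estimate, as a function of the order of the group. -/
noncomputable def errorConst (n : ℕ) : ℝ :=
  let P : ℝ := 14406 * 486 ^ 2 * n
  let C : ℝ := 2 * n
  (4 * P ^ 7 + 2 * P ^ 6 + C * (1 + 12 * P) + C ^ 2)
    + 5 / ((1 - Real.cos (2 * Real.pi / n)) / n) + (48 * P + 4)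

theorem norm_finiteVolumeWilson_sub_le_sqrt (hn : 2 ≤ n) (hρ : Function.Injective ρ) (hβ : 0 < β)
    (hl0 : 0 < lam ρ β) (hl1 : lam ρ β ≤ 1) (h : peierls ρ β ≤ 1 / 2)
    (h1 : oneSubTheta ρ β ≤ 1) (hγ : IsGeneralizedLoop γ)
    (hM : ∀ e ∈ γ.support, ∀ l, |e.1 l| ≤ M) (hN : M + 26 ≤ N) :
    ‖finiteVolumeWilson ρ β γ N - Complex.exp (-(loopLength γ : ℂ) * (1 - theta ρ β))‖
      ≤ errorConst n * √(√((cornerCount γ : ℝ) / (loopLength γ : ℝ)) + lam ρ β ^ 2) := by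
  have hn0 : (0 : ℝ) < n := by exact_mod_cast (by omega : 0 < n)
  have hδ := one_sub_cos_pos hn
  have hcard := card_nonCorner γ
  have herr := norm_finiteVolumeWilson_sub_le h h1 hγ hM hN
  have hupper := oneSubTheta_le (ρ := ρ) (β := β)
  have hlower := le_oneSubTheta hn hρ hβ
  have ha0 : 0 ≤ oneSubTheta ρ β := oneSubTheta_nonneg
  have hdecay := norm_finiteVolumeWilson_le h h1 hγ hM hN
  have htriv : ‖finiteVolumeWilson ρ β γ N‖ ≤ 1 :=
    (norm_expectation_le fun σ => (char_norm ρ _).le).trans_eq (mean_const 1)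
  unfold errorConst
  unfold peierls at herr hdecay
  simp only
  set P : ℝ := 14406 * 486 ^ 2 * n with hP
  set C : ℝ := 2 * n with hC
  set c : ℝ := (1 - Real.cos (2 * Real.pi / n)) / n with hc
  set L := lam ρ β with hL
  set a := oneSubTheta ρ β with ha
  set D := ‖finiteVolumeWilson ρ β γ N - Complex.exp (-(loopLength γ : ℂ) * (1 - theta ρ β))‖
    with hD
  set l : ℝ := (loopLength γ : ℝ) with hl
  set k : ℝ := (cornerCount γ : ℝ) with hk
  have hP0 : 0 < P := by positivity
  have hC0 : 0 < C := by positivity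
  have hc0 : 0 < c := by positivity
  have hl_nonneg : 0 ≤ l := Nat.cast_nonneg _
  have hk_nonneg : 0 ≤ k := Nat.cast_nonneg _
  have hkl : k ≤ l := Nat.cast_le.2 (by omega)
  set r : ℝ := k / l with hr
  have hr0 : 0 ≤ r := by positivity
  have hr1 : r ≤ 1 := div_le_one_of_le₀ hkl hl_nonneg
  -- For the empty loop both counts are `0` and the quotient is `0` by convention.
  have hkr : k = r * l := by
    rcases hl_nonneg.eq_or_lt with h0 | h0
    · rw [← h0, mul_zero]; linarith
    · rw [hr, div_mul_cancel₀ _ h0.ne']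
  have hrs : r ≤ √r := Real.le_sqrt_of_sq_le (by nlinarith)
  have hsr : 0 ≤ √r := Real.sqrt_nonneg r
  set x := √r + L ^ 2 with hx
  have hL2 : 0 ≤ L ^ 2 := sq_nonneg L
  have hx0 : 0 ≤ x := by positivity
  have hx2 : x ≤ 4 := by
    have : √r ≤ 1 := Real.sqrt_le_one.2 hr1
    have : L ^ 2 ≤ 1 := pow_le_one₀ hl0.le hl1
    linarith
  have hy0 : 0 ≤ √x := Real.sqrt_nonneg x
  have hy2 : √x ≤ 2 := Real.sqrt_le_iff.2 ⟨by norm_num, by linarith⟩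
  have hyx : √x ^ 2 = x := Real.sq_sqrt hx0
  have hexp : ‖Complex.exp (-(loopLength γ : ℂ) * (1 - theta ρ β))‖ = Real.exp (-(l * a)) := by
    rw [exp_loopLength_mul, Complex.norm_real, Real.norm_eq_abs, abs_of_pos (Real.exp_pos _)]
  have hDle : D ≤ ‖finiteVolumeWilson ρ β γ N‖ + Real.exp (-(l * a)) := by
    rw [← hexp]; exact norm_sub_le _ _
  -- Interpolation with `y = √x` in the parameter `A = ℓ λ^12`, which is comparable to `ℓ (1 - θ)`.
  -- The three summands of `errorConst` are its three constants.
  refine le_mul_of_interpolation (A := l * L ^ 12) hy0 (by positivity) (by positivity)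
    (by positivity) ?_ fun hA => ?_
  · rw [hyx]
    refine herr.trans ?_
    rw [hkr]
    set A := l * L ^ 12 with hAdef
    have hA0 : 0 ≤ A := by positivity
    have e1 : 4 * l * (P * L ^ 2) ^ 7 ≤ 4 * P ^ 7 * A * x := by
      have : 4 * l * (P * L ^ 2) ^ 7 = 4 * P ^ 7 * A * L ^ 2 := by rw [hAdef]; ring
      rw [this]; exact mul_le_mul_of_nonneg_left (by linarith) (by positivity)
    have e2 : 2 * (r * l) * (P * L ^ 2) ^ 6 ≤ 2 * P ^ 6 * A * x := by
      have : 2 * (r * l) * (P * L ^ 2) ^ 6 = 2 * P ^ 6 * A * r := by rw [hAdef]; ring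
      rw [this]; exact mul_le_mul_of_nonneg_left (by linarith) (by positivity)
    have e3 : a * (r * l + 12 * l * (P * L ^ 2)) ≤ C * (1 + 12 * P) * A * x := by
      calc a * (r * l + 12 * l * (P * L ^ 2))
          ≤ C * L ^ 12 * (r * l + 12 * l * (P * L ^ 2)) :=
            mul_le_mul_of_nonneg_right hupper (by positivity)
        _ = C * A * (r + 12 * P * L ^ 2) := by rw [hAdef]; ring
        _ ≤ C * A * (x + 12 * P * x) := by
            refine mul_le_mul_of_nonneg_left (add_le_add (by linarith) ?_) (by positivity)
            exact mul_le_mul_of_nonneg_left (by linarith) (by positivity)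
        _ = C * (1 + 12 * P) * A * x := by ring
    have e4 : l * a ^ 2 ≤ C ^ 2 * A * x := by
      have hL12 : L ^ 12 ≤ L ^ 2 := pow_le_pow_of_le_one hl0.le hl1 (by norm_num)
      calc l * a ^ 2 ≤ l * (C * L ^ 12) ^ 2 :=
            mul_le_mul_of_nonneg_left (pow_le_pow_left₀ ha0 hupper 2) hl_nonneg
        _ = C ^ 2 * A * L ^ 12 := by rw [hAdef]; ring
        _ ≤ C ^ 2 * A * x := mul_le_mul_of_nonneg_left (by linarith) (by positivity)
    linarith
  · have hlpos : 0 < l := hl_nonneg.lt_of_ne fun h0 => by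
      rw [← h0, zero_mul] at hA; exact hA.false
    -- The decay bound is useful when at least half of the edges are not corners. Otherwise `x` is
    -- bounded below and the trivial bound `2` is absorbed by the constant `4`.
    rcases le_or_gt r (1 / 2) with hr2 | hr2
    · have hm : l / 2 ≤ ((nonCorner γ).card : ℝ) := by
        have : ((nonCorner γ).card : ℝ) + k = l := by rw [hk, hl]; exact_mod_cast hcard
        nlinarith
      have hmpos : 0 < (nonCorner γ).card := by
        have : (0 : ℝ) < (nonCorner γ).card := by linarith
        exact_mod_cast this
      have hcA : 0 < c * (l * L ^ 12) := by positivity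
      have hla : c * (l * L ^ 12) ≤ l * a := by
        have := mul_le_mul_of_nonneg_left hlower hl_nonneg; linarith
      have hd := hdecay hmpos
      have e1 : Real.exp (-(a * ((nonCorner γ).card / 2))) ≤ 4 / (c * (l * L ^ 12)) := by
        have h4 : 0 < c * (l * L ^ 12) / 4 := by positivity
        refine le_trans (Real.exp_le_exp.2 (neg_le_neg ?_)) ((exp_neg_le_inv h4).trans_eq ?_)
        · have := mul_le_mul_of_nonneg_left hm ha0; linarith
        · field_simp
      have e2 : Real.exp (-(l * a)) ≤ 1 / (c * (l * L ^ 12)) :=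
        (Real.exp_le_exp.2 (neg_le_neg hla)).trans (exp_neg_le_inv hcA)
      have e3 : 24 * (P * L ^ 2) ≤ 48 * P * √x := by
        have h2 : √x ^ 2 ≤ 2 * √x := by rw [sq]; exact mul_le_mul_of_nonneg_right hy2 hy0
        have h3 : L ^ 2 ≤ 2 * √x := by linarith
        have := mul_le_mul_of_nonneg_left h3 (by positivity : 0 ≤ 24 * P)
        linarith
      have e4 : 5 / c / (l * L ^ 12) = 4 / (c * (l * L ^ 12)) + 1 / (c * (l * L ^ 12)) := by
        field_simp; norm_num
      rw [e4]
      linarith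
    · have hsq : 1 / 4 ≤ x := by linarith
      have hy : 1 / 2 ≤ √x := Real.le_sqrt_of_sq_le (by linarith)
      have e1 : Real.exp (-(l * a)) ≤ 1 := Real.exp_le_one_iff.2 (by
        have := mul_nonneg hl_nonneg ha0; linarith)
      have e2 : 0 ≤ 5 / c / (l * L ^ 12) := by positivity
      have e3 : 0 ≤ P * √x := by positivity
      linarith

theorem exists_abs_le (γ : OneChain) : ∃ M : ℕ, ∀ e ∈ γ.support, ∀ l, |e.1 l| ≤ M := by
  refine ⟨γ.support.sup fun e => Finset.univ.sup fun l => (e.1 l).natAbs, fun e he l => ?_⟩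
  rw [Int.abs_eq_natAbs]
  have h1 := Finset.le_sup (f := fun l => (e.1 l).natAbs) (Finset.mem_univ l)
  have h2 := Finset.le_sup (f := fun e : Edge => Finset.univ.sup fun l => (e.1 l).natAbs) he
  exact_mod_cast h1.trans h2

end MainEstimate

end LatticeGauge

/-! ### Choice of constants and passage to the infinite volume limit. -/

theorem theorem1p1 (n : ℕ) [NeZero n] (hn : 2 ≤ n)
    (ρ : AddChar (ZMod n) ℂ) (hρ : Function.Injective ρ) :
    ∃ b : ℝ, 0 < b ∧ ∀ β₀ : ℝ, b ≤ β₀ →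
      ∃ K' K'' : ℝ, 0 < K' ∧ 0 < K'' ∧
        ∀ β : ℝ, β₀ ≤ β →
          ∀ γ : LatticeGauge.OneChain, LatticeGauge.IsGeneralizedLoop γ →
            Filter.Tendsto (LatticeGauge.finiteVolumeWilson ρ β γ) Filter.atTop
              (nhds (LatticeGauge.infiniteVolumeWilson ρ β γ)) ∧
            ‖LatticeGauge.infiniteVolumeWilson ρ β γ
                - Complex.exp (-(LatticeGauge.loopLength γ : ℂ) * (1 - LatticeGauge.theta ρ β))‖
              ≤ K' * (√((LatticeGauge.cornerCount γ : ℝ) / (LatticeGauge.loopLength γ : ℝ))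
                  + LatticeGauge.lam ρ β ^ 2) ^ K'' := by
  have hn1 : (1 : ℝ) ≤ n := by exact_mod_cast (by omega : 1 ≤ n)
  -- This threshold for `λ` makes the Peierls parameter at most `1/2`, so that the geometric series
  -- converge, and it forces `1 - θ ≤ 1`.
  obtain ⟨b, hb0, hb⟩ := LatticeGauge.exists_lam_le hn hρ
    (ε := 1 / (2 * (14406 * 486 ^ 2 * n))) (by positivity)
  refine ⟨b, hb0, fun β₀ hβ₀ => ⟨LatticeGauge.errorConst n, 1 / 2, ?_, by norm_num, ?_⟩⟩
  · have := LatticeGauge.one_sub_cos_pos hn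
    unfold LatticeGauge.errorConst
    positivity
  intro β hβ γ hγ
  obtain ⟨hl0, hlε⟩ := hb β (hβ₀.trans hβ)
  have hβ0 : 0 < β := hb0.trans_le (hβ₀.trans hβ)
  rw [le_div_iff₀ (by positivity)] at hlε
  have hl1 : LatticeGauge.lam ρ β ≤ 1 := by nlinarith
  have hpow : ∀ k : ℕ, k ≠ 0 → LatticeGauge.lam ρ β ^ k ≤ LatticeGauge.lam ρ β :=
    fun k hk => pow_le_of_le_one hl0.le hl1 hk
  have hpei : LatticeGauge.peierls ρ β ≤ 1 / 2 := by
    have := mul_le_mul_of_nonneg_left (hpow 2 two_ne_zero)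
      (by positivity : (0 : ℝ) ≤ 14406 * 486 ^ 2 * n)
    unfold LatticeGauge.peierls
    linarith
  have htheta : LatticeGauge.oneSubTheta ρ β ≤ 1 := by
    have h1 := LatticeGauge.oneSubTheta_le (ρ := ρ) (β := β)
    have h2 := mul_le_mul_of_nonneg_left (hpow 12 (by norm_num)) (by positivity : 0 ≤ 2 * (n : ℝ))
    have h3 : 0 ≤ LatticeGauge.lam ρ β * n := by positivity
    linarith
  obtain ⟨M, hM⟩ := LatticeGauge.exists_abs_le γ
  have hlim := LatticeGauge.tendsto_finiteVolumeWilson ρ hβ0.le (γ := γ) (N₀ := M + 1)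
    fun e he => LatticeGauge.mem_boxEdges_of_abs_le hM (by omega) he
  refine ⟨hlim, ?_⟩
  rw [← Real.sqrt_eq_rpow]
  -- The finite-volume bound does not depend on `N` once the box contains the loop with margin `26`,
  -- so it passes to the limit.
  refine le_of_tendsto (hlim.sub_const _).norm ?_
  filter_upwards [Filter.eventually_ge_atTop (M + 26)] with N hN
  exact LatticeGauge.norm_finiteVolumeWilson_sub_le_sqrt hn hρ hβ0 hl0 hl1 hpei htheta hγ hM hN
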